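/- Let $P\subset\mathbb R^2$ be a closed region bounded by a simple polygon with $n$ sides. Points $x,y\in P$ see each other if the segment $xy$ lies in $P$. Assume that $P$ is a street polygon: its boundary can be split at two points into two chains $U,D$ such that each point of $U$ is visible from some point of $D$ and vice versa. Let $C\subseteq P$ be a simple polygonal path with $k\ge 1$ vertices (a collapsed watchman route) such that every $x\in P$ is visible from some point of $C$ and, for every $x\in P$, the set of points of $C$ visible from $x$ is connected (chain-visibility). Let $m\ge 1$ be the number of robots and $t_m>0$ the measurement time. Assume that finitely many points of $C$ suffice to see all of $P$, and let $g$ be the least number of such points. A feasible solution consists of $m$ connected subpaths $\Pi_1,\dots,\Pi_m$ of $C$ (single points allowed) and finite sets of viewpoints $V_i\subset\Pi_i$ such that every point of $P$ is visible from some point of $\bigcup_i V_i$. The cost of the $i$-th path is $\ell(\Pi_i)+|V_i|\,t_m$, where $\ell$ is arc length. Let $T^*$ be the infimum, over all feasible solutions, of the maximum cost of a path. Theorem. There are a single real RAM program (unit-cost $+,-,\cdot,/,\sqrt{\ }$ and comparisons on reals; unit-cost addition, subtraction, comparison and array indexing with natural numbers; no rounding; only natural numbers as constants) and constants $c,d\in\mathbb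 N$ such that, for every such input (the vertices of $P$ and of $C$, and $n$, $k$, $m$, $t_m$), the program halts after at most $$c\,(n+k+m+g)^d\,\bigl(1+\log_2(T^*/t_m)\bigr)$$ steps and outputs a feasible solution whose maximum path cost is at most $4\,T^*$. -/

import Mathlib

open Set

/-! ### The real random access machine

Structured programs over finitely many natural-number variables, real variables, arrays of
natural numbers and arrays of reals. The arithmetic operations `+, -, *, /, √` on reals, the
operations `+, -` on naturals, array accesses and comparisons all cost one unit. There is no
rounding operation, no multiplication of naturals, and the only constants are natural numbers. -/

namespace RealRAM

/-- A memory configuration: variables and arrays, each named by a natural number. -/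
structure State where
  nat : ℕ → ℕ
  real : ℕ → ℝ
  natArr : ℕ → ℕ → ℕ
  realArr : ℕ → ℕ → ℝ

/-- Unit-cost instructions; the arguments are names of variables and arrays, the target first. -/
inductive Instr where
  /-- `nat a := c` -/
  | natConst (a c : ℕ)
  /-- `nat a := nat b + nat c` -/
  | natAdd (a b c : ℕ)
  /-- `nat a := nat b - nat c` (truncated at zero) -/
  | natSub (a b c : ℕ)
  /-- `nat a := natArr A [nat i]` -/
  | natLoad (a A i : ℕ)
  /-- `natArr A [nat i] := nat a` -/
  | natStore (A i a : ℕ)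
  /-- `real a := c` -/
  | realConst (a c : ℕ)
  /-- `real a := real b + real c` -/
  | realAdd (a b c : ℕ)
  /-- `real a := real b - real c` -/
  | realSub (a b c : ℕ)
  /-- `real a := real b * real c` -/
  | realMul (a b c : ℕ)
  /-- `real a := real b / real c` (division by zero gives zero) -/
  | realDiv (a b c : ℕ)
  /-- `real a := √(real b)` (zero if `real b` is negative) -/
  | realSqrt (a b : ℕ)
  /-- `real a := realArr A [nat i]` -/
  | realLoad (a A i : ℕ)
  /-- `realArr A [nat i] := real a` -/
  | realStore (A i a : ℕ)

/-- The effect of one instruction. -/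
noncomputable def Instr.apply (σ : State) : Instr → State
  | .natConst a c => { σ with nat := Function.update σ.nat a c }
  | .natAdd a b c => { σ with nat := Function.update σ.nat a (σ.nat b + σ.nat c) }
  | .natSub a b c => { σ with nat := Function.update σ.nat a (σ.nat b - σ.nat c) }
  | .natLoad a A i => { σ with nat := Function.update σ.nat a (σ.natArr A (σ.nat i)) }
  | .natStore A i a =>
      { σ with natArr :=
          Function.update σ.natArr A (Function.update (σ.natArr A) (σ.nat i) (σ.nat a)) }
  | .realConst a c => { σ with real := Function.update σ.real a (c : ℝ) }
  | .realAdd a b c => { σ with real := Function.update σ.real a (σ.real b + σ.real c) }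
  | .realSub a b c => { σ with real := Function.update σ.real a (σ.real b - σ.real c) }
  | .realMul a b c => { σ with real := Function.update σ.real a (σ.real b * σ.real c) }
  | .realDiv a b c => { σ with real := Function.update σ.real a (σ.real b / σ.real c) }
  | .realSqrt a b => { σ with real := Function.update σ.real a (Real.sqrt (σ.real b)) }
  | .realLoad a A i => { σ with real := Function.update σ.real a (σ.realArr A (σ.nat i)) }
  | .realStore A i a =>
      { σ with realArr :=
          Function.update σ.realArr A (Function.update (σ.realArr A) (σ.nat i) (σ.real a)) }

/-- Tests on two variables. -/
inductive Test where
  | natLt (a b : ℕ)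
  | natLe (a b : ℕ)
  | realLt (a b : ℕ)
  | realLe (a b : ℕ)

/-- The truth of a test in a memory configuration. -/
def Test.Holds (σ : State) : Test → Prop
  | .natLt a b => σ.nat a < σ.nat b
  | .natLe a b => σ.nat a ≤ σ.nat b
  | .realLt a b => σ.real a < σ.real b
  | .realLe a b => σ.real a ≤ σ.real b

/-- Programs. -/
inductive Program where
  | skip
  | basic (i : Instr)
  | seq (p q : Program)
  | ifThenElse (b : Test) (p q : Program)
  | whileDo (b : Test) (p : Program)

/-- `Exec p σ t τ`: started in `σ`, the program `p` halts after exactly `t` steps in `τ`. -/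
inductive Exec : Program → State → ℕ → State → Prop where
  | skip (σ : State) : Exec .skip σ 1 σ
  | basic (i : Instr) (σ : State) : Exec (.basic i) σ 1 (i.apply σ)
  | seq {p q : Program} {σ τ υ : State} {s t : ℕ} :
      Exec p σ s τ → Exec q τ t υ → Exec (.seq p q) σ (s + t) υ
  | ifTrue {b : Test} {p q : Program} {σ τ : State} {t : ℕ} :
      b.Holds σ → Exec p σ t τ → Exec (.ifThenElse b p q) σ (t + 1) τ
  | ifFalse {b : Test} {p q : Program} {σ τ : State} {t : ℕ} :
      ¬ b.Holds σ → Exec q σ t τ → Exec (.ifThenElse b p q) σ (t + 1) τ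
  | whileFalse {b : Test} {p : Program} {σ : State} :
      ¬ b.Holds σ → Exec (.whileDo b p) σ 1 σ
  | whileTrue {b : Test} {p : Program} {σ τ υ : State} {s t : ℕ} :
      b.Holds σ → Exec p σ s τ → Exec (.whileDo b p) τ t υ →
        Exec (.whileDo b p) σ (s + t + 1) υ

end RealRAM

/-! ### Polygons, visibility and curves -/

namespace Watchmen

/-- The Euclidean plane. -/
abbrev Plane := EuclideanSpace ℝ (Fin 2)

/-- The polygonal curve through `v 0, v 1, v 2, …`, parametrized so that the vertex `v i` is the
point at parameter `i` and each edge is run through at constant speed. -/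
noncomputable def polyline (v : ℕ → Plane) (s : ℝ) : Plane :=
  AffineMap.lineMap (v ⌊s⌋₊) (v (⌊s⌋₊ + 1)) (Int.fract s)

/-- The edge from `a` to `b` (closed below, open above) meets the open horizontal ray that starts
at `p` and points to the right. -/
def CrossesRay (p a b : Plane) : Prop :=
  ((a 1 ≤ p 1 ∧ p 1 < b 1) ∨ (b 1 ≤ p 1 ∧ p 1 < a 1)) ∧
    ∃ q ∈ segment ℝ a b, q 1 = p 1 ∧ p 0 < q 0

/-- The closed region bounded by a simple polygon: the boundary together with the interior, which
is given by the even-odd rule. -/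
def region {n : ℕ} (P : Polygon Plane n) : Set Plane :=
  P.boundary ℝ ∪ {p | Odd {i : Fin n | CrossesRay p (P i) (P (finRotate n i))}.ncard}

/-- The boundary of a polygon, parametrized over `[0, n]`. -/
noncomputable def boundaryParam {n : ℕ} [NeZero n] (P : Polygon Plane n) : ℝ → Plane :=
  polyline fun i => P (Fin.ofNat n i)

/-- The boundary is a simple closed curve. -/
def IsSimplePolygon {n : ℕ} [NeZero n] (P : Polygon Plane n) : Prop :=
  3 ≤ n ∧ InjOn (boundaryParam P) (Ico 0 (n : ℝ))

/-- The visibility polygon of `p` in the closed region `R`. -/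
def visibilityPolygon (R : Set Plane) (p : Plane) : Set Plane :=
  {x | segment ℝ p x ⊆ R}

/-- Every point of `A` is visible in `R` from some point of `B`. -/
def WeaklyVisible (R A B : Set Plane) : Prop :=
  ∀ x ∈ A, ∃ y ∈ B, x ∈ visibilityPolygon R y

/-- A street polygon: a simple polygon whose boundary can be split at two points into two chains
`U` and `D` such that each point of either chain is visible from some point of the other one. -/
def IsStreetPolygon {n : ℕ} [NeZero n] (P : Polygon Plane n) : Prop :=
  IsSimplePolygon P ∧ ∃ a b : ℝ, 0 ≤ a ∧ a < b ∧ b < n ∧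
    ∃ U D : Set Plane, U = boundaryParam P '' Icc a b ∧
      D = boundaryParam P '' (Icc 0 a ∪ Icc b n) ∧
      WeaklyVisible (region P) U D ∧ WeaklyVisible (region P) D U

/-- The data of an instance: a polygon with `n` sides, a polygonal curve with `k` vertices, the
number `m` of robots and the measurement time `tm`. -/
structure Instance where
  n : ℕ
  k : ℕ
  m : ℕ
  [n_ne : NeZero n]
  [k_ne : NeZero k]
  [m_ne : NeZero m]
  polygon : Polygon Plane n
  chain : Fin k → Plane
  tm : ℝ
  tm_pos : 0 < tm

attribute [instance] Instance.n_ne Instance.k_ne Instance.m_ne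

namespace Instance

variable (I : Instance)

/-- The polygonal environment. -/
def P : Set Plane := region I.polygon

/-- The given curve as a parametrized curve; its parameter interval is `params`. -/
noncomputable def curve : ℝ → Plane := polyline fun j => I.chain (Fin.ofNat I.k j)

/-- The parameter interval `[0, k - 1]` of the curve with `k` vertices. -/
def params : Set ℝ := Icc 0 ((I.k : ℝ) - 1)

/-- The curve as a point set. -/
def C : Set Plane := I.curve '' I.params

/-- The curve is a simple polygonal path inside `P`, every point of `P` is visible from it, and
the part of the curve visible from any given point of `P` is a connected chain. -/
def IsChainVisibleWatchmanCurve : Prop :=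
  InjOn I.curve I.params ∧ I.C ⊆ I.P ∧
    ∀ x ∈ I.P, IsConnected (visibilityPolygon I.P x ∩ I.C)

/-- The points of the curve with parameters in `V` together see all of `P`. -/
def SeesAll (V : Set ℝ) : Prop :=
  ∀ x ∈ I.P, ∃ s ∈ V, x ∈ visibilityPolygon I.P (I.curve s)

/-- The sizes of the finite sets of viewpoints on the curve that see all of `P`. -/
def viewpointCounts : Set ℕ :=
  {g | ∃ V : Finset ℝ, (V : Set ℝ) ⊆ I.params ∧ I.SeesAll V ∧ V.card = g}

/-- The least number of viewpoints on the curve that together see all of `P`. -/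
noncomputable def minViewpoints : ℕ := sInf I.viewpointCounts

/-- `m` subpaths of the curve, given by the parameters of their first and last points, each with
a finite set of viewpoints. -/
structure Plan where
  first : Fin I.m → ℝ
  last : Fin I.m → ℝ
  views : Fin I.m → Finset ℝ

variable {I}

/-- Each path is a nonempty subpath of the curve, its viewpoints lie on it, and all viewpoints
together see all of `P`. -/
def Plan.IsFeasible (S : I.Plan) : Prop :=
  (∀ i, S.first i ∈ I.params ∧ S.last i ∈ I.params ∧ S.first i ≤ S.last i ∧
    (S.views i : Set ℝ) ⊆ Icc (S.first i) (S.last i)) ∧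
  I.SeesAll (⋃ i, (S.views i : Set ℝ))

/-- The arc length of the `i`-th path. -/
noncomputable def Plan.length (S : I.Plan) (i : Fin I.m) : ℝ :=
  (eVariationOn I.curve (Icc (S.first i) (S.last i))).toReal

/-- Length plus measurement time of the `i`-th path. -/
noncomputable def Plan.cost (S : I.Plan) (i : Fin I.m) : ℝ :=
  S.length i + (S.views i).card * I.tm

/-- The objective: the maximum cost of a path. -/
noncomputable def Plan.maxCost (S : I.Plan) : ℝ := ⨆ i, S.cost i

variable (I)

/-- The optimal value. -/
noncomputable def optCost : ℝ := sInf {c | ∃ S : I.Plan, S.IsFeasible ∧ S.maxCost = c}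

/-- The input memory. Natural variables `0, 1, 2` hold `n, k, m`, real variable `0` holds the
measurement time, real arrays `0, 1` hold the coordinates of the vertices of the polygon, and real
arrays `2, 3` those of the vertices of the curve. Everything else is zero. -/
noncomputable def input : RealRAM.State where
  nat a := if a = 0 then I.n else if a = 1 then I.k else if a = 2 then I.m else 0
  real a := if a = 0 then I.tm else 0
  natArr _ _ := 0
  realArr A i :=
    if A = 0 ∧ i < I.n then I.polygon (Fin.ofNat I.n i) 0
    else if A = 1 ∧ i < I.n then I.polygon (Fin.ofNat I.n i) 1
    else if A = 2 ∧ i < I.k then I.chain (Fin.ofNat I.k i) 0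
    else if A = 3 ∧ i < I.k then I.chain (Fin.ofNat I.k i) 1
    else 0

/-- Reading the output from memory. Real arrays `4, 5` hold the parameters of the first and last
points of the paths. The parameters of the viewpoints of path `i` form the block of real array `6`
whose starting index and length are entry `i` of the natural arrays `0` and `1`. -/
noncomputable def output (σ : RealRAM.State) : I.Plan where
  first i := σ.realArr 4 i
  last i := σ.realArr 5 i
  views i := (Finset.range (σ.natArr 1 i)).image fun j => σ.realArr 6 (σ.natArr 0 i + j)

end Instance

end Watchmen

/-!
The program is a greedy search with doubling budgets. Its first budget per robot is the measurement
time. With a budget `B`, the robots are used one after the other along the curve, and each robot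
always moves as far as possible: to the last position at which no point of the region is lost, or
to the point where `B` is used up. When the robots in use have exhausted `B` and no further robot
is left, the search starts again with `2 * B`.

*The factor four.* In a plan with costs at most `T` the paths may overlap, but its viewpoints can be
divided anew into consecutive groups at the price of one more measurement per robot
(`exists_consecutive`, `exists_isOrderedSolution`). So a budget `B` with `T + tm ≤ B` admits a
solution in which the robots are ordered along the curve. The greedy search is never behind such a
solution (`Ahead`): by chain-visibility, a point of the region is seen from an interval of
parameters, and therefore any solution must have a viewpoint after the last greedy viewpoint and up
to the next greedy position (`exists_mem_le_next`). Hence a failing budget is less than `T + tm`,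
and since `tm ≤ T*`, the final budget is at most `2 * (T* + tm) ≤ 4 * T*`, after about
`log₂ (T* / tm)` doublings.
With a fixed budget, every step passes a viewpoint of a fixed minimal hitting set, or uses up the
budget of a robot, or starts a new robot (`potential`), so that there are at most `g + 2 * m`
steps.

*The next position.* If the last viewpoint has parameter `f`, the next position is the largest
parameter `s` such that no point of the region is seen only from between `f` and `s`
(`Gap`, `next_spec`). Finding it exactly is the geometric core. Whether two points see each other
is determined by the signs of finitely many affine forms at the two points and of the forms
`G(y) F(x) - F(y) G(x)` (`Vis.congr`). For fixed `f` and `s` the zero sets of these forms are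
the lines of an arrangement in the plane, and being seen only from between `f` and `s` is
constant on its cells. Every cell in the region contains the centroid of four vertices of the
arrangement, counted with multiplicity, so that `Gap f s` can be tested at finitely many points
(`gap_iff`). While `s` moves along an edge of the curve, the arrangement changes combinatorially
only when the determinant of three of its forms changes sign. These determinants are quadratic
polynomials in `s` (`tri_quadratic`), so that the next position is a vertex of the curve or one of
polynomially many roots of quadratic polynomials (`Gap.transfer`), each of which can be tested.

*The program.* The functions and predicates involved are built from the input by arithmetic, square
roots, comparisons and bounded loops. Classes of functions computable in polynomial time by the
random access machine (`RC`, `NC`, `BC`) are closed under these constructions (the central case is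
`RC.fold`), which yields programs for one step of the search (`exists_stepProgram`) and for the
whole search (`exists_program`).
-/

/-! ### Verified programs for the random access machine -/

namespace RealRAM

/-- The program `p` started in `σ` halts within `T` steps, in a configuration satisfying `Q`. -/
def Runs (p : Program) (σ : State) (T : ℕ) (Q : State → Prop) : Prop :=
  ∃ t τ, Exec p σ t τ ∧ t ≤ T ∧ Q τ

theorem Runs.mono {p : Program} {σ : State} {T T' : ℕ} {Q Q' : State → Prop}
    (h : Runs p σ T Q) (hT : T ≤ T') (hQ : ∀ τ, Q τ → Q' τ) : Runs p σ T' Q' := by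
  obtain ⟨t, τ, h1, h2, h3⟩ := h
  exact ⟨t, τ, h1, h2.trans hT, hQ τ h3⟩

theorem Runs.basic (i : Instr) {σ : State} {Q : State → Prop} (h : Q (i.apply σ)) :
    Runs (.basic i) σ 1 Q :=
  ⟨1, _, .basic i σ, le_rfl, h⟩

theorem Runs.seq {p q : Program} {σ : State} {T T' : ℕ} {Q R : State → Prop}
    (h : Runs p σ T Q) (h' : ∀ τ, Q τ → Runs q τ T' R) : Runs (.seq p q) σ (T + T') R := by
  obtain ⟨t, τ, h1, h2, h3⟩ := h
  obtain ⟨t', τ', h1', h2', h3'⟩ := h' τ h3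
  exact ⟨t + t', τ', .seq h1 h1', by omega, h3'⟩

theorem Runs.ite {b : Test} {p q : Program} {σ : State} {T : ℕ} {Q : State → Prop}
    (h : b.Holds σ → Runs p σ T Q) (h' : ¬ b.Holds σ → Runs q σ T Q) :
    Runs (.ifThenElse b p q) σ (T + 1) Q := by
  by_cases hb : b.Holds σ
  · obtain ⟨t, τ, h1, h2, h3⟩ := h hb
    exact ⟨t + 1, τ, .ifTrue hb h1, by omega, h3⟩
  · obtain ⟨t, τ, h1, h2, h3⟩ := h' hb
    exact ⟨t + 1, τ, .ifFalse hb h1, by omega, h3⟩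

/-- A loop with a natural-number variant: the variant `v` decreases with every execution of the
body. -/
theorem Runs.while {b : Test} {p : Program} {T : ℕ} {Inv : ℕ → State → Prop}
    (h : ∀ v σ, Inv v σ → b.Holds σ → Runs p σ T (fun τ => ∃ v' < v, Inv v' τ))
    (v : ℕ) (σ : State) (hv : Inv v σ) :
    Runs (.whileDo b p) σ (v * (T + 1) + 1) (fun τ => (∃ v', Inv v' τ) ∧ ¬ b.Holds τ) := by
  induction v using Nat.strong_induction_on generalizing σ with
  | _ v ih =>
    by_cases hb : b.Holds σ
    · obtain ⟨t, τ, h1, h2, v', hv', h3⟩ := h v σ hv hb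
      obtain ⟨t', τ', h1', h2', h3'⟩ := ih v' hv' τ h3
      refine ⟨t + t' + 1, τ', .whileTrue hb h1 h1', ?_, h3'⟩
      have : (v' + 1) * (T + 1) ≤ v * (T + 1) := Nat.mul_le_mul_right _ hv'
      rw [Nat.add_mul] at this
      omega
    · exact ⟨1, σ, .whileFalse hb, by omega, ⟨v, hv⟩, hb⟩

/-- A loop that is executed exactly `N` times. -/
theorem Runs.while_count {b : Test} {p : Program} {T N : ℕ} {Inv : ℕ → State → Prop}
    (h : ∀ j < N, ∀ σ, Inv j σ → Runs p σ T (Inv (j + 1)))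
    (hb : ∀ j ≤ N, ∀ σ, Inv j σ → (b.Holds σ ↔ j < N)) (σ : State) (h0 : Inv 0 σ) :
    Runs (.whileDo b p) σ (N * (T + 1) + 1) (Inv N) := by
  refine (Runs.while (Inv := fun v τ => ∃ j, j + v = N ∧ Inv j τ) (b := b) (p := p) (T := T)
    ?_ N σ ⟨0, by simp, h0⟩).mono le_rfl ?_
  · rintro v τ ⟨j, hj, hi⟩ hh
    have hjN : j < N := (hb j (by omega) τ hi).1 hh
    exact (h j hjN τ hi).mono le_rfl fun υ hυ => ⟨v - 1, by omega, j + 1, by omega, hυ⟩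
  · rintro τ ⟨⟨v, j, hj, hi⟩, hh⟩
    have : j = N := by
      by_contra hne
      exact hh ((hb j (by omega) τ hi).2 (by omega))
    exact this ▸ hi

/-- The configurations agree on all variables below `L` and on all arrays. -/
def Agree (L : ℕ) (σ τ : State) : Prop :=
  (∀ i < L, τ.nat i = σ.nat i) ∧ (∀ i < L, τ.real i = σ.real i) ∧
    τ.natArr = σ.natArr ∧ τ.realArr = σ.realArr

theorem Agree.trans {L : ℕ} {σ τ υ : State} (h : Agree L σ τ) (h' : Agree L τ υ) :
    Agree L σ υ :=
  ⟨fun i hi => (h'.1 i hi).trans (h.1 i hi), fun i hi => (h'.2.1 i hi).trans (h.2.1 i hi),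
    h'.2.2.1.trans h.2.2.1, h'.2.2.2.trans h.2.2.2⟩

theorem Agree.mono {L L' : ℕ} {σ τ : State} (h : Agree L σ τ) (hL : L' ≤ L) : Agree L' σ τ :=
  ⟨fun i hi => h.1 i (by omega), fun i hi => h.2.1 i (by omega), h.2.2.1, h.2.2.2⟩

theorem Agree.update_real (σ : State) {L x : ℕ} (hx : L ≤ x) (v : ℝ) :
    Agree L σ { σ with real := Function.update σ.real x v } :=
  ⟨fun _ _ => rfl, fun i hi => Function.update_of_ne (by omega) _ _, rfl, rfl⟩

theorem Agree.update_nat (σ : State) {L x : ℕ} (hx : L ≤ x) (v : ℕ) :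
    Agree L σ { σ with nat := Function.update σ.nat x v } :=
  ⟨fun i hi => Function.update_of_ne (by omega) _ _, fun _ _ => rfl, rfl, rfl⟩

/-- A way of representing a value `a : α` in memory. The representation uses only variables below
`lvl`, and arrays. Every value comes with a problem instance, whose data are stored in the places
fixed by the input format, and with a size, in which running times are measured. -/
structure Layout (α : Type) where
  inst : α → Watchmen.Instance
  size : α → ℕ
  rep : α → State → Prop
  lvl : ℕ
  lvl_ge : 3 ≤ lvl
  size_ge : ∀ a, (inst a).n + (inst a).k + (inst a).m ≤ size a
  stable : ∀ {a σ τ}, rep a σ → Agree lvl σ τ → rep a τ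
  base_nat : ∀ {a σ}, rep a σ → ∀ i < 3, σ.nat i = (inst a).input.nat i
  base_real : ∀ {a σ}, rep a σ → σ.real 0 = (inst a).input.real 0
  base_arr : ∀ {a σ}, rep a σ → ∀ A < 4, σ.realArr A = (inst a).input.realArr A

variable {α : Type}

theorem Layout.two_le_size (Λ : Layout α) (a : α) : 2 ≤ Λ.size a := by
  have := Λ.size_ge a
  have := NeZero.pos (Λ.inst a).n
  have := NeZero.pos (Λ.inst a).k
  omega

theorem mul_pow_le_pow_add {S : ℕ} (hS : 2 ≤ S) (c b : ℕ) : c * S ^ b ≤ S ^ (b + c) := by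
  have h1 : c ≤ S ^ c := (Nat.lt_pow_self (by omega)).le
  calc c * S ^ b ≤ S ^ c * S ^ b := Nat.mul_le_mul_right _ h1
    _ = S ^ (b + c) := by rw [pow_add, mul_comm]

/-- A sum of up to three powers and small constants is bounded by one power. -/
theorem add_pow_le_pow {S : ℕ} (hS : 2 ≤ S) (a b c e : ℕ) :
    S ^ a + S ^ b + S ^ c + e ≤ S ^ (a + b + c + (3 + e)) := by
  refine le_trans ?_ (mul_pow_le_pow_add hS (3 + e) (a + b + c))
  have h1 : S ^ a ≤ S ^ (a + b + c) := Nat.pow_le_pow_right (by omega) (by omega)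
  have h2 : S ^ b ≤ S ^ (a + b + c) := Nat.pow_le_pow_right (by omega) (by omega)
  have h3 : S ^ c ≤ S ^ (a + b + c) := Nat.pow_le_pow_right (by omega) (by omega)
  have h4 : e ≤ e * S ^ (a + b + c) := Nat.le_mul_of_pos_right _ (by positivity)
  calc _ ≤ S ^ (a + b + c) + S ^ (a + b + c) + S ^ (a + b + c) + e * S ^ (a + b + c) := by omega
    _ = _ := by ring

/-- The real-valued function `f` is computable in polynomial time: for every level `L` some program
writes the value to variable `L` and leaves the variables below `L` and the arrays unchanged. -/
def RC (Λ : Layout α) (f : α → ℝ) : Prop :=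
  ∀ L ≥ Λ.lvl, ∃ p b, ∀ a σ, Λ.rep a σ →
    Runs p σ (Λ.size a ^ b) (fun τ => τ.real L = f a ∧ Agree L σ τ)

/-- The natural-number-valued function `f` is polynomially bounded and computable in polynomial
time. -/
def NC (Λ : Layout α) (f : α → ℕ) : Prop :=
  (∃ b, ∀ a σ, Λ.rep a σ → f a ≤ Λ.size a ^ b) ∧
  ∀ L ≥ Λ.lvl, ∃ p b, ∀ a σ, Λ.rep a σ →
    Runs p σ (Λ.size a ^ b) (fun τ => τ.nat L = f a ∧ Agree L σ τ)

open Classical in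
/-- The predicate `φ` is decidable in polynomial time. -/
def BC (Λ : Layout α) (φ : α → Prop) : Prop :=
  RC Λ (fun a => if φ a then 1 else 0)

/-- The layout extended by a natural-number variable with values below `N`. -/
def Layout.natExt (Λ : Layout α) (x : ℕ) (N : α → ℕ) : Layout (α × ℕ) where
  inst p := Λ.inst p.1
  size p := Λ.size p.1
  rep p σ := Λ.rep p.1 σ ∧ σ.nat x = p.2 ∧ p.2 < N p.1
  lvl := max Λ.lvl (x + 1)
  lvl_ge := le_max_of_le_left Λ.lvl_ge
  size_ge p := Λ.size_ge p.1
  stable h h' := ⟨Λ.stable h.1 (h'.mono (le_max_left _ _)),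
    (h'.1 x (by omega)).trans h.2.1, h.2.2⟩
  base_nat h := Λ.base_nat h.1
  base_real h := Λ.base_real h.1
  base_arr h := Λ.base_arr h.1

/-- The layout extended by a real variable. -/
def Layout.realExt (Λ : Layout α) (x : ℕ) : Layout (α × ℝ) where
  inst p := Λ.inst p.1
  size p := Λ.size p.1
  rep p σ := Λ.rep p.1 σ ∧ σ.real x = p.2
  lvl := max Λ.lvl (x + 1)
  lvl_ge := le_max_of_le_left Λ.lvl_ge
  size_ge p := Λ.size_ge p.1
  stable h h' := ⟨Λ.stable h.1 (h'.mono (le_max_left _ _)), (h'.2.1 x (by omega)).trans h.2⟩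
  base_nat h := Λ.base_nat h.1
  base_real h := Λ.base_real h.1
  base_arr h := Λ.base_arr h.1

variable {Λ : Layout α} {f g : α → ℝ} {φ ψ : α → Prop} {M N : α → ℕ}

theorem RC.congr (h : RC Λ f) (hfg : ∀ a, f a = g a) : RC Λ g := by
  have : f = g := funext hfg
  exact this ▸ h

theorem BC.congr (h : BC Λ φ) (hfg : ∀ a, φ a ↔ ψ a) : BC Λ ψ := by
  have : φ = ψ := funext fun a => propext (hfg a)
  exact this ▸ h

theorem RC.natExt (h : RC Λ f) (x : ℕ) (N : α → ℕ) : RC (Λ.natExt x N) (fun p => f p.1) := by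
  intro L hL
  obtain ⟨p, b, hp⟩ := h L (le_trans (le_max_left _ _) hL)
  exact ⟨p, b, fun a σ ha => hp a.1 σ ha.1⟩

theorem RC.realExt (h : RC Λ f) (x : ℕ) : RC (Λ.realExt x) (fun p => f p.1) := by
  intro L hL
  obtain ⟨p, b, hp⟩ := h L (le_trans (le_max_left _ _) hL)
  exact ⟨p, b, fun a σ ha => hp a.1 σ ha.1⟩

theorem NC.natExt (h : NC Λ M) (x : ℕ) (N : α → ℕ) : NC (Λ.natExt x N) (fun p => M p.1) := by
  refine ⟨h.1.imp fun b hb a σ ha => hb a.1 σ ha.1, fun L hL => ?_⟩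
  obtain ⟨p, b, hp⟩ := h.2 L (le_trans (le_max_left _ _) hL)
  exact ⟨p, b, fun a σ ha => hp a.1 σ ha.1⟩

/-- Copying real variables. -/
theorem runs_copy_real {σ : State} {x y : ℕ} (hxy : x ≠ y) :
    Runs (.seq (.basic (.realConst x 0)) (.basic (.realAdd x x y))) σ 2
      (fun τ => τ = { σ with real := Function.update σ.real x (σ.real y) }) := by
  refine Runs.seq (T := 1) (T' := 1) (Runs.basic _ rfl) ?_
  rintro τ rfl
  refine Runs.basic _ ?_
  simp [Instr.apply, Function.update_of_ne hxy.symm]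

/-- Copying natural-number variables. -/
theorem runs_copy_nat {σ : State} {x y : ℕ} (hxy : x ≠ y) :
    Runs (.seq (.basic (.natConst x 0)) (.basic (.natAdd x x y))) σ 2
      (fun τ => τ = { σ with nat := Function.update σ.nat x (σ.nat y) }) := by
  refine Runs.seq (T := 1) (T' := 1) (Runs.basic _ rfl) ?_
  rintro τ rfl
  refine Runs.basic _ ?_
  simp [Instr.apply, Function.update_of_ne hxy.symm]

theorem RC.var {x : ℕ} (hx : x < Λ.lvl) (h : ∀ a σ, Λ.rep a σ → σ.real x = f a) : RC Λ f := by
  intro L hL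
  refine ⟨_, 1, fun a σ ha => (runs_copy_real (x := L) (y := x) (by omega)).mono ?_ ?_⟩
  · simpa using Λ.two_le_size a
  · rintro τ rfl
    exact ⟨by simp [h a σ ha], Agree.update_real σ le_rfl _⟩

theorem NC.var {x : ℕ} (hx : x < Λ.lvl) (h : ∀ a σ, Λ.rep a σ → σ.nat x = M a)
    (hM : ∃ b, ∀ a σ, Λ.rep a σ → M a ≤ Λ.size a ^ b) : NC Λ M := by
  refine ⟨hM, fun L hL => ⟨_, 1, fun a σ ha =>
    (runs_copy_nat (x := L) (y := x) (by omega)).mono ?_ ?_⟩⟩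
  · simpa using Λ.two_le_size a
  · rintro τ rfl
    exact ⟨by simp [h a σ ha], Agree.update_nat σ le_rfl _⟩

theorem RC.snd (Λ : Layout α) (x : ℕ) : RC (Λ.realExt x) (fun p => p.2) :=
  RC.var (x := x) (lt_of_lt_of_le (Nat.lt_succ_self x) (le_max_right _ _)) fun _ _ h => h.2

theorem NC.snd (x : ℕ) (hN : NC Λ N) : NC (Λ.natExt x N) (fun p => p.2) := by
  refine NC.var (x := x) (lt_of_lt_of_le (Nat.lt_succ_self x) (le_max_right _ _))
    (fun _ _ h => h.2.1) ?_
  obtain ⟨b, hb⟩ := hN.1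
  exact ⟨b, fun a σ ha => ha.2.2.le.trans (hb a.1 σ ha.1)⟩

theorem RC.const (Λ : Layout α) (c : ℕ) : RC Λ (fun _ => (c : ℝ)) := fun L _ =>
  ⟨.basic (.realConst L c), 0, fun _ σ _ => (Runs.basic (Q := fun τ => _ ∧ Agree L σ τ) _
    ⟨by simp [Instr.apply], Agree.update_real σ le_rfl _⟩).mono (by simp) fun _ h => h⟩

theorem RC.zero (Λ : Layout α) : RC Λ (fun _ => 0) := (RC.const Λ 0).congr fun _ => by simp

theorem RC.one (Λ : Layout α) : RC Λ (fun _ => 1) := (RC.const Λ 1).congr fun _ => by simp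

theorem NC.const (Λ : Layout α) (c : ℕ) : NC Λ (fun _ => c) :=
  ⟨⟨c, fun a _ _ => (Nat.lt_pow_self (Λ.two_le_size a)).le⟩, fun L _ =>
  ⟨.basic (.natConst L c), 0, fun _ σ _ => (Runs.basic (Q := fun τ => _ ∧ Agree L σ τ) _
    ⟨by simp [Instr.apply], Agree.update_nat σ le_rfl _⟩).mono (by simp) fun _ h => h⟩⟩

/-- Two consecutive evaluations on the levels `L` and `L + 1`. -/
theorem RC.pair (hf : RC Λ f) (hg : RC Λ g) {L : ℕ} (hL : Λ.lvl ≤ L) :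
    ∃ p b, ∀ a σ, Λ.rep a σ → Runs p σ (Λ.size a ^ b)
      (fun τ => τ.real L = f a ∧ τ.real (L + 1) = g a ∧ Agree L σ τ) := by
  obtain ⟨p, b, hp⟩ := hf L hL
  obtain ⟨q, b', hq⟩ := hg (L + 1) (by omega)
  refine ⟨.seq p q, b + b' + 0 + (3 + 0), fun a σ ha => ?_⟩
  refine ((hp a σ ha).seq (T' := Λ.size a ^ b') (R := fun τ => τ.real L = f a ∧
    τ.real (L + 1) = g a ∧ Agree L σ τ) fun τ hτ =>
    (hq a τ (Λ.stable ha (hτ.2.mono hL))).mono le_rfl fun υ hυ => ?_).mono ?_ fun _ h => h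
  · exact ⟨(hυ.2.2.1 L (by omega)).trans hτ.1, hυ.1, hτ.2.trans (hυ.2.mono (by omega))⟩
  · have := add_pow_le_pow (Λ.two_le_size a) b b' 0 0
    simp only [add_zero] at this ⊢
    omega

theorem NC.pair (hf : NC Λ M) (hg : NC Λ N) {L : ℕ} (hL : Λ.lvl ≤ L) :
    ∃ p b, ∀ a σ, Λ.rep a σ → Runs p σ (Λ.size a ^ b)
      (fun τ => τ.nat L = M a ∧ τ.nat (L + 1) = N a ∧ Agree L σ τ) := by
  obtain ⟨p, b, hp⟩ := hf.2 L hL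
  obtain ⟨q, b', hq⟩ := hg.2 (L + 1) (by omega)
  refine ⟨.seq p q, b + b' + 0 + (3 + 0), fun a σ ha => ?_⟩
  refine ((hp a σ ha).seq (T' := Λ.size a ^ b') (R := fun τ => τ.nat L = M a ∧
    τ.nat (L + 1) = N a ∧ Agree L σ τ) fun τ hτ =>
    (hq a τ (Λ.stable ha (hτ.2.mono hL))).mono le_rfl fun υ hυ => ?_).mono ?_ fun _ h => h
  · exact ⟨(hυ.2.1 L (by omega)).trans hτ.1, hυ.1, hτ.2.trans (hυ.2.mono (by omega))⟩
  · have := add_pow_le_pow (Λ.two_le_size a) b b' 0 0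
    simp only [add_zero] at this ⊢
    omega

theorem RC.binop (op : ℝ → ℝ → ℝ) (ins : ℕ → ℕ → ℕ → Instr)
    (h : ∀ σ a b c, (ins a b c).apply σ =
      { σ with real := Function.update σ.real a (op (σ.real b) (σ.real c)) })
    (hf : RC Λ f) (hg : RC Λ g) : RC Λ (fun a => op (f a) (g a)) := by
  intro L hL
  obtain ⟨p, b, hp⟩ := hf.pair hg hL
  refine ⟨.seq p (.basic (ins L L (L + 1))), b + 0 + 0 + (3 + 0), fun a σ ha => ?_⟩
  refine ((hp a σ ha).seq (T' := 1) (R := fun τ => τ.real L = op (f a) (g a) ∧ Agree L σ τ)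
    fun τ hτ => Runs.basic _ ?_).mono ?_ fun _ h => h
  · rw [h, hτ.1, hτ.2.1]
    exact ⟨by simp, hτ.2.2.trans (Agree.update_real τ le_rfl _)⟩
  · have := add_pow_le_pow (Λ.two_le_size a) b 0 0 0
    simp only [add_zero, pow_zero] at this ⊢
    omega

theorem RC.add (hf : RC Λ f) (hg : RC Λ g) : RC Λ (fun a => f a + g a) :=
  RC.binop (· + ·) .realAdd (fun _ _ _ _ => rfl) hf hg

theorem RC.sub (hf : RC Λ f) (hg : RC Λ g) : RC Λ (fun a => f a - g a) :=
  RC.binop (· - ·) .realSub (fun _ _ _ _ => rfl) hf hg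

theorem RC.mul (hf : RC Λ f) (hg : RC Λ g) : RC Λ (fun a => f a * g a) :=
  RC.binop (· * ·) .realMul (fun _ _ _ _ => rfl) hf hg

theorem RC.div (hf : RC Λ f) (hg : RC Λ g) : RC Λ (fun a => f a / g a) :=
  RC.binop (· / ·) .realDiv (fun _ _ _ _ => rfl) hf hg

theorem RC.sqrt (hf : RC Λ f) : RC Λ (fun a => √(f a)) :=
  RC.binop (fun x _ => √x) (fun a b _ => .realSqrt a b) (fun _ _ _ _ => rfl) hf hf

theorem RC.neg (hf : RC Λ f) : RC Λ (fun a => -f a) :=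
  ((RC.zero Λ).sub hf).congr fun _ => by simp

theorem NC.add (hf : NC Λ M) (hg : NC Λ N) : NC Λ (fun a => M a + N a) := by
  constructor
  · obtain ⟨b, hb⟩ := hf.1
    obtain ⟨b', hb'⟩ := hg.1
    refine ⟨b + b' + 0 + (3 + 0), fun a σ ha => ?_⟩
    have := add_pow_le_pow (Λ.two_le_size a) b b' 0 0
    have := hb a σ ha
    have := hb' a σ ha
    simp only at *
    omega
  · intro L hL
    obtain ⟨p, b, hp⟩ := hf.pair hg hL
    refine ⟨.seq p (.basic (.natAdd L L (L + 1))), b + 0 + 0 + (3 + 0), fun a σ ha => ?_⟩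
    refine ((hp a σ ha).seq (T' := 1) (R := fun τ => τ.nat L = M a + N a ∧ Agree L σ τ)
      fun τ hτ => Runs.basic _ ?_).mono ?_ fun _ h => h
    · rw [Instr.apply, hτ.1, hτ.2.1]
      exact ⟨by simp, hτ.2.2.trans (Agree.update_nat τ le_rfl _)⟩
    · have := add_pow_le_pow (Λ.two_le_size a) b 0 0 0
      simp only [add_zero, pow_zero] at this ⊢
      omega

theorem NC.sub (hf : NC Λ M) (hg : NC Λ N) : NC Λ (fun a => M a - N a) := by
  refine ⟨hf.1.imp fun b hb a σ ha => (Nat.sub_le _ _).trans (hb a σ ha), fun L hL => ?_⟩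
  obtain ⟨p, b, hp⟩ := hf.pair hg hL
  refine ⟨.seq p (.basic (.natSub L L (L + 1))), b + 0 + 0 + (3 + 0), fun a σ ha => ?_⟩
  refine ((hp a σ ha).seq (T' := 1) (R := fun τ => τ.nat L = M a - N a ∧ Agree L σ τ)
    fun τ hτ => Runs.basic _ ?_).mono ?_ fun _ h => h
  · rw [Instr.apply, hτ.1, hτ.2.1]
    exact ⟨by simp, hτ.2.2.trans (Agree.update_nat τ le_rfl _)⟩
  · have := add_pow_le_pow (Λ.two_le_size a) b 0 0 0
    simp only [add_zero, pow_zero] at this ⊢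
    omega

/-- Evaluating a test whose two arguments can be computed. -/
theorem BC.of_test {T : Test} {L : ℕ} {p : Program} {b : ℕ}
    (hp : ∀ a σ, Λ.rep a σ → Runs p σ (Λ.size a ^ b) (fun τ => (T.Holds τ ↔ φ a) ∧ Agree L σ τ))
    : open Classical in ∃ q b, ∀ a σ, Λ.rep a σ → Runs q σ (Λ.size a ^ b)
      (fun τ => τ.real L = (if φ a then 1 else 0) ∧ Agree L σ τ) := by
  classical
  refine ⟨.seq p (.ifThenElse T (.basic (.realConst L 1)) (.basic (.realConst L 0))),
    b + 0 + 0 + (3 + 0), fun a σ ha => ?_⟩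
  refine ((hp a σ ha).seq (T' := 1 + 1) (R := fun τ => τ.real L = (if φ a then 1 else 0) ∧
    Agree L σ τ) fun τ hτ => Runs.ite ?_ ?_).mono ?_ fun _ h => h
  · intro h
    refine Runs.basic _ ⟨?_, hτ.2.trans (Agree.update_real τ le_rfl _)⟩
    simp [Instr.apply, hτ.1.1 h]
  · intro h
    refine Runs.basic _ ⟨?_, hτ.2.trans (Agree.update_real τ le_rfl _)⟩
    simp [Instr.apply, mt hτ.1.2 h]
  · have := add_pow_le_pow (Λ.two_le_size a) b 0 0 0
    simp only [add_zero, pow_zero] at this ⊢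
    omega

theorem BC.lt (hf : RC Λ f) (hg : RC Λ g) : BC Λ (fun a => f a < g a) := by
  intro L hL
  obtain ⟨p, b, hp⟩ := hf.pair hg hL
  exact BC.of_test (T := .realLt L (L + 1)) fun a σ ha => (hp a σ ha).mono le_rfl
    fun τ hτ => ⟨by rw [Test.Holds, hτ.1, hτ.2.1], hτ.2.2⟩

theorem BC.natLt (hf : NC Λ M) (hg : NC Λ N) : BC Λ (fun a => M a < N a) := by
  intro L hL
  obtain ⟨p, b, hp⟩ := hf.pair hg hL
  exact BC.of_test (T := .natLt L (L + 1)) fun a σ ha => (hp a σ ha).mono le_rfl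
    fun τ hτ => ⟨by rw [Test.Holds, hτ.1, hτ.2.1], hτ.2.2⟩

theorem BC.not (hφ : BC Λ φ) : BC Λ (fun a => ¬ φ a) := by
  classical
  exact ((RC.one Λ).sub hφ).congr fun a => by by_cases h : φ a <;> simp [h]

theorem BC.and (hφ : BC Λ φ) (hψ : BC Λ ψ) : BC Λ (fun a => φ a ∧ ψ a) := by
  classical
  exact (RC.mul hφ hψ).congr fun a => by by_cases h : φ a <;> simp [h]

theorem BC.or (hφ : BC Λ φ) (hψ : BC Λ ψ) : BC Λ (fun a => φ a ∨ ψ a) :=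
  (hφ.not.and hψ.not).not.congr fun a => by tauto

theorem BC.imp (hφ : BC Λ φ) (hψ : BC Λ ψ) : BC Λ (fun a => φ a → ψ a) :=
  (hφ.and hψ.not).not.congr fun a => by tauto

theorem BC.le (hf : RC Λ f) (hg : RC Λ g) : BC Λ (fun a => f a ≤ g a) :=
  (BC.lt hg hf).not.congr fun _ => not_lt

theorem BC.eq (hf : RC Λ f) (hg : RC Λ g) : BC Λ (fun a => f a = g a) :=
  ((BC.le hf hg).and (BC.le hg hf)).congr fun _ => le_antisymm_iff.symm

theorem BC.natEq (hf : NC Λ M) (hg : NC Λ N) : BC Λ (fun a => M a = N a) :=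
  ((BC.natLt hf hg).not.and (BC.natLt hg hf).not).congr fun _ => by omega

/-- Both branches are evaluated and multiplied by the truth values of the condition. -/
theorem RC.ite [∀ a, Decidable (φ a)] (hφ : BC Λ φ) (hf : RC Λ f) (hg : RC Λ g) :
    RC Λ (fun a => if φ a then f a else g a) :=
  ((RC.mul hφ hf).add (RC.mul hφ.not hg)).congr fun a => by by_cases h : φ a <;> simp [h]

/-- In contrast to `RC.ite`, the program branches, for natural numbers cannot be multiplied. -/
theorem NC.ite [∀ a, Decidable (φ a)] (hφ : BC Λ φ) (hf : NC Λ M) (hg : NC Λ N) :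
    NC Λ (fun a => if φ a then M a else N a) := by
  constructor
  · refine (hf.add hg).1.imp fun b hb a σ ha => le_trans ?_ (hb a σ ha)
    dsimp only
    split_ifs <;> omega
  · intro L hL
    obtain ⟨r, b, hr⟩ := RC.pair hφ (RC.zero Λ) hL
    obtain ⟨p, c, hp⟩ := hf.2 L hL
    obtain ⟨q, d, hq⟩ := hg.2 L hL
    refine ⟨.seq r (.ifThenElse (.realLt (L + 1) L) p q), b + c + d + (3 + 1), fun a σ ha => ?_⟩
    refine ((hr a σ ha).seq (T' := Λ.size a ^ c + Λ.size a ^ d + 1)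
      (R := fun τ => τ.nat L = (if φ a then M a else N a) ∧ Agree L σ τ)
      fun τ hτ => Runs.ite ?_ ?_).mono ?_ fun _ h => h
    · intro h
      have hφa : φ a := by
        by_contra hn
        simp [Test.Holds, hτ.1, hτ.2.1, hn] at h
      refine (hp a τ (Λ.stable ha (hτ.2.2.mono hL))).mono (by omega) fun υ hυ => ?_
      exact ⟨by simp [hφa, hυ.1], hτ.2.2.trans hυ.2⟩
    · intro h
      have hφa : ¬ φ a := by
        intro hn
        simp [Test.Holds, hτ.1, hτ.2.1, hn] at h
      refine (hq a τ (Λ.stable ha (hτ.2.2.mono hL))).mono (by omega) fun υ hυ => ?_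
      exact ⟨by simp [hφa, hυ.1], hτ.2.2.trans hυ.2⟩
    · have := add_pow_le_pow (Λ.two_le_size a) b c d 1
      omega

/-- Bounded recursion with a real accumulator. The hypothesis on `step` allows any variables for
the counter and the accumulator, since loops may be nested; the program keeps the bound, the
counter, the constant `1` and the accumulator on the levels from `L` on, and evaluates `step` above
them. -/
theorem RC.fold {step : α → ℕ → ℝ → ℝ} (hN : NC Λ N) (hf : RC Λ f)
    (hs : ∀ x y, RC ((Λ.natExt x N).realExt y) (fun p => step p.1.1 p.1.2 p.2)) :
    RC Λ (fun a => Nat.rec (f a) (fun j acc => step a j acc) (N a)) := by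
  intro L hL
  obtain ⟨bN, hbN⟩ := hN.1
  obtain ⟨pN, b1, hpN⟩ := hN.2 L hL
  obtain ⟨pf, b2, hpf⟩ := hf (L + 3) (by omega)
  have hlvl : ((Λ.natExt (L + 1) N).realExt L).lvl ≤ L + 3 := by
    simp only [Layout.realExt, Layout.natExt]; omega
  obtain ⟨ps, b3, hps⟩ := hs (L + 1) L (L + 3) hlvl
  let copy : Program := .seq (.basic (.realConst L 0)) (.basic (.realAdd L L (L + 3)))
  let body : Program := .seq (.seq ps copy) (.basic (.natAdd (L + 1) (L + 1) (L + 2)))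
  let prog : Program := .seq (.seq (.seq pN (.seq (.basic (.natConst (L + 1) 0))
    (.basic (.natConst (L + 2) 1)))) (.seq pf copy)) (.whileDo (.natLt (L + 1) L) body)
  refine ⟨prog, (b1 + b2 + (bN + b3 + 5) + (3 + 5)), fun a σ ha => ?_⟩
  let val : ℕ → ℝ := fun j => Nat.rec (f a) (fun j acc => step a j acc) j
  let Inv : ℕ → State → Prop := fun j τ => τ.nat L = N a ∧ τ.nat (L + 1) = j ∧
    τ.nat (L + 2) = 1 ∧ τ.real L = val j ∧ Agree L σ τ
  have h1 : Runs (.seq pN (.seq (.basic (.natConst (L + 1) 0)) (.basic (.natConst (L + 2) 1))))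
      σ (Λ.size a ^ b1 + (1 + 1)) (fun τ => τ.nat L = N a ∧ τ.nat (L + 1) = 0 ∧
        τ.nat (L + 2) = 1 ∧ Agree L σ τ) := by
    refine (hpN a σ ha).seq fun τ hτ => (Runs.basic _ (Q := fun υ => υ.nat L = N a ∧
      υ.nat (L + 1) = 0 ∧ Agree L σ υ) ?_).seq fun υ hυ => Runs.basic _ ?_
    · exact ⟨by simp [Instr.apply, hτ.1], by simp [Instr.apply],
        hτ.2.trans (Agree.update_nat τ (by omega) _)⟩
    · exact ⟨by simp [Instr.apply, hυ.1], by simp [Instr.apply, hυ.2.1], by simp [Instr.apply],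
        hυ.2.2.trans (Agree.update_nat υ (by omega) _)⟩
  have h2 : Runs (.seq (.seq pN (.seq (.basic (.natConst (L + 1) 0))
      (.basic (.natConst (L + 2) 1)))) (.seq pf copy)) σ
      ((Λ.size a ^ b1 + (1 + 1)) + (Λ.size a ^ b2 + 2)) (Inv 0) := by
    refine h1.seq fun τ hτ => (hpf a τ (Λ.stable ha (hτ.2.2.2.mono hL))).seq fun υ hυ =>
      (runs_copy_real (by omega)).mono le_rfl ?_
    rintro ω rfl
    refine ⟨(hυ.2.1 L (by omega)).trans hτ.1, (hυ.2.1 _ (by omega)).trans hτ.2.1,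
      (hυ.2.1 _ (by omega)).trans hτ.2.2.1, by simp [hυ.1, val], ?_⟩
    exact hτ.2.2.2.trans ((hυ.2.mono (by omega)).trans (Agree.update_real υ le_rfl _))
  have h3 : ∀ j < N a, ∀ τ, Inv j τ → Runs body τ (Λ.size a ^ b3 + 2 + 1) (Inv (j + 1)) := by
    rintro j hj τ ⟨i1, i2, i3, i4, i5⟩
    have hr : ((Λ.natExt (L + 1) N).realExt L).rep ((a, j), val j) τ :=
      ⟨⟨Λ.stable ha (i5.mono hL), i2, hj⟩, i4⟩
    refine ((hps _ τ hr).seq (R := fun υ => υ.nat L = N a ∧ υ.nat (L + 1) = j ∧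
        υ.nat (L + 2) = 1 ∧ υ.real L = val (j + 1) ∧ Agree L σ υ)
        fun υ hυ => (runs_copy_real (y := L + 3) (by omega)).mono le_rfl ?_).seq ?_
    · rintro ω rfl
      exact ⟨(hυ.2.1 L (by omega)).trans i1, (hυ.2.1 _ (by omega)).trans i2,
        (hυ.2.1 _ (by omega)).trans i3, by simp [hυ.1, val],
        i5.trans ((hυ.2.mono (by omega)).trans (Agree.update_real υ le_rfl _))⟩
    · rintro υ ⟨j1, j2, j3, j4, j5⟩
      refine Runs.basic _ ⟨?_, ?_, ?_, j4, j5.trans (Agree.update_nat υ (by omega) _)⟩ <;>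
        simp [Instr.apply, j1, j2, j3]
  have h4 := h2.seq fun τ hτ => Runs.while_count (b := .natLt (L + 1) L) h3
    (fun j _ υ hυ => by simp [Test.Holds, hυ.1, hυ.2.1]) τ hτ
  refine h4.mono ?_ fun τ hτ => ⟨hτ.2.2.2.1, hτ.2.2.2.2⟩
  have hS := Λ.two_le_size a
  have e1 : N a * (Λ.size a ^ b3 + 2 + 1 + 1) ≤ Λ.size a ^ (bN + b3 + 5) := by
    have h5 : Λ.size a ^ b3 + 4 ≤ 5 * Λ.size a ^ b3 := by
      have : 0 < Λ.size a ^ b3 := by positivity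
      omega
    calc N a * (Λ.size a ^ b3 + 2 + 1 + 1) ≤ Λ.size a ^ bN * (5 * Λ.size a ^ b3) :=
          Nat.mul_le_mul (hbN a σ ha) h5
      _ = 5 * Λ.size a ^ (bN + b3) := by rw [pow_add]; ring
      _ ≤ _ := mul_pow_le_pow_add hS _ _
  have := add_pow_le_pow hS b1 b2 (bN + b3 + 5) 5
  omega

theorem RC.sum {F : α → ℕ → ℝ} (hN : NC Λ N)
    (hF : ∀ x, RC (Λ.natExt x N) (fun p => F p.1 p.2)) :
    RC Λ (fun a => ∑ j ∈ Finset.range (N a), F a j) := by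
  refine (RC.fold (step := fun a j acc => acc + F a j) hN (RC.zero Λ) fun x y =>
    (RC.snd _ y).add ((hF x).realExt y)).congr fun a => ?_
  induction N a with
  | zero => simp
  | succ n ih => rw [Finset.sum_range_succ, ← ih]

theorem RC.natCast (hM : NC Λ M) : RC Λ (fun a => (M a : ℝ)) :=
  (RC.sum (F := fun _ _ => 1) hM fun x => RC.one _).congr fun a => by simp

theorem BC.exists {Q : α → ℕ → Prop} (hN : NC Λ N)
    (hQ : ∀ x, BC (Λ.natExt x N) (fun p => Q p.1 p.2)) : BC Λ (fun a => ∃ j < N a, Q a j) := by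
  classical
  refine (RC.fold (step := fun a j acc => if Q a j then 1 else acc) hN (RC.zero Λ) fun x y =>
    RC.ite (BC.congr (RC.realExt (hQ x) y) fun _ => Iff.rfl) (RC.one _) (RC.snd _ y)).congr
    fun a => ?_
  have key : ∀ n : ℕ, (Nat.rec 0 (fun j acc => if Q a j then 1 else acc) n : ℝ) =
      if ∃ j < n, Q a j then 1 else 0 := by
    intro n
    induction n with
    | zero => simp
    | succ n ih =>
      simp only [ih, Nat.lt_succ_iff_lt_or_eq, or_and_right, exists_or, exists_eq_left]
      by_cases h : Q a n <;> simp [h]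
  exact (key (N a)).trans (by congr)

theorem BC.forall {Q : α → ℕ → Prop} (hN : NC Λ N)
    (hQ : ∀ x, BC (Λ.natExt x N) (fun p => Q p.1 p.2)) : BC Λ (fun a => ∀ j < N a, Q a j) :=
  (BC.exists (Q := fun a j => ¬ Q a j) hN fun x => (hQ x).not).not.congr fun a => by push Not; rfl

theorem BC.realExt (h : BC Λ φ) (x : ℕ) : BC (Λ.realExt x) (fun p => φ p.1) :=
  RC.realExt h x

/-- Loading an entry of one of the input arrays. -/
theorem RC.load {A : ℕ} (hA : A < 4) (hM : NC Λ M) :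
    RC Λ (fun a => (Λ.inst a).input.realArr A (M a)) := by
  intro L hL
  obtain ⟨p, b, hp⟩ := hM.2 L hL
  refine ⟨.seq p (.basic (.realLoad L A L)), b + 0 + 0 + (3 + 0), fun a σ ha => ?_⟩
  refine ((hp a σ ha).seq (T' := 1) (R := fun τ => τ.real L = (Λ.inst a).input.realArr A (M a) ∧
    Agree L σ τ) fun τ hτ => Runs.basic _ ⟨?_, ?_⟩).mono ?_ fun _ h => h
  · simp [Instr.apply, hτ.1, Λ.base_arr (Λ.stable ha (hτ.2.mono hL)) A hA]
  · exact hτ.2.trans (Agree.update_real τ le_rfl _)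
  · have := add_pow_le_pow (Λ.two_le_size a) b 0 0 0
    simp only [add_zero, pow_zero] at this ⊢
    omega

theorem NC.n (Λ : Layout α) : NC Λ (fun a => (Λ.inst a).n) :=
  NC.var (x := 0) (by have := Λ.lvl_ge; omega)
    (fun a σ h => by simpa [Watchmen.Instance.input] using Λ.base_nat h 0 (by omega))
    ⟨1, fun a σ _ => by have := Λ.size_ge a; rw [pow_one]; omega⟩

theorem NC.k (Λ : Layout α) : NC Λ (fun a => (Λ.inst a).k) :=
  NC.var (x := 1) (by have := Λ.lvl_ge; omega)
    (fun a σ h => by simpa [Watchmen.Instance.input] using Λ.base_nat h 1 (by omega))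
    ⟨1, fun a σ _ => by have := Λ.size_ge a; rw [pow_one]; omega⟩

theorem NC.m (Λ : Layout α) : NC Λ (fun a => (Λ.inst a).m) :=
  NC.var (x := 2) (by have := Λ.lvl_ge; omega)
    (fun a σ h => by simpa [Watchmen.Instance.input] using Λ.base_nat h 2 (by omega))
    ⟨1, fun a σ _ => by have := Λ.size_ge a; rw [pow_one]; omega⟩

theorem RC.tm (Λ : Layout α) : RC Λ (fun a => (Λ.inst a).tm) :=
  RC.var (x := 0) (by have := Λ.lvl_ge; omega)
    (fun a σ h => by simpa [Watchmen.Instance.input] using Λ.base_real h)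

end RealRAM

/-! ### The polygonal region in coordinates -/

namespace Watchmen

/-- The two reals are both positive, both zero or both negative. -/
def SameSign (x y : ℝ) : Prop := (0 < x ↔ 0 < y) ∧ (x < 0 ↔ y < 0)

theorem SameSign.refl (x : ℝ) : SameSign x x := ⟨Iff.rfl, Iff.rfl⟩

theorem SameSign.symm {x y : ℝ} (h : SameSign x y) : SameSign y x := ⟨h.1.symm, h.2.symm⟩

theorem SameSign.trans {x y z : ℝ} (h : SameSign x y) (h' : SameSign y z) : SameSign x z :=
  ⟨h.1.trans h'.1, h.2.trans h'.2⟩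

theorem SameSign.eq_zero_iff {x y : ℝ} (h : SameSign x y) : x = 0 ↔ y = 0 := by
  obtain ⟨h1, h2⟩ := h
  constructor <;> intro h0 <;> subst h0
  · exact le_antisymm (not_lt.1 fun h => lt_irrefl _ (h1.2 h))
      (not_lt.1 fun h => lt_irrefl _ (h2.2 h))
  · exact le_antisymm (not_lt.1 fun h => lt_irrefl _ (h1.1 h))
      (not_lt.1 fun h => lt_irrefl _ (h2.1 h))

theorem SameSign.nonneg_iff {x y : ℝ} (h : SameSign x y) : 0 ≤ x ↔ 0 ≤ y := by
  rw [← not_lt, ← not_lt, h.2]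

theorem SameSign.nonpos_iff {x y : ℝ} (h : SameSign x y) : x ≤ 0 ↔ y ≤ 0 := by
  rw [← not_lt, ← not_lt, h.1]

/-- The value at `p` of the affine form with the given coefficients. -/
def ev (a : ℝ × ℝ × ℝ) (p : ℝ × ℝ) : ℝ := a.1 * p.1 + a.2.1 * p.2 + a.2.2

/-- The coordinates of a point of the plane. -/
def coords (p : Plane) : ℝ × ℝ := (p 0, p 1)

/-- The point at parameter `t` of the segment from `y` to `x`. -/
def segPt (y x : ℝ × ℝ) (t : ℝ) : ℝ × ℝ :=
  ((1 - t) * y.1 + t * x.1, (1 - t) * y.2 + t * x.2)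

theorem ev_segPt (a : ℝ × ℝ × ℝ) (y x : ℝ × ℝ) (t : ℝ) :
    ev a (segPt y x t) = (1 - t) * ev a y + t * ev a x := by
  simp only [ev, segPt]; ring

theorem continuous_ev (a : ℝ × ℝ × ℝ) : Continuous (ev a) := by
  unfold ev; fun_prop

namespace Instance

variable (I : Instance)

/-- The first coordinate of a vertex of the polygon. -/
noncomputable def vx (i : ℕ) : ℝ := I.input.realArr 0 i

/-- The second coordinate of a vertex of the polygon. -/
noncomputable def vy (i : ℕ) : ℝ := I.input.realArr 1 i

/-- The cyclic successor of the index of a vertex of the polygon. -/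
def nxt (i : ℕ) : ℕ := if i + 1 < I.n then i + 1 else 0

/-- The affine forms whose signs determine membership in the region: for every edge the form
vanishing on its line, for every vertex the forms vanishing on the vertical and on the horizontal
line through it, and the constant form `1`. -/
noncomputable def form (q : ℕ) : ℝ × ℝ × ℝ :=
  if q < I.n then
    (I.vy q - I.vy (I.nxt q), I.vx (I.nxt q) - I.vx q,
      (I.vy (I.nxt q) - I.vy q) * I.vx q - (I.vx (I.nxt q) - I.vx q) * I.vy q)
  else if q < I.n + I.n then (1, 0, -I.vx (q - I.n))
  else if q < I.n + I.n + I.n then (0, 1, -I.vy (q - (I.n + I.n)))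
  else (0, 0, 1)

/-- The number of forms. -/
def nf : ℕ := I.n + I.n + I.n + 1

/-- The point lies on the `i`-th edge. -/
def OnEdge (i : ℕ) (p : ℝ × ℝ) : Prop :=
  ev (I.form i) p = 0 ∧
    ((I.vx i ≤ p.1 ∧ p.1 ≤ I.vx (I.nxt i)) ∨ (I.vx (I.nxt i) ≤ p.1 ∧ p.1 ≤ I.vx i)) ∧
    ((I.vy i ≤ p.2 ∧ p.2 ≤ I.vy (I.nxt i)) ∨ (I.vy (I.nxt i) ≤ p.2 ∧ p.2 ≤ I.vy i))

/-- The `i`-th edge crosses the open ray from the point to the right. -/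
def Crosses (i : ℕ) (p : ℝ × ℝ) : Prop :=
  (I.vy i ≤ p.2 ∧ p.2 < I.vy (I.nxt i) ∧ 0 < ev (I.form i) p) ∨
    (I.vy (I.nxt i) ≤ p.2 ∧ p.2 < I.vy i ∧ ev (I.form i) p < 0)

open Classical in
/-- Membership in the region, in coordinates. -/
def InReg (p : ℝ × ℝ) : Prop :=
  (∃ i < I.n, I.OnEdge i p) ∨ Odd ((Finset.range I.n).filter fun i => I.Crosses i p).card

/-- The two points, given by coordinates, see each other. -/
def Vis (y x : ℝ × ℝ) : Prop := ∀ t ∈ Icc (0 : ℝ) 1, I.InReg (segPt y x t)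

theorem ev_form_edge {i : ℕ} (hi : i < I.n) (p : ℝ × ℝ) : ev (I.form i) p =
    (I.vx (I.nxt i) - I.vx i) * (p.2 - I.vy i) - (I.vy (I.nxt i) - I.vy i) * (p.1 - I.vx i) := by
  simp only [ev, form, hi, if_true]; ring

theorem form_x {i : ℕ} (hi : i < I.n) : I.form (I.n + i) = (1, 0, -I.vx i) := by
  simp [form, hi]

theorem form_y {i : ℕ} (hi : i < I.n) : I.form (I.n + I.n + i) = (0, 1, -I.vy i) := by
  have h1 : ¬ I.n + I.n + i < I.n := by omega
  simp [form, hi, h1]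

theorem form_one : I.form (I.n + I.n + I.n) = (0, 0, 1) := by
  simp [form]

theorem ev_form_x {i : ℕ} (hi : i < I.n) (p : ℝ × ℝ) :
    ev (I.form (I.n + i)) p = p.1 - I.vx i := by
  simp [ev, form_x, hi, sub_eq_add_neg]

theorem ev_form_y {i : ℕ} (hi : i < I.n) (p : ℝ × ℝ) :
    ev (I.form (I.n + I.n + i)) p = p.2 - I.vy i := by
  simp [ev, form_y, hi, sub_eq_add_neg]

theorem nxt_lt (i : ℕ) : I.nxt i < I.n := by
  have := NeZero.pos I.n
  unfold nxt; split_ifs <;> assumption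

theorem vx_eq (i : Fin I.n) : I.vx i = I.polygon i 0 := by
  simp [vx, input]

theorem vy_eq (i : Fin I.n) : I.vy i = I.polygon i 1 := by
  simp [vy, input]

theorem finRotate_eq (i : Fin I.n) : ((finRotate I.n i : Fin I.n) : ℕ) = I.nxt i := by
  have hi := i.2
  rw [nxt]
  obtain ⟨m, hm⟩ : ∃ m, I.n = m + 1 := ⟨I.n - 1, by have := NeZero.pos I.n; omega⟩
  generalize I.n = n at *
  subst hm
  rw [coe_finRotate]
  by_cases h : i = Fin.last m
  · simp [h]
  · have : (i : ℕ) ≠ m := fun h' => h (Fin.ext h')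
    rw [if_neg h, if_pos (by omega)]

/-- Whether a point is in the region depends only on the signs of the forms at the point. -/
theorem InReg.congr {p p' : ℝ × ℝ}
    (h : ∀ q < I.nf, SameSign (ev (I.form q) p) (ev (I.form q) p')) : I.InReg p ↔ I.InReg p' := by
  have hx : ∀ i < I.n, (I.vx i ≤ p.1 ↔ I.vx i ≤ p'.1) ∧ (p.1 ≤ I.vx i ↔ p'.1 ≤ I.vx i) := by
    intro i hi
    have := h (I.n + i) (by unfold nf; omega)
    rw [I.ev_form_x hi, I.ev_form_x hi] at this
    exact ⟨by simpa using this.nonneg_iff, by simpa using this.nonpos_iff⟩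
  have hy : ∀ i < I.n, (I.vy i ≤ p.2 ↔ I.vy i ≤ p'.2) ∧ (p.2 ≤ I.vy i ↔ p'.2 ≤ I.vy i) := by
    intro i hi
    have := h (I.n + I.n + i) (by unfold nf; omega)
    rw [I.ev_form_y hi, I.ev_form_y hi] at this
    exact ⟨by simpa using this.nonneg_iff, by simpa using this.nonpos_iff⟩
  have he : ∀ i < I.n, I.OnEdge i p ↔ I.OnEdge i p' := by
    intro i hi
    have h1 := (h i (by unfold nf; omega)).eq_zero_iff
    simp only [OnEdge, h1, hx i hi, hx _ (I.nxt_lt i), hy i hi, hy _ (I.nxt_lt i)]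
  have hc : ∀ i < I.n, I.Crosses i p ↔ I.Crosses i p' := by
    intro i hi
    have h1 := h i (by unfold nf; omega)
    have h2 := hy i hi
    have h3 := hy _ (I.nxt_lt i)
    simp only [Crosses, h1.1, h1.2, h2.1, h3.1, lt_iff_not_ge]
  classical
  unfold InReg
  refine or_congr (exists_congr fun i => and_congr_right (he i)) ?_
  rw [Finset.filter_congr fun i hi => (hc i (Finset.mem_range.1 hi))]

/-- The parity of a number of indices as a sum in the field with two elements. -/
theorem odd_card_filter_iff (n : ℕ) (Q : ℕ → Prop) [DecidablePred Q] :
    Odd ((Finset.range n).filter Q).card ↔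
      (∑ i ∈ Finset.range n, if Q i then (1 : ZMod 2) else 0) = 1 := by
  rw [← ZMod.natCast_eq_one_iff_odd, Finset.card_filter]
  push_cast
  rfl

theorem sum_nxt (F : ℕ → ZMod 2) :
    ∑ i ∈ Finset.range I.n, F (I.nxt i) = ∑ i ∈ Finset.range I.n, F i := by
  obtain ⟨m, hm⟩ : ∃ m, I.n = m + 1 := ⟨I.n - 1, by have := NeZero.pos I.n; omega⟩
  rw [hm, Finset.sum_range_succ, Finset.sum_range_succ']
  congr 1
  · refine Finset.sum_congr rfl fun i hi => ?_
    have := Finset.mem_range.1 hi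
    simp [nxt, hm, this]
  · simp [nxt, hm]

/-- How the crossing status of the edge from `(a, b)` to `(c, d)` changes when the point `(x, y)`
off the edge moves to a nearby point at height `y'`. -/
theorem crosses_perturb {a b c d x y y' e e' : ℝ}
    (he : e = (c - a) * (y - b) - (d - b) * (x - a))
    (hoff : ¬ (e = 0 ∧ ((a ≤ x ∧ x ≤ c) ∨ (c ≤ x ∧ x ≤ a)) ∧ ((b ≤ y ∧ y ≤ d) ∨ (d ≤ y ∧ y ≤ b))))
    (h1 : 0 < e → 0 < e') (h2 : e < 0 → e' < 0)
    (h3 : b < y → b < y') (h4 : y < b → y' < b) (h5 : d < y → d < y') (h6 : y < d → y' < d) :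
    ((b ≤ y' ∧ y' < d ∧ 0 < e') ∨ (d ≤ y' ∧ y' < b ∧ e' < 0)) ↔
      Xor ((b ≤ y ∧ y < d ∧ 0 < e) ∨ (d ≤ y ∧ y < b ∧ e < 0))
        (Xor (b = y ∧ x < a ∧ y' < y) (d = y ∧ x < c ∧ y' < y)) := by
  have hid : e = (c - x) * (y - b) + (a - x) * (d - y) := by rw [he]; ring
  have hne : e = 0 → ¬ ((b ≤ y ∧ y ≤ d) ∨ (d ≤ y ∧ y ≤ b)) ∨
      ¬ ((a ≤ x ∧ x ≤ c) ∨ (c ≤ x ∧ x ≤ a)) := fun h0 =>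
    or_iff_not_imp_left.2 fun h h' => hoff ⟨h0, h', not_not.1 h⟩
  -- the sign of the form at a point at the height of an endpoint of the edge
  have hby : b = y → e = (a - x) * (d - y) := by rintro rfl; rw [hid]; ring
  have hdy : d = y → e = (c - x) * (y - b) := by rintro rfl; rw [hid]; ring
  clear hoff he
  rcases lt_trichotomy b y with hb | hb | hb <;> rcases lt_trichotomy d y with hd | hd | hd
  · have := h3 hb; have := h5 hd
    grind [Xor]
  · have := h3 hb
    have hp : x < c → 0 < e := fun h => by rw [hdy hd]; nlinarith
    have hn : c < x → e < 0 := fun h => by rw [hdy hd]; nlinarith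
    grind [Xor]
  · have := h3 hb; have := h6 hd
    have hc : e ≠ 0 := fun h0 => by
      rcases hne h0 with h | h
      · exact h (Or.inl ⟨hb.le, hd.le⟩)
      · apply h
        rw [hid] at h0
        rcases le_total x a with hxa | hxa
        · right; exact ⟨by by_contra hn; push Not at hn; nlinarith, hxa⟩
        · left; exact ⟨hxa, by by_contra hn; push Not at hn; nlinarith⟩
    grind [Xor]
  · have := h5 hd
    have hp : x < a → e < 0 := fun h => by rw [hby hb]; nlinarith
    have hn : a < x → 0 < e := fun h => by rw [hby hb]; nlinarith
    grind [Xor]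
  · grind [Xor]
  · have := h6 hd
    have hp : x < a → 0 < e := fun h => by rw [hby hb]; nlinarith
    have hn : a < x → e < 0 := fun h => by rw [hby hb]; nlinarith
    grind [Xor]
  · have := h4 hb; have := h5 hd
    have hc : e ≠ 0 := fun h0 => by
      rcases hne h0 with h | h
      · exact h (Or.inr ⟨hd.le, hb.le⟩)
      · apply h
        rw [hid] at h0
        rcases le_total x a with hxa | hxa
        · right; exact ⟨by by_contra hn; push Not at hn; nlinarith, hxa⟩
        · left; exact ⟨hxa, by by_contra hn; push Not at hn; nlinarith⟩
    grind [Xor]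
  · have := h4 hb
    have hp : x < c → e < 0 := fun h => by rw [hdy hd]; nlinarith
    have hn : c < x → 0 < e := fun h => by rw [hdy hd]; nlinarith
    grind [Xor]
  · have := h4 hb; have := h6 hd
    grind [Xor]

/-- The region is closed: off the boundary the parity of the number of crossings is locally
constant, since whenever the height of the point passes the height of a vertex to its right, the
crossing status of both edges at that vertex changes. -/
theorem isClosed_inReg : IsClosed {p | I.InReg p} := by
  classical
  rw [← isOpen_compl_iff, isOpen_iff_mem_nhds]
  intro p0 hp0
  have hoff : ∀ i < I.n, ¬ I.OnEdge i p0 := fun i hi h => hp0 (Or.inl ⟨i, hi, h⟩)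
  have hedge : ∀ i, IsClosed {p | I.OnEdge i p} := by
    intro i
    have := continuous_ev (I.form i)
    unfold OnEdge
    have hb : ∀ (g : ℝ × ℝ → ℝ) (a b : ℝ), Continuous g →
        IsClosed {p | (a ≤ g p ∧ g p ≤ b) ∨ (b ≤ g p ∧ g p ≤ a)} := fun g a b hg =>
      ((isClosed_le continuous_const hg).inter (isClosed_le hg continuous_const)).union
        ((isClosed_le continuous_const hg).inter (isClosed_le hg continuous_const))
    exact (isClosed_eq this continuous_const).inter
      ((hb _ _ _ continuous_fst).inter (hb _ _ _ continuous_snd))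
  have hlt : ∀ (g h : ℝ × ℝ → ℝ), Continuous g → Continuous h →
      ∀ᶠ p in nhds p0, g p0 < h p0 → g p < h p := by
    intro g h hg hh
    by_cases hgh : g p0 < h p0
    · exact Filter.Eventually.mono ((isOpen_lt hg hh).mem_nhds hgh) fun p hp _ => hp
    · exact Filter.Eventually.of_forall fun p hp => absurd hp hgh
  have h1 : ∀ᶠ p in nhds p0, ∀ i ∈ Finset.range I.n, ¬ I.OnEdge i p := by
    rw [Filter.eventually_all_finset]
    exact fun i hi => (hedge i).isOpen_compl.mem_nhds (hoff i (Finset.mem_range.1 hi))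
  -- the height of the vertex `i`, to the right of `p0`, is passed downwards on the way to `p`
  let Δ : ℕ → ℝ × ℝ → Prop := fun i p => I.vy i = p0.2 ∧ p0.1 < I.vx i ∧ p.2 < p0.2
  have h2 : ∀ᶠ p in nhds p0, ∀ i ∈ Finset.range I.n,
      (I.Crosses i p ↔ Xor (I.Crosses i p0) (Xor (Δ i p) (Δ (I.nxt i) p))) := by
    rw [Filter.eventually_all_finset]
    intro i hi
    have hi := Finset.mem_range.1 hi
    filter_upwards [hlt (fun _ => 0) (ev (I.form i)) continuous_const (continuous_ev _),
      hlt (ev (I.form i)) (fun _ => 0) (continuous_ev _) continuous_const,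
      hlt (fun _ => I.vy i) Prod.snd continuous_const continuous_snd,
      hlt Prod.snd (fun _ => I.vy i) continuous_snd continuous_const,
      hlt (fun _ => I.vy (I.nxt i)) Prod.snd continuous_const continuous_snd,
      hlt Prod.snd (fun _ => I.vy (I.nxt i)) continuous_snd continuous_const]
      with p k1 k2 k3 k4 k5 k6
    exact crosses_perturb (I.ev_form_edge hi p0) (hoff i hi) k1 k2 k3 k4 k5 k6
  filter_upwards [h1, h2] with p k1 k2
  rintro (⟨i, hi, h⟩ | h)
  · exact k1 i (Finset.mem_range.2 hi) h
  apply hp0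
  right
  rw [odd_card_filter_iff] at h ⊢
  have hz : ∀ i ∈ Finset.range I.n, (if I.Crosses i p then (1 : ZMod 2) else 0) =
      (if I.Crosses i p0 then 1 else 0) + ((if Δ i p then 1 else 0) +
        if Δ (I.nxt i) p then 1 else 0) := by
    intro i hi
    rw [if_congr (k2 i hi) rfl rfl]
    by_cases c1 : I.Crosses i p0 <;> by_cases c2 : Δ i p <;> by_cases c3 : Δ (I.nxt i) p <;>
      simp only [c1, c2, c3, Xor] <;> decide
  -- every vertex is an endpoint of two edges, so the changes cancel in pairs
  rw [Finset.sum_congr rfl hz, Finset.sum_add_distrib, Finset.sum_add_distrib,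
    I.sum_nxt fun i => if Δ i p then (1 : ZMod 2) else 0, CharTwo.add_self_eq_zero, add_zero] at h
  exact h

/-- If the edges crossed by the ray from `p` are those whose endpoints are separated by a
predicate on the vertices, then their number is even. -/
theorem not_odd_of_crosses_iff {p : ℝ × ℝ} (Q : ℕ → Prop)
    (h : ∀ i < I.n, (I.Crosses i p ↔ Xor (Q i) (Q (I.nxt i)))) :
    open Classical in ¬ Odd ((Finset.range I.n).filter fun i => I.Crosses i p).card := by
  classical
  have hz : ∀ i ∈ Finset.range I.n, (if I.Crosses i p then (1 : ZMod 2) else 0) =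
      (if Q i then 1 else 0) + if Q (I.nxt i) then 1 else 0 := by
    intro i hi
    rw [if_congr (h i (Finset.mem_range.1 hi)) rfl rfl]
    by_cases c2 : Q i <;> by_cases c3 : Q (I.nxt i) <;>
      simp only [c2, c3, Xor] <;> decide
  rw [odd_card_filter_iff, Finset.sum_congr rfl hz, Finset.sum_add_distrib,
    I.sum_nxt fun i => if Q i then (1 : ZMod 2) else 0, CharTwo.add_self_eq_zero]
  exact zero_ne_one

/-- The region lies in the bounding box of the vertices. -/
theorem InReg.box {p : ℝ × ℝ} (h : I.InReg p) :
    ((∃ i < I.n, I.vx i ≤ p.1) ∧ ∃ i < I.n, p.1 ≤ I.vx i) ∧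
      (∃ i < I.n, I.vy i ≤ p.2) ∧ ∃ i < I.n, p.2 ≤ I.vy i := by
  rcases h with ⟨i, hi, -, hx, hy⟩ | h
  · have hj := I.nxt_lt i
    refine ⟨⟨?_, ?_⟩, ?_, ?_⟩
    · rcases hx with hx | hx
      exacts [⟨i, hi, hx.1⟩, ⟨_, hj, hx.1⟩]
    · rcases hx with hx | hx
      exacts [⟨_, hj, hx.2⟩, ⟨_, hi, hx.2⟩]
    · rcases hy with hx | hx
      exacts [⟨i, hi, hx.1⟩, ⟨_, hj, hx.1⟩]
    · rcases hy with hx | hx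
      exacts [⟨_, hj, hx.2⟩, ⟨_, hi, hx.2⟩]
  · have hid : ∀ i < I.n, ev (I.form i) p = (I.vx (I.nxt i) - p.1) * (p.2 - I.vy i) +
        (I.vx i - p.1) * (I.vy (I.nxt i) - p.2) := fun i hi => by
      rw [I.ev_form_edge hi]; ring
    refine ⟨⟨?_, ?_⟩, ?_, ?_⟩
    -- left of all vertices the ray crosses just the edges that pass its height
    · by_contra! hn
      refine I.not_odd_of_crosses_iff (fun i => I.vy i ≤ p.2) (fun i hi => ?_) h
      have h1 := hn i hi
      have h2 := hn _ (I.nxt_lt i)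
      have e1 : I.vy i ≤ p.2 → p.2 < I.vy (I.nxt i) → 0 < ev (I.form i) p := fun a b => by
        rw [hid i hi]; nlinarith
      have e2 : I.vy (I.nxt i) ≤ p.2 → p.2 < I.vy i → ev (I.form i) p < 0 := fun a b => by
        rw [hid i hi]; nlinarith
      simp only [Crosses, Xor, not_le]
      exact ⟨fun h => h.imp (fun h => ⟨h.1, h.2.1⟩) fun h => ⟨h.1, h.2.1⟩,
        fun h => h.imp (fun h => ⟨h.1, h.2, e1 h.1 h.2⟩) fun h => ⟨h.1, h.2, e2 h.1 h.2⟩⟩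
    · by_contra! hn
      refine I.not_odd_of_crosses_iff (fun _ => False) (fun i hi => ?_) h
      have h1 := hn i hi
      have h2 := hn _ (I.nxt_lt i)
      simp only [Crosses, xor_self, iff_false]
      rintro (⟨a, b, c⟩ | ⟨a, b, c⟩) <;> rw [hid i hi] at c <;> nlinarith
    · by_contra! hn
      refine I.not_odd_of_crosses_iff (fun _ => False) (fun i hi => ?_) h
      have h1 := hn i hi
      have h2 := hn _ (I.nxt_lt i)
      simp only [Crosses, xor_self, iff_false]
      rintro (⟨a, b, c⟩ | ⟨a, b, c⟩) <;> linarith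
    · by_contra! hn
      refine I.not_odd_of_crosses_iff (fun _ => False) (fun i hi => ?_) h
      have h1 := hn i hi
      have h2 := hn _ (I.nxt_lt i)
      simp only [Crosses, xor_self, iff_false]
      rintro (⟨a, b, c⟩ | ⟨a, b, c⟩) <;> linarith

theorem crossesRay_iff (i : Fin I.n) (p : Plane) :
    CrossesRay p (I.polygon i) (I.polygon (finRotate I.n i)) ↔ I.Crosses i (coords p) := by
  have hi := i.2
  have e0 := I.vx_eq i
  have e1 := I.vy_eq i
  have e2 := I.vx_eq (finRotate I.n i)
  have e3 := I.vy_eq (finRotate I.n i)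
  rw [finRotate_eq] at e2 e3
  rw [Crosses, I.ev_form_edge hi, e0, e1, e2, e3]
  simp only [CrossesRay, segment_eq_image, mem_image, exists_exists_and_eq_and, coords]
  generalize I.polygon i = a
  generalize I.polygon (finRotate I.n i) = b
  simp only [PiLp.add_apply, PiLp.smul_apply, smul_eq_mul]
  constructor
  · rintro ⟨h | h, t, ht, h1, h2⟩
    · left
      refine ⟨h.1, h.2, ?_⟩
      have : 0 < b 1 - a 1 := by linarith
      have h3 : p 1 - a 1 = t * (b 1 - a 1) := by rw [← h1]; ring
      rw [h3]
      nlinarith [mul_pos this (sub_pos.2 h2)]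
    · right
      refine ⟨h.1, h.2, ?_⟩
      have : 0 < a 1 - b 1 := by linarith
      have h3 : p 1 - a 1 = t * (b 1 - a 1) := by rw [← h1]; ring
      rw [h3]
      nlinarith [mul_pos this (sub_pos.2 h2)]
  · rintro (⟨h1, h2, h3⟩ | ⟨h1, h2, h3⟩)
    · have hd : 0 < b 1 - a 1 := by linarith
      refine ⟨Or.inl ⟨h1, h2⟩, (p 1 - a 1) / (b 1 - a 1), ⟨by apply div_nonneg <;> linarith,
        by rw [div_le_one hd]; linarith⟩, by field_simp; ring, ?_⟩
      have : (1 - (p 1 - a 1) / (b 1 - a 1)) * a 0 + (p 1 - a 1) / (b 1 - a 1) * b 0 - p 0 =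
        ((b 0 - a 0) * (p 1 - a 1) - (b 1 - a 1) * (p 0 - a 0)) / (b 1 - a 1) := by
        field_simp; ring
      linarith [div_pos h3 hd]
    · have hd : 0 < a 1 - b 1 := by linarith
      refine ⟨Or.inr ⟨h1, h2⟩, (a 1 - p 1) / (a 1 - b 1), ⟨by apply div_nonneg <;> linarith,
        by rw [div_le_one hd]; linarith⟩, by field_simp; ring, ?_⟩
      have : (1 - (a 1 - p 1) / (a 1 - b 1)) * a 0 + (a 1 - p 1) / (a 1 - b 1) * b 0 - p 0 =
        (-((b 0 - a 0) * (p 1 - a 1) - (b 1 - a 1) * (p 0 - a 0))) / (a 1 - b 1) := by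
        field_simp; ring
      linarith [div_pos (neg_pos.2 h3) hd]

theorem mem_edgeSet_iff (i : Fin I.n) (p : Plane) :
    p ∈ I.polygon.edgeSet ℝ i ↔ I.OnEdge i (coords p) := by
  have hi := i.2
  have e0 := I.vx_eq i
  have e1 := I.vy_eq i
  have e2 := I.vx_eq (finRotate I.n i)
  have e3 := I.vy_eq (finRotate I.n i)
  rw [finRotate_eq] at e2 e3
  rw [OnEdge, I.ev_form_edge hi, e0, e1, e2, e3, Polygon.edgeSet, affineSegment_eq_segment,
    segment_eq_image]
  generalize I.polygon i = a
  generalize I.polygon (finRotate I.n i) = b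
  simp only [mem_image, coords]
  constructor
  · rintro ⟨t, ⟨h0, h1⟩, rfl⟩
    simp only [PiLp.add_apply, PiLp.smul_apply, smul_eq_mul]
    refine ⟨by ring, ?_, ?_⟩
    · rcases le_total (a 0) (b 0) with h | h
      · left; constructor <;> nlinarith
      · right; constructor <;> nlinarith
    · rcases le_total (a 1) (b 1) with h | h
      · left; constructor <;> nlinarith
      · right; constructor <;> nlinarith
  · rintro ⟨h0, h1, h2⟩
    have key : ∀ j j' : Fin 2, (∀ q : Plane, (∀ i, q i = p i) ↔ q j = p j ∧ q j' = p j') →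
        a j ≠ b j → ((a j ≤ p j ∧ p j ≤ b j) ∨ (b j ≤ p j ∧ p j ≤ a j)) →
        (b j' - a j') * (p j - a j) = (b j - a j) * (p j' - a j') →
        ∃ t ∈ Icc (0 : ℝ) 1, (1 - t) • a + t • b = p := by
      intro j j' hq hne hbt he
      have hne' : b j - a j ≠ 0 := sub_ne_zero.2 hne.symm
      refine ⟨(p j - a j) / (b j - a j), ?_, ?_⟩
      · rcases hbt with h | h
        · have : 0 < b j - a j := lt_of_le_of_ne (by linarith) hne'.symm
          exact ⟨by apply div_nonneg <;> linarith, by rw [div_le_one this]; linarith⟩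
        · have : b j - a j < 0 := lt_of_le_of_ne (by linarith) hne'
          exact ⟨div_nonneg_of_nonpos (by linarith) (by linarith),
            by rw [div_le_one_of_neg this]; linarith⟩
      · refine PiLp.ext ((hq _).2 ⟨?_, ?_⟩)
        · simp only [PiLp.add_apply, PiLp.smul_apply, smul_eq_mul]
          field_simp; ring
        · simp only [PiLp.add_apply, PiLp.smul_apply, smul_eq_mul]
          field_simp
          linarith
    by_cases h3 : a 0 = b 0
    · by_cases h4 : a 1 = b 1
      · refine ⟨0, by simp, ?_⟩
        rw [← h3] at h1
        rw [← h4] at h2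
        refine PiLp.ext (Fin.forall_fin_two.2 ⟨?_, ?_⟩)
        · simp; rcases h1 with h | h <;> linarith
        · simp; rcases h2 with h | h <;> linarith
      · exact key 1 0 (fun q => by rw [Fin.forall_fin_two, and_comm]) h4 h2 (by linarith)
    · exact key 0 1 (fun q => Fin.forall_fin_two) h3 h1 (by linarith)

/-- The region of the problem instance, in coordinates. -/
theorem mem_P_iff (p : Plane) : p ∈ I.P ↔ I.InReg (coords p) := by
  classical
  rw [P, region, mem_union, InReg]
  refine or_congr ?_ ?_
  · simp only [Polygon.boundary, mem_iUnion, mem_edgeSet_iff]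
    exact ⟨fun ⟨i, h⟩ => ⟨i, i.2, h⟩, fun ⟨i, hi, h⟩ => ⟨⟨i, hi⟩, h⟩⟩
  · rw [mem_ofPred_eq, Set.ncard_eq_toFinset_card']
    have : ((Finset.range I.n).filter fun i => I.Crosses i (coords p)) =
        (Set.toFinset {i : Fin I.n | CrossesRay p (I.polygon i)
          (I.polygon (finRotate I.n i))}).map Fin.valEmbedding := by
      ext j
      simp only [Finset.mem_filter, Finset.mem_range, Finset.mem_map, mem_toFinset, mem_ofPred_eq,
        crossesRay_iff, Fin.valEmbedding_apply]
      exact ⟨fun ⟨h1, h2⟩ => ⟨⟨j, h1⟩, h2, rfl⟩, fun ⟨i, h1, h2⟩ => h2 ▸ ⟨i.2, h1⟩⟩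
    rw [this, Finset.card_map]

theorem mem_visibilityPolygon_iff (y x : Plane) :
    x ∈ visibilityPolygon I.P y ↔ I.Vis (coords y) (coords x) := by
  rw [visibilityPolygon, mem_ofPred_eq, segment_eq_image, image_subset_iff]
  refine forall₂_congr fun t ht => ?_
  rw [mem_preimage, mem_P_iff]
  rfl

theorem Vis.symm {y x : ℝ × ℝ} (h : I.Vis y x) : I.Vis x y := by
  intro t ht
  convert h (1 - t) ⟨by linarith [ht.2], by linarith [ht.1]⟩ using 1
  simp only [segPt]
  ext <;> simp <;> ring

/-- The visibility relation is closed. -/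
theorem isClosed_vis : IsClosed {p : (ℝ × ℝ) × (ℝ × ℝ) | I.Vis p.1 p.2} := by
  simp only [Vis, ofPred_forall]
  refine isClosed_iInter fun t => isClosed_iInter fun _ =>
    I.isClosed_inReg.preimage (f := fun p : (ℝ × ℝ) × (ℝ × ℝ) => segPt p.1 p.2 t) ?_
  unfold segPt
  fun_prop

end Instance
end Watchmen

/-! ### Sign patterns along segments -/

namespace Watchmen

theorem sameSign_iff {x y : ℝ} : SameSign x y ↔ SignType.sign x = SignType.sign y := by
  unfold SameSign
  rcases lt_trichotomy x 0 with hx | hx | hx <;> rcases lt_trichotomy y 0 with hy | hy | hy <;>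
    simp [hx, hy, hx.not_gt, hy.not_gt]

theorem SameSign.mul {x y x' y' : ℝ} (h : SameSign x y) (h' : SameSign x' y') :
    SameSign (x * x') (y * y') := by
  rw [sameSign_iff] at *
  rw [sign_mul, sign_mul, h, h']

theorem SameSign.neg {x y : ℝ} (h : SameSign x y) : SameSign (-x) (-y) := by
  simpa [SameSign, and_comm] using h

theorem SameSign.div {x y x' y' : ℝ} (h : SameSign x y) (h' : SameSign x' y') :
    SameSign (x / x') (y / y') := by
  have : SameSign x'⁻¹ y'⁻¹ := by simpa [SameSign] using h'
  simpa only [div_eq_mul_inv] using h.mul this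

/-- The values `y` and `z` have weakly the sign of `x`, and not both vanish unless `x` does. -/
def SplitSign (x y z : ℝ) : Prop :=
  (0 < x → 0 ≤ y ∧ 0 ≤ z ∧ (0 < y ∨ 0 < z)) ∧ (x < 0 → y ≤ 0 ∧ z ≤ 0 ∧ (y < 0 ∨ z < 0)) ∧
    (x = 0 → y = 0 ∧ z = 0)

theorem SplitSign.congr {x y z x' y' z' : ℝ} (h : SplitSign x y z) (hx : SameSign x x')
    (hy : SameSign y y') (hz : SameSign z z') : SplitSign x' y' z' := by
  unfold SplitSign at *
  rwa [← hx.1, ← hx.2, ← hx.eq_zero_iff, ← hy.1, ← hy.2, ← hy.eq_zero_iff, ← hz.1, ← hz.2,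
    ← hz.eq_zero_iff, ← hy.nonneg_iff, ← hy.nonpos_iff, ← hz.nonneg_iff, ← hz.nonpos_iff]

theorem SplitSign.sameSign {x y z : ℝ} (h : SplitSign x y z) : SameSign x ((y + z) / 2) := by
  obtain ⟨h1, h2, h3⟩ := h
  rcases lt_trichotomy x 0 with hx | hx | hx
  · obtain ⟨a, b, c⟩ := h2 hx
    have : (y + z) / 2 < 0 := by rcases c with c | c <;> linarith
    simp [SameSign, hx, this, hx.not_gt, this.not_gt]
  · obtain ⟨a, b⟩ := h3 hx
    simp [SameSign, hx, a, b]
  · obtain ⟨a, b, c⟩ := h1 hx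
    have : 0 < (y + z) / 2 := by rcases c with c | c <;> linarith
    simp [SameSign, hx, this, hx.not_gt, this.not_gt]

/-- Starting at `0` and moving in both directions up to the first zeros of the affine functions
`t ↦ a i + t * d i`, no sign changes strictly. -/
theorem exists_breakpoints {ι : Type*} (s : Finset ι) (a d : ι → ℝ)
    (h0 : ∃ i ∈ s, d i ≠ 0 ∧ -a i / d i ≤ 0) (h1 : ∃ i ∈ s, d i ≠ 0 ∧ 0 ≤ -a i / d i) :
    ∃ i ∈ s, ∃ j ∈ s, d i ≠ 0 ∧ d j ≠ 0 ∧
      ∀ k ∈ s, SplitSign (a k) (a k + -a i / d i * d k) (a k + -a j / d j * d k) := by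
  classical
  obtain ⟨i0, hi0, hi1, hi2⟩ := h0
  obtain ⟨j0, hj0, hj1, hj2⟩ := h1
  obtain ⟨i, hi, himax⟩ := (s.filter fun i => d i ≠ 0 ∧ -a i / d i ≤ 0).exists_max_image
    (fun i => -a i / d i) ⟨i0, by simp [*]⟩
  obtain ⟨j, hj, hjmin⟩ := (s.filter fun i => d i ≠ 0 ∧ 0 ≤ -a i / d i).exists_min_image
    (fun i => -a i / d i) ⟨j0, by simp [*]⟩
  rw [Finset.mem_filter] at hi hj
  refine ⟨i, hi.1, j, hj.1, hi.2.1, hj.2.1, fun k hk => ?_⟩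
  have hi' := hi.2.2
  have hj' := hj.2.2
  generalize -a i / d i = ti at *
  generalize -a j / d j = tj at *
  by_cases hd : d k = 0
  · simp only [hd, mul_zero, add_zero, SplitSign]
    refine ⟨fun h => ⟨h.le, h.le, Or.inl h⟩, fun h => ⟨h.le, h.le, Or.inl h⟩, fun h => ⟨h, h⟩⟩
  have ha : a k = -(-a k / d k) * d k := by field_simp
  have m1 := himax k
  have m2 := hjmin k
  simp only [Finset.mem_filter, hk, hd, ne_eq, not_false_eq_true, true_and] at m1 m2
  generalize -a k / d k = tk at *
  have e1 : a k + ti * d k = (ti - tk) * d k := by rw [ha]; ring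
  have e2 : a k + tj * d k = (tj - tk) * d k := by rw [ha]; ring
  rw [e1, e2, ha]
  rcases lt_trichotomy tk 0 with ht | ht | ht
  · have l1 := m1 ht.le
    have l2 : 0 < tj - tk := by linarith
    rcases lt_or_gt_of_ne hd with hd | hd
    · have n1 : -tk * d k < 0 := mul_neg_of_pos_of_neg (by linarith) hd
      have n2 := mul_neg_of_pos_of_neg l2 hd
      have n3 := mul_nonpos_of_nonneg_of_nonpos (sub_nonneg.2 l1) hd.le
      exact ⟨fun h => absurd h n1.not_gt, fun _ => ⟨n3, n2.le, Or.inr n2⟩, fun h => absurd h n1.ne⟩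
    · have n1 : 0 < -tk * d k := mul_pos (by linarith) hd
      have n2 := mul_pos l2 hd
      have n3 := mul_nonneg (sub_nonneg.2 l1) hd.le
      exact ⟨fun _ => ⟨n3, n2.le, Or.inr n2⟩, fun h => absurd h n1.not_gt, fun h => absurd h n1.ne'⟩
  · subst ht
    have l1 : ti = 0 := le_antisymm hi' (m1 le_rfl)
    have l2 : tj = 0 := le_antisymm (m2 le_rfl) hj'
    simp [l1, l2, SplitSign]
  · have l1 := m2 ht.le
    have l2 : ti - tk < 0 := by linarith
    rcases lt_or_gt_of_ne hd with hd | hd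
    · have n1 : 0 < -tk * d k := mul_pos_of_neg_of_neg (by linarith) hd
      have n2 := mul_pos_of_neg_of_neg l2 hd
      have n3 := mul_nonneg_of_nonpos_of_nonpos (sub_nonpos.2 l1) hd.le
      exact ⟨fun _ => ⟨n2.le, n3, Or.inl n2⟩, fun h => absurd h n1.not_gt, fun h => absurd h n1.ne'⟩
    · have n1 : -tk * d k < 0 := mul_neg_of_neg_of_pos (by linarith) hd
      have n2 := mul_neg_of_neg_of_pos l2 hd
      have n3 := mul_nonpos_of_nonpos_of_nonneg (sub_nonpos.2 l1) hd.le
      exact ⟨fun h => absurd h n1.not_gt, fun _ => ⟨n2.le, n3, Or.inl n2⟩, fun h => absurd h n1.ne⟩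

namespace Instance

variable (I : Instance)

/-- The value at the start `y` of a segment of the `q`-th of the forms extended by the parameter
`t` of the segment and by `1 - t`. -/
noncomputable def startVal (y : ℝ × ℝ) (q : ℕ) : ℝ :=
  if q < I.nf then ev (I.form q) y else if q < I.nf + 1 then 0 else 1

/-- The value at the end `x` of a segment of the `q`-th of the extended forms. -/
noncomputable def endVal (x : ℝ × ℝ) (q : ℕ) : ℝ :=
  if q < I.nf then ev (I.form q) x else if q < I.nf + 1 then 1 else 0

/-- The parameter at which the `q`-th extended form vanishes on the segment. -/
noncomputable def breakPt (y x : ℝ × ℝ) (q : ℕ) : ℝ :=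
  I.startVal y q / (I.startVal y q - I.endVal x q)

/-- The bilinear form `G(y) F(x) - F(y) G(x)` for the forms `F, G` with indices `q, r`; its signs
determine the order in which the lines `F = 0` and `G = 0` are met on the segment. -/
noncomputable def pairForm (q r : ℕ) (y x : ℝ × ℝ) : ℝ :=
  ev (I.form r) y * ev (I.form q) x - ev (I.form q) y * ev (I.form r) x

/-- Every point of a segment shows the sign pattern of the midpoint of two break points. -/
theorem exists_breakPt (y x : ℝ × ℝ) {t : ℝ} (ht : t ∈ Icc (0 : ℝ) 1) :
    ∃ i < I.nf + 2, ∃ j < I.nf + 2, I.startVal y i ≠ I.endVal x i ∧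
      I.startVal y j ≠ I.endVal x j ∧ I.breakPt y x i ∈ Icc (0 : ℝ) 1 ∧
      I.breakPt y x j ∈ Icc (0 : ℝ) 1 ∧ ∀ k < I.nf + 2,
      SplitSign ((1 - t) * I.startVal y k + t * I.endVal x k)
        ((1 - I.breakPt y x i) * I.startVal y k + I.breakPt y x i * I.endVal x k)
        ((1 - I.breakPt y x j) * I.startVal y k + I.breakPt y x j * I.endVal x k) := by
  have s0 : I.startVal y I.nf = 0 := by simp [startVal]
  have e0 : I.endVal x I.nf = 1 := by simp [endVal]
  have s1 : I.startVal y (I.nf + 1) = 1 := by simp [startVal]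
  have e1 : I.endVal x (I.nf + 1) = 0 := by simp [endVal]
  -- the two additional forms, the parameter and its complement, bound the segment
  obtain ⟨i, hi, j, hj, hdi, hdj, h⟩ := exists_breakpoints (Finset.range (I.nf + 2))
    (fun k => (1 - t) * I.startVal y k + t * I.endVal x k)
    (fun k => I.endVal x k - I.startVal y k)
    ⟨I.nf, by simp, by simp [s0, e0], by simp [s0, e0, ht.1]⟩
    ⟨I.nf + 1, by simp, by simp [s1, e1], by
      simpa [s1, e1] using div_nonneg_of_nonpos (sub_nonpos.2 ht.2) (by norm_num : (-1 : ℝ) ≤ 0)⟩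
  simp only [Finset.mem_range] at hi hj h
  have key : ∀ i, I.endVal x i - I.startVal y i ≠ 0 → ∀ k,
      (1 - t) * I.startVal y k + t * I.endVal x k +
        -((1 - t) * I.startVal y i + t * I.endVal x i) / (I.endVal x i - I.startVal y i) *
          (I.endVal x k - I.startVal y k) =
      (1 - I.breakPt y x i) * I.startVal y k + I.breakPt y x i * I.endVal x k := by
    intro i hi k
    have : I.startVal y i - I.endVal x i ≠ 0 := fun h0 => hi (by linarith)
    have e : -((1 - t) * I.startVal y i + t * I.endVal x i) / (I.endVal x i - I.startVal y i) =
        I.breakPt y x i - t := by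
      unfold breakPt
      field_simp
      ring
    rw [e]; ring
  have h' : ∀ k < I.nf + 2, SplitSign ((1 - t) * I.startVal y k + t * I.endVal x k)
        ((1 - I.breakPt y x i) * I.startVal y k + I.breakPt y x i * I.endVal x k)
        ((1 - I.breakPt y x j) * I.startVal y k + I.breakPt y x j * I.endVal x k) := by
    intro k hk
    rw [← key i hdi, ← key j hdj]
    exact h k hk
  have b0 := h' I.nf (by omega)
  have b1 := h' (I.nf + 1) (by omega)
  simp only [s0, e0, s1, e1, mul_zero, mul_one, zero_add, add_zero] at b0 b1
  have c0 : 0 ≤ I.breakPt y x i ∧ 0 ≤ I.breakPt y x j := by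
    rcases ht.1.lt_or_eq with h | h
    · exact ⟨(b0.1 h).1, (b0.1 h).2.1⟩
    · exact ⟨(b0.2.2 h.symm).1.ge, (b0.2.2 h.symm).2.ge⟩
  have c1 : 0 ≤ 1 - I.breakPt y x i ∧ 0 ≤ 1 - I.breakPt y x j := by
    rcases (sub_nonneg.2 ht.2).lt_or_eq with h | h
    · exact ⟨(b1.1 h).1, (b1.1 h).2.1⟩
    · exact ⟨(b1.2.2 h.symm).1.ge, (b1.2.2 h.symm).2.ge⟩
  exact ⟨i, hi, j, hj, fun h => hdi (by linarith), fun h => hdj (by linarith),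
    ⟨c0.1, by linarith⟩, ⟨c0.2, by linarith⟩, h'⟩

/-- The value of the `k`-th extended form at the `i`-th break point in terms of the endpoints: its
sign is determined by a bilinear form and a difference of values. -/
theorem val_breakPt {y x : ℝ × ℝ} {i : ℕ} (h : I.startVal y i ≠ I.endVal x i) (k : ℕ) :
    (1 - I.breakPt y x i) * I.startVal y k + I.breakPt y x i * I.endVal x k =
      (I.startVal y i * I.endVal x k - I.startVal y k * I.endVal x i) /
        (I.startVal y i - I.endVal x i) := by
  have : I.startVal y i - I.endVal x i ≠ 0 := sub_ne_zero.2 h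
  unfold breakPt
  field_simp
  ring

/-- Whether two points see each other depends only on the signs of the forms at the two points
and of the bilinear forms at the pair. -/
theorem Vis.congr {y x y' x' : ℝ × ℝ} (h : I.Vis y x)
    (hy : ∀ q < I.nf, SameSign (ev (I.form q) y) (ev (I.form q) y'))
    (hx : ∀ q < I.nf, SameSign (ev (I.form q) x) (ev (I.form q) x'))
    (hH : ∀ q < I.nf, ∀ r < I.nf, SameSign (I.pairForm q r y x) (I.pairForm q r y' x')) :
    I.Vis y' x' := by
  intro t ht
  obtain ⟨i, hi, j, hj, di, dj, bi, bj, hs⟩ := I.exists_breakPt y' x' ht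
  have hS : ∀ k < I.nf + 2, SameSign (I.startVal y' k) (I.startVal y k) := by
    intro k hk
    unfold startVal
    split_ifs with h1 h2
    exacts [(hy k h1).symm, SameSign.refl _, SameSign.refl _]
  have hE : ∀ k < I.nf + 2, SameSign (I.endVal x' k) (I.endVal x k) := by
    intro k hk
    unfold endVal
    split_ifs with h1 h2
    exacts [(hx k h1).symm, SameSign.refl _, SameSign.refl _]
  have hD : ∀ i < I.nf + 2, ∀ k < I.nf + 2,
      SameSign (I.startVal y' i * I.endVal x' k - I.startVal y' k * I.endVal x' i)
        (I.startVal y i * I.endVal x k - I.startVal y k * I.endVal x i) := by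
    have hb : ∀ i, ¬ i < I.nf → ∀ k < I.nf + 2,
      SameSign (I.startVal y' i * I.endVal x' k - I.startVal y' k * I.endVal x' i)
        (I.startVal y i * I.endVal x k - I.startVal y k * I.endVal x i) := by
      intro i hi k hk
      by_cases h1 : i < I.nf + 1
      · simpa [startVal, endVal, hi, h1] using (hS k hk).neg
      · simpa [startVal, endVal, hi, h1] using hE k hk
    intro i hi k hk
    by_cases h1 : i < I.nf
    · by_cases h2 : k < I.nf
      · have := hH k h2 i h1
        simp only [pairForm] at this
        simpa only [startVal, endVal, h1, h2, if_true] using this.symm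
      · have := (hb k h2 i hi).neg
        rwa [neg_sub, neg_sub] at this
    · exact hb i h1 k hk
  -- the constant form turns the difference of the values into a bilinear form
  have hd : ∀ i < I.nf + 2, SameSign (I.startVal y' i - I.endVal x' i)
      (I.startVal y i - I.endVal x i) := by
    intro i hi
    by_cases h1 : i < I.nf
    · have h2 : I.n + I.n + I.n < I.nf := by unfold nf; omega
      have := hD i hi _ (show I.n + I.n + I.n < I.nf + 2 by omega)
      simpa [startVal, endVal, h2, form_one, ev] using this
    · unfold startVal endVal
      rw [if_neg h1, if_neg h1, if_neg h1, if_neg h1]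
      exact SameSign.refl _
  have key : ∀ i < I.nf + 2, I.startVal y' i ≠ I.endVal x' i → ∀ k < I.nf + 2,
      SameSign ((1 - I.breakPt y' x' i) * I.startVal y' k + I.breakPt y' x' i * I.endVal x' k)
        ((1 - I.breakPt y x i) * I.startVal y k + I.breakPt y x i * I.endVal x k) := by
    intro i hi hne k hk
    have hne' : I.startVal y i ≠ I.endVal x i := fun h0 =>
      hne (sub_eq_zero.1 ((hd i hi).eq_zero_iff.2 (sub_eq_zero.2 h0)))
    rw [I.val_breakPt hne, I.val_breakPt hne']
    exact (hD i hi k hk).div (hd i hi)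
  have hbp : ∀ i < I.nf + 2, I.startVal y' i ≠ I.endVal x' i →
      I.breakPt y' x' i ∈ Icc (0 : ℝ) 1 → I.breakPt y x i ∈ Icc (0 : ℝ) 1 := by
    intro i hi hne hb
    have k0 := key i hi hne I.nf (by omega)
    have k1 := key i hi hne (I.nf + 1) (by omega)
    simp only [startVal, endVal, lt_irrefl, Nat.lt_succ_self, if_true, if_false,
      show ¬ I.nf + 1 < I.nf by omega, mul_zero, mul_one, zero_add, add_zero] at k0 k1
    exact ⟨k0.nonneg_iff.1 hb.1, sub_nonneg.1 (k1.nonneg_iff.1 (sub_nonneg.2 hb.2))⟩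
  -- the point at `t` of the second segment has the signs of a midpoint on the first one
  have ci := hbp i hi di bi
  have cj := hbp j hj dj bj
  refine (InReg.congr I fun q hq => ?_).1
    (h ((I.breakPt y x i + I.breakPt y x j) / 2)
      ⟨by linarith [ci.1, cj.1], by linarith [ci.2, cj.2]⟩)
  have hs' := ((hs q (by omega)).congr (SameSign.refl _) (key i hi di q (by omega))
    (key j hj dj q (by omega))).sameSign
  rw [ev_segPt, ev_segPt]
  simp only [startVal, endVal, hq, if_true] at hs'
  refine (hs'.trans ?_).symm
  convert SameSign.refl _ using 1
  ring

/-- A break point clamped to the parameter interval of the segment. -/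
noncomputable def clampPt (y x : ℝ × ℝ) (q : ℕ) : ℝ := max 0 (min 1 (I.breakPt y x q))

/-- Visibility can be tested at the midpoints of pairs of break points. -/
theorem vis_iff (y x : ℝ × ℝ) : I.Vis y x ↔ ∀ q < I.nf + 2, ∀ r < I.nf + 2,
    I.InReg (segPt y x ((I.clampPt y x q + I.clampPt y x r) / 2)) := by
  constructor
  · intro h q _ r _
    have hc : ∀ q, 0 ≤ I.clampPt y x q ∧ I.clampPt y x q ≤ 1 := fun q =>
      ⟨le_max_left _ _, max_le zero_le_one (min_le_left _ _)⟩
    exact h _ ⟨by linarith [(hc q).1, (hc r).1], by linarith [(hc q).2, (hc r).2]⟩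
  · intro h t ht
    obtain ⟨i, hi, j, hj, -, -, bi, bj, hs⟩ := I.exists_breakPt y x ht
    have h := h i hi j hj
    rw [clampPt, clampPt, min_eq_right bi.2, min_eq_right bj.2, max_eq_right bi.1,
      max_eq_right bj.1] at h
    refine (InReg.congr I fun q hq => ?_).1 h
    have hs' := (hs q (by omega)).sameSign
    rw [ev_segPt, ev_segPt]
    simp only [startVal, endVal, hq, if_true] at hs'
    refine (hs'.trans ?_).symm
    convert SameSign.refl _ using 1
    ring

end Instance
end Watchmen

/-! ### Sampling the cells of a line arrangement -/

namespace Watchmen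

/-- The determinant of three affine forms. -/
def det3 (a b c : ℝ × ℝ × ℝ) : ℝ :=
  a.1 * (b.2.1 * c.2.2 - b.2.2 * c.2.1) - a.2.1 * (b.1 * c.2.2 - b.2.2 * c.1) +
    a.2.2 * (b.1 * c.2.1 - b.2.1 * c.1)

/-- The determinant of the linear parts of two affine forms. -/
def det2 (a b : ℝ × ℝ × ℝ) : ℝ := a.1 * b.2.1 - a.2.1 * b.1

/-- The common zero of two affine forms with independent linear parts. -/
noncomputable def meet (a b : ℝ × ℝ × ℝ) : ℝ × ℝ :=
  ((a.2.1 * b.2.2 - a.2.2 * b.2.1) / det2 a b, (a.2.2 * b.1 - a.1 * b.2.2) / det2 a b)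

theorem ev_meet (c : ℝ × ℝ × ℝ) {a b : ℝ × ℝ × ℝ} (h : det2 a b ≠ 0) :
    ev c (meet a b) = det3 c a b / det2 a b := by
  simp only [ev, meet]
  field_simp
  simp only [det2, det3]
  ring

theorem det3_one (a b : ℝ × ℝ × ℝ) : det3 (0, 0, 1) a b = det2 a b := by
  simp [det2, det3]

theorem det3_eq_zero {a b c : ℝ × ℝ × ℝ} {y : ℝ × ℝ} (ha : ev a y = 0) (hb : ev b y = 0)
    (hc : ev c y = 0) : det3 a b c = 0 := by
  simp only [ev, det3] at *
  linear_combination (b.1 * c.2.1 - b.2.1 * c.1) * ha - (a.1 * c.2.1 - a.2.1 * c.1) * hb +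
    (a.1 * b.2.1 - a.2.1 * b.1) * hc

/-- The centroid of four points. -/
noncomputable def avg4 (v₁ v₂ v₃ v₄ : ℝ × ℝ) : ℝ × ℝ :=
  ((v₁.1 + v₂.1 + v₃.1 + v₄.1) / 4, (v₁.2 + v₂.2 + v₃.2 + v₄.2) / 4)

theorem ev_avg4 (a : ℝ × ℝ × ℝ) (v₁ v₂ v₃ v₄ : ℝ × ℝ) :
    ev a (avg4 v₁ v₂ v₃ v₄) = (ev a v₁ + ev a v₂ + ev a v₃ + ev a v₄) / 4 := by
  simp only [ev, avg4]; ring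

/-- Four values have weakly the sign of `x`, and do not all vanish unless `x` does: the values
arise by splitting `x` twice. -/
def SplitSign4 (x v₁ v₂ v₃ v₄ : ℝ) : Prop :=
  ∃ y z, SplitSign x y z ∧ SplitSign y v₁ v₂ ∧ SplitSign z v₃ v₄

theorem SplitSign4.sameSign {x v₁ v₂ v₃ v₄ v₁' v₂' v₃' v₄' : ℝ} (h : SplitSign4 x v₁ v₂ v₃ v₄)
    (h₁ : SameSign v₁ v₁') (h₂ : SameSign v₂ v₂') (h₃ : SameSign v₃ v₃') (h₄ : SameSign v₄ v₄') :
    SameSign x ((v₁' + v₂' + v₃' + v₄') / 4) := by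
  obtain ⟨y, z, h, hy, hz⟩ := h
  have hy' := (hy.congr (SameSign.refl _) h₁ h₂).sameSign
  have hz' := (hz.congr (SameSign.refl _) h₃ h₄).sameSign
  have := (h.congr (SameSign.refl _) hy' hz').sameSign
  convert this using 1
  ring

/-- On a line of an arrangement, the sign pattern at a point splits into those at two vertices,
provided that the point lies between two horizontal lines of the arrangement. -/
theorem exists_meet_of_mem_line {ι : Type*} (s : Finset ι) (a : ι → ℝ × ℝ × ℝ) {p : ℝ × ℝ} {i : ι}
    (hp : ev (a i) p = 0) (hi : (a i).1 ≠ 0)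
    (h0 : ∃ j ∈ s, (a j).1 = 0 ∧ (a j).2.1 = 1 ∧ 0 ≤ ev (a j) p)
    (h1 : ∃ j ∈ s, (a j).1 = 0 ∧ (a j).2.1 = 1 ∧ ev (a j) p ≤ 0) :
    ∃ j ∈ s, ∃ j' ∈ s, det2 (a i) (a j) ≠ 0 ∧ det2 (a i) (a j') ≠ 0 ∧
      ∀ k ∈ s, SplitSign (ev (a k) p) (ev (a k) (meet (a i) (a j)))
        (ev (a k) (meet (a i) (a j'))) := by
  -- moving along the line `a i`, the form `a k` changes with the rate `det2 (a i) (a k)`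
  have key : ∃ j ∈ s, ∃ j' ∈ s, det2 (a i) (a j) ≠ 0 ∧ det2 (a i) (a j') ≠ 0 ∧
      ∀ k ∈ s, SplitSign (ev (a k) p) (ev (a k) p + -ev (a j) p / det2 (a i) (a j) *
        det2 (a i) (a k)) (ev (a k) p + -ev (a j') p / det2 (a i) (a j') * det2 (a i) (a k)) := by
    obtain ⟨j, hj, hj1, hj2, hj3⟩ := h0
    obtain ⟨j', hj', hj1', hj2', hj3'⟩ := h1
    have d : det2 (a i) (a j) = (a i).1 := by simp [det2, hj1, hj2]
    have d' : det2 (a i) (a j') = (a i).1 := by simp [det2, hj1', hj2']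
    rcases lt_or_gt_of_ne hi with h | h
    · refine exists_breakpoints s (fun k => ev (a k) p) (fun k => det2 (a i) (a k))
        ⟨j', hj', by rwa [d'], ?_⟩ ⟨j, hj, by rwa [d], ?_⟩
      · rw [d']; exact div_nonpos_of_nonneg_of_nonpos (by linarith) h.le
      · rw [d]; exact div_nonneg_of_nonpos (by linarith) h.le
    · refine exists_breakpoints s (fun k => ev (a k) p) (fun k => det2 (a i) (a k))
        ⟨j, hj, by rwa [d], ?_⟩ ⟨j', hj', by rwa [d'], ?_⟩
      · rw [d]; exact div_nonpos_of_nonpos_of_nonneg (by linarith) h.le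
      · rw [d']; exact div_nonneg (by linarith) h.le
  obtain ⟨j, hj, j', hj', d, d', h⟩ := key
  have hk : ∀ j, det2 (a i) (a j) ≠ 0 → ∀ k, ev (a k) p + -ev (a j) p / det2 (a i) (a j) *
      det2 (a i) (a k) = ev (a k) (meet (a i) (a j)) := by
    intro j d k
    rw [ev_meet _ d]
    field_simp
    simp only [ev, det2, det3] at *
    linear_combination ((a k).1 * (a j).2.1 - (a k).2.1 * (a j).1) * hp
  refine ⟨j, hj, j', hj', d, d', fun k hk' => ?_⟩
  rw [← hk j d, ← hk j' d']
  exact h k hk'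

/-- In an arrangement that bounds `p` horizontally and vertically, the sign pattern at `p` splits
into those at four vertices. -/
theorem exists_splitSign4 {ι : Type*} (s : Finset ι) (a : ι → ℝ × ℝ × ℝ) {p : ℝ × ℝ}
    (hx0 : ∃ j ∈ s, (a j).1 = 1 ∧ 0 ≤ ev (a j) p) (hx1 : ∃ j ∈ s, (a j).1 = 1 ∧ ev (a j) p ≤ 0)
    (h0 : ∃ j ∈ s, (a j).1 = 0 ∧ (a j).2.1 = 1 ∧ 0 ≤ ev (a j) p)
    (h1 : ∃ j ∈ s, (a j).1 = 0 ∧ (a j).2.1 = 1 ∧ ev (a j) p ≤ 0) :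
    ∃ i₁ ∈ s, ∃ j₁ ∈ s, ∃ i₂ ∈ s, ∃ j₂ ∈ s, ∃ i₃ ∈ s, ∃ j₃ ∈ s, ∃ i₄ ∈ s, ∃ j₄ ∈ s,
      det2 (a i₁) (a j₁) ≠ 0 ∧ det2 (a i₂) (a j₂) ≠ 0 ∧ det2 (a i₃) (a j₃) ≠ 0 ∧
      det2 (a i₄) (a j₄) ≠ 0 ∧
      ∀ k ∈ s, SplitSign4 (ev (a k) p) (ev (a k) (meet (a i₁) (a j₁)))
        (ev (a k) (meet (a i₂) (a j₂))) (ev (a k) (meet (a i₃) (a j₃)))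
        (ev (a k) (meet (a i₄) (a j₄))) := by
  -- moving horizontally in both directions up to the first lines, and then along these lines
  have key : ∃ i ∈ s, ∃ j ∈ s, (a i).1 ≠ 0 ∧ (a j).1 ≠ 0 ∧
      ∀ k ∈ s, SplitSign (ev (a k) p) (ev (a k) p + -ev (a i) p / (a i).1 * (a k).1)
        (ev (a k) p + -ev (a j) p / (a j).1 * (a k).1) := by
    obtain ⟨j, hj, hj1, hj3⟩ := hx0
    obtain ⟨j', hj', hj1', hj3'⟩ := hx1
    refine exists_breakpoints s (fun k => ev (a k) p) (fun k => (a k).1)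
        ⟨j, hj, by simp [hj1], by simpa [hj1]⟩ ⟨j', hj', by simp [hj1'], by simpa [hj1']⟩
  obtain ⟨i, hi, j, hj, di, dj, h⟩ := key
  have hk : ∀ t, ∀ k, ev (a k) p + t * (a k).1 = ev (a k) (p.1 + t, p.2) := by
    intro t k; simp only [ev]; ring
  simp only [hk] at h
  have line : ∀ i ∈ s, (a i).1 ≠ 0 → ev (a i) (p.1 + -ev (a i) p / (a i).1, p.2) = 0 := by
    intro i _ di
    rw [← hk]; field_simp; ring
  have box0 : ∀ t, ∃ j ∈ s, (a j).1 = 0 ∧ (a j).2.1 = 1 ∧ 0 ≤ ev (a j) (p.1 + t, p.2) := by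
    intro t
    obtain ⟨j, hj, e1, e2, e3⟩ := h0
    exact ⟨j, hj, e1, e2, by rw [← hk, e1]; simpa using e3⟩
  have box1 : ∀ t, ∃ j ∈ s, (a j).1 = 0 ∧ (a j).2.1 = 1 ∧ ev (a j) (p.1 + t, p.2) ≤ 0 := by
    intro t
    obtain ⟨j, hj, e1, e2, e3⟩ := h1
    exact ⟨j, hj, e1, e2, by rw [← hk, e1]; simpa using e3⟩
  obtain ⟨j₁, hj₁, j₂, hj₂, d₁, d₂, e⟩ := exists_meet_of_mem_line s a (line i hi di) di
    (box0 _) (box1 _)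
  obtain ⟨j₃, hj₃, j₄, hj₄, d₃, d₄, e'⟩ := exists_meet_of_mem_line s a (line j hj dj) dj
    (box0 _) (box1 _)
  exact ⟨i, hi, j₁, hj₁, i, hi, j₂, hj₂, j, hj, j₃, hj₃, j, hj, j₄, hj₄, d₁, d₂, d₃, d₄,
    fun k hk => ⟨_, _, h k hk, e k hk, e' k hk⟩⟩

/-- An affine function that does not vanish at `t`, or vanishes identically, has constant sign
near `t`. -/
theorem eventually_sameSign_affine {h₀ h₁ t : ℝ} (ht : t ≠ h₀ / (h₀ - h₁)) :
    ∀ᶠ u in nhds t, SameSign ((1 - t) * h₀ + t * h₁) ((1 - u) * h₀ + u * h₁) := by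
  have hc : Continuous fun u : ℝ => (1 - u) * h₀ + u * h₁ := by fun_prop
  rcases lt_trichotomy ((1 - t) * h₀ + t * h₁) 0 with h | h | h
  · filter_upwards [(isOpen_lt hc continuous_const).mem_nhds h] with u hu
    have hu : (1 - u) * h₀ + u * h₁ < 0 := hu
    exact ⟨by simp [h.not_gt, hu.not_gt], by simp [h, hu]⟩
  · have h01 : h₀ = h₁ := by
      by_contra hne
      have : h₀ - h₁ ≠ 0 := sub_ne_zero.2 hne
      apply ht
      field_simp
      linarith
    subst h01
    have : h₀ = 0 := by linarith
    subst this
    simp [SameSign]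
  · filter_upwards [(isOpen_lt continuous_const hc).mem_nhds h] with u hu
    have hu : 0 < (1 - u) * h₀ + u * h₁ := hu
    exact ⟨by simp [h, hu], by simp [h.not_gt, hu.not_gt]⟩

/-- One of the two roots (selected by `σ = 1` or `σ = -1`) of the quadratic polynomial with the
values `q₀`, `qh`, `q₁` at `0`, `1/2`, `1`; the root of a linear polynomial, if the leading
coefficient vanishes. -/
noncomputable def quadRoot (σ q₀ qh q₁ : ℝ) : ℝ :=
  if 2 * (q₀ + q₁ - 2 * qh) = 0 then -q₀ / (q₁ - q₀)
  else (-(q₁ - q₀ - 2 * (q₀ + q₁ - 2 * qh)) + σ * √((q₁ - q₀ - 2 * (q₀ + q₁ - 2 * qh)) ^ 2 -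
    4 * (2 * (q₀ + q₁ - 2 * qh)) * q₀)) / (2 * (2 * (q₀ + q₁ - 2 * qh)))

/-- The quadratic formula, including the linear case; the coefficients are recovered from the
values at `0`, `1/2`, `1`. -/
theorem eq_quadRoot {c₀ c₁ c₂ t : ℝ} (ht : c₀ + c₁ * t + c₂ * t ^ 2 = 0)
    (hne : ¬ (c₀ = 0 ∧ c₁ = 0 ∧ c₂ = 0)) :
    t = quadRoot 1 c₀ (c₀ + c₁ / 2 + c₂ / 4) (c₀ + c₁ + c₂) ∨
      t = quadRoot (-1) c₀ (c₀ + c₁ / 2 + c₂ / 4) (c₀ + c₁ + c₂) := by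
  have e2 : 2 * (c₀ + (c₀ + c₁ + c₂) - 2 * (c₀ + c₁ / 2 + c₂ / 4)) = c₂ := by ring
  have e1 : c₀ + c₁ + c₂ - c₀ - c₂ = c₁ := by ring
  simp only [quadRoot, e2, e1]
  by_cases h2 : c₂ = 0
  · left
    subst h2
    have h1 : c₁ ≠ 0 := by
      rintro rfl
      exact hne ⟨by simpa using ht, rfl, rfl⟩
    have : c₀ + c₁ + 0 - c₀ = c₁ := by ring
    rw [if_pos rfl, this]
    field_simp
    linarith
  · rw [if_neg h2, if_neg h2]
    have hd : c₁ ^ 2 - 4 * c₂ * c₀ = (2 * c₂ * t + c₁) ^ 2 := by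
      linear_combination (-4 * c₂) * ht
    rw [hd, Real.sqrt_sq_eq_abs]
    rcases abs_choice (2 * c₂ * t + c₁) with h | h <;> rw [h]
    · left; field_simp; ring
    · right; field_simp; ring

theorem eventually_sameSign_quadratic {c₀ c₁ c₂ t : ℝ}
    (h1 : t ≠ quadRoot 1 c₀ (c₀ + c₁ / 2 + c₂ / 4) (c₀ + c₁ + c₂))
    (h2 : t ≠ quadRoot (-1) c₀ (c₀ + c₁ / 2 + c₂ / 4) (c₀ + c₁ + c₂)) :
    ∀ᶠ u in nhds t, SameSign (c₀ + c₁ * t + c₂ * t ^ 2) (c₀ + c₁ * u + c₂ * u ^ 2) := by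
  have hc : Continuous fun u : ℝ => c₀ + c₁ * u + c₂ * u ^ 2 := by fun_prop
  rcases lt_trichotomy (c₀ + c₁ * t + c₂ * t ^ 2) 0 with h | h | h
  · filter_upwards [(isOpen_lt hc continuous_const).mem_nhds h] with u hu
    have hu : c₀ + c₁ * u + c₂ * u ^ 2 < 0 := hu
    exact ⟨by simp [h.not_gt, hu.not_gt], by simp [h, hu]⟩
  · by_cases hz : c₀ = 0 ∧ c₁ = 0 ∧ c₂ = 0
    · obtain ⟨rfl, rfl, rfl⟩ := hz
      simp [SameSign]
    · rcases eq_quadRoot h hz with h' | h'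
      exacts [absurd h' h1, absurd h' h2]
  · filter_upwards [(isOpen_lt continuous_const hc).mem_nhds h] with u hu
    have hu : 0 < c₀ + c₁ * u + c₂ * u ^ 2 := hu
    exact ⟨by simp [h, hu], by simp [h.not_gt, hu.not_gt]⟩

/-! ### Ramp functions and the curve -/

/-- The projection of the reals to the unit interval. -/
noncomputable def clamp01 (z : ℝ) : ℝ := max 0 (min 1 z)

theorem clamp01_of_nonpos {z : ℝ} (h : z ≤ 0) : clamp01 z = 0 :=
  max_eq_left ((min_le_right _ _).trans h)

theorem clamp01_of_one_le {z : ℝ} (h : 1 ≤ z) : clamp01 z = 1 := by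
  rw [clamp01, min_eq_left h, max_eq_right zero_le_one]

theorem clamp01_of_mem {z : ℝ} (h : z ∈ Icc (0 : ℝ) 1) : clamp01 z = z := by
  rw [clamp01, min_eq_right h.2, max_eq_right h.1]

theorem continuous_clamp01 : Continuous clamp01 := by
  unfold clamp01; fun_prop

theorem monotone_clamp01 : Monotone clamp01 := fun _ _ h =>
  max_le_max le_rfl (min_le_min le_rfl h)

/-- The function that is `0` at `0` and has slope `w i` on `[i, i + 1]`. -/
noncomputable def ramp (K : ℕ) (w : ℕ → ℝ) (s : ℝ) : ℝ :=
  ∑ i ∈ Finset.range K, w i * clamp01 (s - i)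

theorem continuous_ramp (K : ℕ) (w : ℕ → ℝ) : Continuous (ramp K w) := by
  unfold ramp
  have := continuous_clamp01
  fun_prop

theorem ramp_add {K j : ℕ} (hj : j < K) (w : ℕ → ℝ) {t : ℝ} (ht : t ∈ Icc (0 : ℝ) 1) :
    ramp K w (j + t) = (∑ i ∈ Finset.range j, w i) + t * w j := by
  obtain ⟨d, rfl⟩ : ∃ d, K = j + 1 + d := ⟨K - (j + 1), by omega⟩
  rw [ramp, Finset.sum_range_add, Finset.sum_range_succ]
  have h1 : ∀ i ∈ Finset.range j, w i * clamp01 (j + t - i) = w i := by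
    intro i hi
    have : (i : ℝ) + 1 ≤ j := by exact_mod_cast Finset.mem_range.1 hi
    rw [clamp01_of_one_le (by linarith [ht.1]), mul_one]
  have h2 : ∀ i ∈ Finset.range d, w (j + 1 + i) * clamp01 (j + t - ((j + 1 + i : ℕ) : ℝ)) = 0 := by
    intro i _
    rw [clamp01_of_nonpos, mul_zero]
    push_cast
    have : (0 : ℝ) ≤ i := by positivity
    linarith [ht.2]
  rw [Finset.sum_congr rfl h1, Finset.sum_eq_zero h2, add_sub_cancel_left, clamp01_of_mem ht]
  ring

namespace Instance

variable (I : Instance)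

/-- The first coordinate of a vertex of the curve. -/
noncomputable def cx (i : ℕ) : ℝ := I.input.realArr 2 i

/-- The second coordinate of a vertex of the curve. -/
noncomputable def cy (i : ℕ) : ℝ := I.input.realArr 3 i

/-- The point of the curve at parameter `s`, in coordinates; the parameter is clamped to the
parameter interval. -/
noncomputable def cpt (s : ℝ) : ℝ × ℝ :=
  (I.cx 0 + ramp (I.k - 1) (fun i => I.cx (i + 1) - I.cx i) s,
    I.cy 0 + ramp (I.k - 1) (fun i => I.cy (i + 1) - I.cy i) s)

theorem continuous_cpt : Continuous I.cpt :=
  (continuous_const.add (continuous_ramp _ _)).prodMk (continuous_const.add (continuous_ramp _ _))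

theorem cpt_add {j : ℕ} (hj : j < I.k - 1) {t : ℝ} (ht : t ∈ Icc (0 : ℝ) 1) :
    I.cpt (j + t) = segPt (I.cx j, I.cy j) (I.cx (j + 1), I.cy (j + 1)) t := by
  simp only [cpt, segPt, ramp_add hj _ ht, Finset.sum_range_sub]
  ext <;> simp <;> ring

theorem cpt_eq_segPt {j : ℕ} (hj : j < I.k - 1) {t : ℝ} (ht : t ∈ Icc (0 : ℝ) 1) :
    I.cpt (j + t) = segPt (I.cpt j) (I.cpt (j + 1)) t := by
  have h0 := I.cpt_add hj (t := 0) (by simp)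
  have h1 := I.cpt_add hj (t := 1) (by simp)
  rw [add_zero] at h0
  rw [I.cpt_add hj ht, h0, h1]
  simp [segPt]

theorem cast_k_sub_one : ((I.k - 1 : ℕ) : ℝ) = (I.k : ℝ) - 1 := by
  have := NeZero.pos I.k
  rw [Nat.cast_sub (by omega), Nat.cast_one]

/-- A parameter is the index of a vertex or lies inside an edge. -/
theorem params_cases {s : ℝ} (hs : s ∈ I.params) :
    (∃ j < I.k, s = j) ∨ ∃ j < I.k - 1, ∃ t ∈ Ioo (0 : ℝ) 1, s = j + t := by
  rw [params, ← cast_k_sub_one] at hs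
  have hk := NeZero.pos I.k
  have h1 := Nat.floor_le hs.1
  have h2 := Nat.lt_floor_add_one s
  rcases h1.lt_or_eq with h | h
  · right
    refine ⟨⌊s⌋₊, ?_, s - ⌊s⌋₊, ⟨by linarith, by linarith⟩, by ring⟩
    have : ((⌊s⌋₊ : ℕ) : ℝ) < ((I.k - 1 : ℕ) : ℝ) := h.trans_le hs.2
    exact_mod_cast this
  · left
    refine ⟨⌊s⌋₊, ?_, h.symm⟩
    have : ((⌊s⌋₊ : ℕ) : ℝ) ≤ ((I.k - 1 : ℕ) : ℝ) := h.le.trans hs.2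
    have : ⌊s⌋₊ ≤ I.k - 1 := by exact_mod_cast this
    omega

theorem chain_coord {i : ℕ} (hi : i < I.k) :
    coords (I.chain (Fin.ofNat I.k i)) = (I.cx i, I.cy i) := by
  simp [coords, cx, cy, input, hi]

theorem coords_curve {s : ℝ} (hs : s ∈ I.params) : coords (I.curve s) = I.cpt s := by
  have hk := NeZero.pos I.k
  rcases I.params_cases hs with ⟨j, hj, rfl⟩ | ⟨j, hj, t, ht, rfl⟩
  · have : I.curve j = I.chain (Fin.ofNat I.k j) := by
      simp [curve, polyline]
    rw [this, chain_coord I hj]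
    rcases Nat.lt_or_ge j (I.k - 1) with h | h
    · have := I.cpt_add h (t := 0) (by simp)
      rw [add_zero] at this
      rw [this]; simp [segPt]
    · rcases Nat.eq_zero_or_pos j with rfl | hj0
      · have h1 : I.k - 1 = 0 := by omega
        simp [cpt, ramp, h1]
      · have := I.cpt_add (show j - 1 < I.k - 1 by omega) (t := 1) (by simp)
        rw [Nat.cast_sub hj0, Nat.cast_one, sub_add_cancel, Nat.sub_add_cancel hj0] at this
        rw [this]; simp [segPt]
  · have hf : ⌊(j : ℝ) + t⌋₊ = j := by
      rw [add_comm, Nat.floor_add_natCast ht.1.le, Nat.floor_eq_zero.2 ht.2, zero_add]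
    have hfr : Int.fract ((j : ℝ) + t) = t := by
      rw [Int.fract_natCast_add, Int.fract_eq_self.2 ⟨ht.1.le, ht.2⟩]
    rw [I.cpt_add hj ⟨ht.1.le, ht.2.le⟩, ← chain_coord I (by omega), ← chain_coord I (by omega),
      curve, polyline, hf, hfr]
    simp only [coords, segPt, AffineMap.lineMap_apply_module]
    simp

end Instance
end Watchmen

/-! ### The frontier of the greedy hitting set -/

namespace Watchmen
namespace Instance

variable (I : Instance)

/-- The parameters of the points of the curve from which `x` is visible. -/
def seeing (x : ℝ × ℝ) : Set ℝ := {u | u ∈ I.params ∧ I.Vis (I.cpt u) x}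

/-- Every point of the region is visible from a nonempty subpath of the curve. -/
def ChainVisible : Prop :=
  ∀ x, I.InReg x → (I.seeing x).Nonempty ∧ (I.seeing x).OrdConnected

theorem isCompact_seeing (x : ℝ × ℝ) : IsCompact (I.seeing x) := by
  refine isCompact_Icc.inter_right (t := {u | I.Vis (I.cpt u) x})
    (I.isClosed_vis.preimage (f := fun u => (I.cpt u, x)) ?_)
  have := I.continuous_cpt
  fun_prop

/-- The form `x ↦ G(y) F(x) - F(y) G(x)` for the forms `F, G` with indices `q, r`. -/
noncomputable def pairCoef (q r : ℕ) (y : ℝ × ℝ) : ℝ × ℝ × ℝ :=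
  (ev (I.form r) y * (I.form q).1 - ev (I.form q) y * (I.form r).1,
    ev (I.form r) y * (I.form q).2.1 - ev (I.form q) y * (I.form r).2.1,
    ev (I.form r) y * (I.form q).2.2 - ev (I.form q) y * (I.form r).2.2)

theorem ev_pairCoef (q r : ℕ) (y x : ℝ × ℝ) :
    ev (I.pairCoef q r y) x = I.pairForm q r y x := by
  simp only [ev, pairCoef, pairForm]; ring

/-- The arrangement that determines visibility from the points `y` and `z`: the forms of the
polygon and the bilinear forms with one argument fixed to `y` or `z`. -/
noncomputable def arr (y z : ℝ × ℝ) (i : ℕ × ℕ × ℕ) : ℝ × ℝ × ℝ :=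
  if i.1 = 0 then I.form i.2.1
  else if i.1 = 1 then I.pairCoef i.2.1 i.2.2 y
  else I.pairCoef i.2.1 i.2.2 z

/-- The indices of the forms in the arrangements. -/
def idx : Finset (ℕ × ℕ × ℕ) :=
  Finset.range 3 ×ˢ Finset.range I.nf ×ˢ Finset.range I.nf

theorem mem_idx {i : ℕ × ℕ × ℕ} : i ∈ I.idx ↔ i.1 < 3 ∧ i.2.1 < I.nf ∧ i.2.2 < I.nf := by
  simp [idx]

/-- The point `x` is seen only from parameters strictly between `f` and `s`. -/
def SeesOnly (f s : ℝ) (x : ℝ × ℝ) : Prop := ∀ u ∈ I.seeing x, f < u ∧ u < s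

/-- Some point of the region is seen only from parameters strictly between `f` and `s`. -/
def Gap (f s : ℝ) : Prop := ∃ x, I.InReg x ∧ I.SeesOnly f s x

theorem Gap.mono {f s s' : ℝ} (h : I.Gap f s) (hs : s ≤ s') : I.Gap f s' := by
  obtain ⟨x, hx, h⟩ := h
  exact ⟨x, hx, fun u hu => ⟨(h u hu).1, (h u hu).2.trans_le hs⟩⟩

variable {I}

/-- While a point moves inside the region and two bounds move along the curve, such that the
point is never seen from a bound, the part of the curve seeing the point stays between them. -/
theorem SeesOnly.path (hI : I.ChainVisible) {f a b : ℝ} {γ : ℝ → ℝ × ℝ} {τ : ℝ → ℝ}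
    (hγ : ContinuousOn γ (Icc a b)) (hτ : ContinuousOn τ (Icc a b))
    (hreg : ∀ v ∈ Icc a b, I.InReg (γ v))
    (hf : ∀ v ∈ Icc a b, 0 ≤ f → ¬ I.Vis (I.cpt f) (γ v))
    (hs : ∀ v ∈ Icc a b, τ v ≤ (I.k : ℝ) - 1 → ¬ I.Vis (I.cpt (τ v)) (γ v))
    {e : ℝ} (he : e ∈ Icc a b) (h : I.SeesOnly f (τ e) (γ e)) :
    ∀ v ∈ Icc a b, I.SeesOnly f (τ v) (γ v) := by
  -- The times at which some seeing parameter lies between the bounds, and those at which some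
  -- seeing parameter does not lie strictly between them, form closed sets that cover the interval.
  -- At a common time the subpath of seeing parameters would contain a bound.
  have hclosed : ∀ R : ℝ → ℝ → Prop, IsClosed {p : ℝ × ℝ | R p.1 p.2} →
      IsClosed {v | v ∈ Icc a b ∧ ∃ w ∈ I.seeing (γ v), R w (τ v)} := by
    intro R hR
    have h1 : IsClosed ((Icc a b ×ˢ I.params) ∩
        (fun p : ℝ × ℝ => ((I.cpt p.2, γ p.1), (p.2, τ p.1))) ⁻¹'
          ({p | I.Vis p.1 p.2} ×ˢ {p : ℝ × ℝ | R p.1 p.2})) := by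
      refine ContinuousOn.preimage_isClosed_of_isClosed ?_
        (isClosed_Icc.prod isClosed_Icc) (I.isClosed_vis.prod hR)
      have c1 : ContinuousOn (fun p : ℝ × ℝ => γ p.1) (Icc a b ×ˢ I.params) :=
        hγ.comp continuousOn_fst fun p hp => hp.1
      have c2 : ContinuousOn (fun p : ℝ × ℝ => τ p.1) (Icc a b ×ˢ I.params) :=
        hτ.comp continuousOn_fst fun p hp => hp.1
      exact ((I.continuous_cpt.comp continuous_snd).continuousOn.prodMk c1).prodMk
        (continuousOn_snd.prodMk c2)
    have h2 : IsCompact ((Icc a b ×ˢ I.params) ∩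
        (fun p : ℝ × ℝ => ((I.cpt p.2, γ p.1), (p.2, τ p.1))) ⁻¹'
          ({p | I.Vis p.1 p.2} ×ˢ {p : ℝ × ℝ | R p.1 p.2})) :=
      (isCompact_Icc.prod isCompact_Icc).of_isClosed_subset h1 inter_subset_left
    convert (h2.image continuous_fst).isClosed using 1
    ext v
    constructor
    · rintro ⟨hv, w, ⟨hw, hw'⟩, hR⟩
      exact ⟨(v, w), ⟨⟨hv, hw⟩, hw', hR⟩, rfl⟩
    · rintro ⟨⟨v', w⟩, ⟨⟨hv, hw⟩, hw', hR⟩, rfl⟩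
      exact ⟨hv, w, ⟨hw, hw'⟩, hR⟩
  have hG := hclosed (fun w t => f ≤ w ∧ w ≤ t)
    ((isClosed_le continuous_const continuous_fst).inter
      (isClosed_le continuous_fst continuous_snd))
  have hB := hclosed (fun w t => w ≤ f ∨ t ≤ w)
    ((isClosed_le continuous_fst continuous_const).union
      (isClosed_le continuous_snd continuous_fst))
  intro v hv u hu
  by_contra hcon
  have hu' : u ≤ f ∨ τ v ≤ u := by
    by_contra! h'
    exact hcon h'
  obtain ⟨w, hw⟩ := (hI _ (hreg e he)).1
  have hcover : Icc a b ⊆ {v | v ∈ Icc a b ∧ ∃ w ∈ I.seeing (γ v), f ≤ w ∧ w ≤ τ v} ∪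
      {v | v ∈ Icc a b ∧ ∃ w ∈ I.seeing (γ v), w ≤ f ∨ τ v ≤ w} := by
    intro z hz
    obtain ⟨w, hw⟩ := (hI _ (hreg z hz)).1
    by_cases h' : f ≤ w ∧ w ≤ τ z
    · exact Or.inl ⟨hz, w, hw, h'⟩
    · refine Or.inr ⟨hz, w, hw, ?_⟩
      by_contra! h''
      exact h' ⟨h''.1.le, h''.2.le⟩
  obtain ⟨z, hz, ⟨-, w₁, hw₁, h₁⟩, ⟨-, w₂, hw₂, h₂⟩⟩ := isPreconnected_closed_iff.1
    (isPreconnected_Icc (a := a) (b := b)) _ _ hG hB hcover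
    ⟨e, he, he, w, hw, (h w hw).1.le, (h w hw).2.le⟩ ⟨v, hv, hv, u, hu, hu'⟩
  rcases h₂ with h₂ | h₂
  · exact hf z hz (hw₂.1.1.trans h₂) ((hI _ (hreg z hz)).2.out hw₂ hw₁ ⟨h₂, h₁.1⟩).2
  · exact hs z hz (h₂.trans hw₂.1.2) ((hI _ (hreg z hz)).2.out hw₁ hw₂ ⟨h₁.2, h₂⟩).2

theorem arr_form (y z : ℝ × ℝ) (q r : ℕ) : I.arr y z (0, q, r) = I.form q := by simp [arr]

theorem arr_fst (y z : ℝ × ℝ) (q r : ℕ) : I.arr y z (1, q, r) = I.pairCoef q r y := by simp [arr]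

theorem arr_snd (y z : ℝ × ℝ) (q r : ℕ) : I.arr y z (2, q, r) = I.pairCoef q r z := by simp [arr]

theorem nf_pos : 0 < I.nf := Nat.succ_pos _

theorem sameSign_form {y z x y' z' x' : ℝ × ℝ}
    (h : ∀ i ∈ I.idx, SameSign (ev (I.arr y z i) x) (ev (I.arr y' z' i) x')) {q : ℕ}
    (hq : q < I.nf) : SameSign (ev (I.form q) x) (ev (I.form q) x') := by
  simpa only [arr_form] using h (0, q, 0) (I.mem_idx.2 ⟨by simp, hq, nf_pos⟩)

theorem inReg_of_sameSign {y z x y' z' x' : ℝ × ℝ} (hx : I.InReg x)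
    (h : ∀ i ∈ I.idx, SameSign (ev (I.arr y z i) x) (ev (I.arr y' z' i) x')) : I.InReg x' :=
  (InReg.congr I fun _ hq => sameSign_form h hq).1 hx

theorem not_vis_fst {y z x z' x' : ℝ × ℝ} (hx : ¬ I.Vis y x)
    (h : ∀ i ∈ I.idx, SameSign (ev (I.arr y z i) x) (ev (I.arr y z' i) x')) : ¬ I.Vis y x' := by
  refine fun hv => hx (Vis.congr I hv (fun _ _ => SameSign.refl _)
    (fun q hq => (sameSign_form h hq).symm) fun q hq r hr => ?_)
  have := h (1, q, r) (I.mem_idx.2 ⟨by simp, hq, hr⟩)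
  rw [arr_fst, arr_fst, ev_pairCoef, ev_pairCoef] at this
  exact this.symm

theorem not_vis_snd {y z x z' x' : ℝ × ℝ} (hx : ¬ I.Vis z x)
    (hz : ∀ q < I.nf, SameSign (ev (I.form q) z) (ev (I.form q) z'))
    (h : ∀ i ∈ I.idx, SameSign (ev (I.arr y z i) x) (ev (I.arr y z' i) x')) : ¬ I.Vis z' x' := by
  refine fun hv => hx (Vis.congr I hv (fun q hq => (hz q hq).symm)
    (fun q hq => (sameSign_form h hq).symm) fun q hq r hr => ?_)
  have := h (2, q, r) (I.mem_idx.2 ⟨by simp, hq, hr⟩)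
  rw [arr_snd, arr_snd, ev_pairCoef, ev_pairCoef] at this
  exact this.symm

theorem SeesOnly.not_vis_left {f s : ℝ} {x : ℝ × ℝ} (h : I.SeesOnly f s x)
    (hf : f ≤ (I.k : ℝ) - 1) (h0 : 0 ≤ f) : ¬ I.Vis (I.cpt f) x :=
  fun hv => lt_irrefl f (h f ⟨⟨h0, hf⟩, hv⟩).1

theorem SeesOnly.not_vis_right {f s : ℝ} {x : ℝ × ℝ} (h : I.SeesOnly f s x)
    (hs : 0 ≤ s) (h1 : s ≤ (I.k : ℝ) - 1) : ¬ I.Vis (I.cpt s) x :=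
  fun hv => lt_irrefl s (h s ⟨⟨hs, h1⟩, hv⟩).2

/-- Within a cell of the arrangement, being seen only from between `f` and `s` is constant. -/
theorem SeesOnly.of_sameSign (hI : I.ChainVisible) {f s : ℝ} (hf : f ≤ (I.k : ℝ) - 1) (hs : 0 ≤ s)
    {x x' : ℝ × ℝ} (hx : I.InReg x) (h : I.SeesOnly f s x)
    (hxx : ∀ i ∈ I.idx, SameSign (ev (I.arr (I.cpt f) (I.cpt s) i) x)
      (ev (I.arr (I.cpt f) (I.cpt s) i) x')) : I.SeesOnly f s x' := by
  have hseg : ∀ v ∈ Icc (0 : ℝ) 1, ∀ i ∈ I.idx, SameSign (ev (I.arr (I.cpt f) (I.cpt s) i) x)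
      (ev (I.arr (I.cpt f) (I.cpt s) i) (segPt x x' v)) := by
    intro v hv i hi
    have h0 := hxx i hi
    rw [ev_segPt]
    generalize ev (I.arr (I.cpt f) (I.cpt s) i) x = A at *
    generalize ev (I.arr (I.cpt f) (I.cpt s) i) x' = B at *
    have hv1 : 0 ≤ 1 - v := sub_nonneg.2 hv.2
    rcases lt_trichotomy A 0 with hA | hA | hA
    · have hB := h0.2.1 hA
      have : (1 - v) * A + v * B < 0 := by
        rcases hv.1.lt_or_eq with h | h
        · nlinarith [mul_nonneg hv1 (neg_nonneg.2 hA.le), mul_pos h (neg_pos.2 hB)]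
        · rw [← h]; simpa using hA
      simp [SameSign, hA, this, hA.not_gt, this.not_gt]
    · have hB := h0.eq_zero_iff.1 hA
      simp [SameSign, hA, hB]
    · have hB := h0.1.1 hA
      have : 0 < (1 - v) * A + v * B := by
        rcases hv.1.lt_or_eq with h | h
        · nlinarith [mul_nonneg hv1 hA.le, mul_pos h hB]
        · rw [← h]; simpa using hA
      simp [SameSign, hA, this, hA.not_gt, this.not_gt]
  have := SeesOnly.path hI (f := f) (a := 0) (b := 1) (γ := segPt x x') (τ := fun _ => s) (e := 0)
    (by unfold segPt; fun_prop) (by fun_prop) (fun v hv => inReg_of_sameSign hx (hseg v hv))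
    (fun v hv h0 => not_vis_fst (h.not_vis_left hf h0) (hseg v hv))
    (fun v hv h1 => not_vis_snd (h.not_vis_right hs h1) (fun _ _ => SameSign.refl _) (hseg v hv))
    (by simp) (by simpa [segPt] using h) 1 (by simp)
  simpa [segPt] using this

/-- Every sign pattern of the arrangement in the region splits into those at four vertices. -/
theorem exists_vertices {x : ℝ × ℝ} (hx : I.InReg x) (y z : ℝ × ℝ) :
    ∃ i₁ ∈ I.idx, ∃ j₁ ∈ I.idx, ∃ i₂ ∈ I.idx, ∃ j₂ ∈ I.idx, ∃ i₃ ∈ I.idx, ∃ j₃ ∈ I.idx,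
      ∃ i₄ ∈ I.idx, ∃ j₄ ∈ I.idx,
      det2 (I.arr y z i₁) (I.arr y z j₁) ≠ 0 ∧ det2 (I.arr y z i₂) (I.arr y z j₂) ≠ 0 ∧
      det2 (I.arr y z i₃) (I.arr y z j₃) ≠ 0 ∧ det2 (I.arr y z i₄) (I.arr y z j₄) ≠ 0 ∧
      ∀ k ∈ I.idx, SplitSign4 (ev (I.arr y z k) x)
        (ev (I.arr y z k) (meet (I.arr y z i₁) (I.arr y z j₁)))
        (ev (I.arr y z k) (meet (I.arr y z i₂) (I.arr y z j₂)))
        (ev (I.arr y z k) (meet (I.arr y z i₃) (I.arr y z j₃)))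
        (ev (I.arr y z k) (meet (I.arr y z i₄) (I.arr y z j₄))) := by
  obtain ⟨⟨⟨a, ha, ha'⟩, ⟨b, hb, hb'⟩⟩, ⟨c, hc, hc'⟩, ⟨d, hd, hd'⟩⟩ := hx.box
  have hX : ∀ i < I.n, (0, I.n + i, 0) ∈ I.idx := fun i hi =>
    I.mem_idx.2 ⟨by simp, by simp [nf]; omega, nf_pos⟩
  have hY : ∀ i < I.n, (0, I.n + I.n + i, 0) ∈ I.idx := fun i hi =>
    I.mem_idx.2 ⟨by simp, by simp [nf]; omega, nf_pos⟩
  refine exists_splitSign4 I.idx (I.arr y z) ⟨_, hX a ha, ?_⟩ ⟨_, hX b hb, ?_⟩ ⟨_, hY c hc, ?_⟩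
    ⟨_, hY d hd, ?_⟩ <;> rw [arr_form]
  · rw [I.ev_form_x ha, I.form_x ha]; simpa using ha'
  · rw [I.ev_form_x hb, I.form_x hb]; simpa using hb'
  · rw [I.ev_form_y hc, I.form_y hc]; simpa using hc'
  · rw [I.ev_form_y hd, I.form_y hd]; simpa using hd'

/-- A zero of the affine function on the edge `j` of the curve with the values `h₀`, `h₁` at the
endpoints; the first endpoint, if these values are equal. -/
noncomputable def edgeRoot (j : ℕ) (h₀ h₁ : ℝ) : ℝ := j + h₀ / (h₀ - h₁)

variable (I) in
/-- A test of `SeesOnly` at finitely many parameters: the vertices of the curve and the zeros of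
the relevant affine functions on its edges. -/
def SeesOnlyTest (f s : ℝ) (x : ℝ × ℝ) : Prop :=
  (∀ j < I.k, (j : ℝ) ∈ I.seeing x → f < j ∧ (j : ℝ) < s) ∧
  (∀ j < I.k - 1, ∀ q < I.nf,
    edgeRoot j (ev (I.form q) (I.cpt j)) (ev (I.form q) (I.cpt (j + 1))) ∈ I.seeing x →
      f < edgeRoot j (ev (I.form q) (I.cpt j)) (ev (I.form q) (I.cpt (j + 1))) ∧
      edgeRoot j (ev (I.form q) (I.cpt j)) (ev (I.form q) (I.cpt (j + 1))) < s) ∧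
  ∀ j < I.k - 1, ∀ q < I.nf, ∀ r < I.nf,
    edgeRoot j (I.pairForm q r (I.cpt j) x) (I.pairForm q r (I.cpt (j + 1)) x) ∈ I.seeing x →
      f < edgeRoot j (I.pairForm q r (I.cpt j) x) (I.pairForm q r (I.cpt (j + 1)) x) ∧
      edgeRoot j (I.pairForm q r (I.cpt j) x) (I.pairForm q r (I.cpt (j + 1)) x) < s

/-- Off the test parameters, visibility is locally constant along the curve. -/
theorem eventually_mem_seeing {x : ℝ × ℝ} {j : ℕ} (hj : j < I.k - 1) {t : ℝ}
    (ht : t ∈ Ioo (0 : ℝ) 1) (hu : ((j : ℝ) + t) ∈ I.seeing x)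
    (h1 : ∀ q < I.nf,
      (j : ℝ) + t ≠ edgeRoot j (ev (I.form q) (I.cpt j)) (ev (I.form q) (I.cpt (j + 1))))
    (h2 : ∀ q < I.nf, ∀ r < I.nf, (j : ℝ) + t ≠
      edgeRoot j (I.pairForm q r (I.cpt j) x) (I.pairForm q r (I.cpt (j + 1)) x)) :
    ∀ᶠ v in nhds t, (j : ℝ) + v ∈ I.seeing x := by
  have e1 : ∀ᶠ v in nhds t, ∀ q ∈ Finset.range I.nf, SameSign
      ((1 - t) * ev (I.form q) (I.cpt j) + t * ev (I.form q) (I.cpt (j + 1)))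
      ((1 - v) * ev (I.form q) (I.cpt j) + v * ev (I.form q) (I.cpt (j + 1))) := by
    rw [Filter.eventually_all_finset]
    intro q hq
    exact eventually_sameSign_affine fun h => h1 q (Finset.mem_range.1 hq) (by rw [edgeRoot, ← h])
  have e2 : ∀ᶠ v in nhds t, ∀ q ∈ Finset.range I.nf, ∀ r ∈ Finset.range I.nf, SameSign
      ((1 - t) * I.pairForm q r (I.cpt j) x + t * I.pairForm q r (I.cpt (j + 1)) x)
      ((1 - v) * I.pairForm q r (I.cpt j) x + v * I.pairForm q r (I.cpt (j + 1)) x) := by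
    rw [Filter.eventually_all_finset]
    intro q hq
    rw [Filter.eventually_all_finset]
    intro r hr
    exact eventually_sameSign_affine fun h => h2 q (Finset.mem_range.1 hq) r
      (Finset.mem_range.1 hr) (by rw [edgeRoot, ← h])
  filter_upwards [e1, e2, isOpen_Ioo.mem_nhds ht] with v k1 k2 hv
  have hjk : (j : ℝ) + 1 ≤ (I.k : ℝ) - 1 := by
    rw [← cast_k_sub_one]; exact_mod_cast hj
  have hj0 : (0 : ℝ) ≤ j := by positivity
  refine ⟨⟨by linarith [hv.1], by linarith [hv.2]⟩, ?_⟩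
  have ht' : t ∈ Icc (0 : ℝ) 1 := ⟨ht.1.le, ht.2.le⟩
  have hv' : v ∈ Icc (0 : ℝ) 1 := ⟨hv.1.le, hv.2.le⟩
  refine Vis.congr I hu.2 (fun q hq => ?_) (fun _ _ => SameSign.refl _) fun q hq r hr => ?_
  · rw [I.cpt_eq_segPt hj ht', I.cpt_eq_segPt hj hv', ev_segPt, ev_segPt]
    exact k1 q (Finset.mem_range.2 hq)
  · have hp : ∀ w, I.pairForm q r (segPt (I.cpt j) (I.cpt (j + 1)) w) x =
        (1 - w) * I.pairForm q r (I.cpt j) x + w * I.pairForm q r (I.cpt (j + 1)) x := by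
      intro w
      simp only [pairForm, ev_segPt]; ring
    rw [I.cpt_eq_segPt hj ht', I.cpt_eq_segPt hj hv', hp, hp]
    exact k2 q (Finset.mem_range.2 hq) r (Finset.mem_range.2 hr)

/-- The endpoints of the compact set `seeing x` are test parameters, because visibility is locally
constant elsewhere. -/
theorem seesOnly_iff {f s : ℝ} {x : ℝ × ℝ} (hne : (I.seeing x).Nonempty) :
    I.SeesOnly f s x ↔ I.SeesOnlyTest f s x := by
  constructor
  · exact fun h => ⟨fun j _ hj => h _ hj, fun j _ q _ hj => h _ hj, fun j _ q _ r _ hj => h _ hj⟩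
  · rintro ⟨h0, h1, h2⟩
    -- a parameter in `seeing x` that violates the bounds has a neighbourhood in `seeing x`
    have key : ∀ u ∈ I.seeing x, ¬ (f < u ∧ u < s) → ∀ᶠ v in nhds u, v ∈ I.seeing x := by
      intro u hu hn
      rcases I.params_cases hu.1 with ⟨j, hj, rfl⟩ | ⟨j, hj, t, ht, rfl⟩
      · exact absurd (h0 j hj hu) hn
      · have := eventually_mem_seeing hj ht hu
          (fun q hq h => hn (by rw [h] at hu ⊢; exact h1 j hj q hq hu))
          (fun q hq r hr h => hn (by rw [h] at hu ⊢; exact h2 j hj q hq r hr hu))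
        have hc : Filter.Tendsto (fun v : ℝ => v - j) (nhds (j + t)) (nhds t) := by
          have : Filter.Tendsto (fun v : ℝ => v - j) (nhds (j + t)) (nhds (j + t - j)) :=
            (continuous_id.sub continuous_const).tendsto _
          rwa [add_sub_cancel_left] at this
        filter_upwards [hc.eventually this] with v hv
        rwa [add_sub_cancel] at hv
    obtain ⟨l, hl, hl'⟩ := (I.isCompact_seeing x).exists_isLeast hne
    obtain ⟨r, hr, hr'⟩ := (I.isCompact_seeing x).exists_isGreatest hne
    have hl1 : f < l ∧ l < s := by
      by_contra hn
      obtain ⟨v, hv, hv'⟩ := ((key l hl hn).filter_mono nhdsWithin_le_nhds |>.and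
        (self_mem_nhdsWithin : Iio l ∈ nhdsWithin l (Iio l))).exists
      exact (hl' hv).not_gt hv'
    have hr1 : f < r ∧ r < s := by
      by_contra hn
      obtain ⟨v, hv, hv'⟩ := ((key r hr hn).filter_mono nhdsWithin_le_nhds |>.and
        (self_mem_nhdsWithin : Ioi r ∈ nhdsWithin r (Ioi r))).exists
      exact (hr' hv).not_gt hv'
    exact fun u hu => ⟨hl1.1.trans_le (hl' hu), (hr' hu).trans_lt hr1.2⟩

variable (I) in
/-- Some vertex of the arrangement for the parameters `f` and `s` has the property `Q`. -/
def ExistsVertex (f s : ℝ) (Q : ℝ × ℝ → Prop) : Prop :=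
  ∃ i ∈ I.idx, ∃ j ∈ I.idx, Q (meet (I.arr (I.cpt f) (I.cpt s) i) (I.arr (I.cpt f) (I.cpt s) j))

variable (I) in
/-- A test of `Gap` at finitely many points: the centroids of four vertices of the arrangement.
Pairs of parallel lines contribute meaningless points, but these do no harm, because every point
that passes the test is a witness of `Gap`. -/
def GapTest (f s : ℝ) : Prop :=
  I.ExistsVertex f s fun v₁ => I.ExistsVertex f s fun v₂ => I.ExistsVertex f s fun v₃ =>
    I.ExistsVertex f s fun v₄ => I.InReg (avg4 v₁ v₂ v₃ v₄) ∧ I.SeesOnlyTest f s (avg4 v₁ v₂ v₃ v₄)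

/-- The centroid of the four vertices into which the sign pattern at a witness splits has the same
sign pattern, so that it is a witness as well. -/
theorem gap_iff (hI : I.ChainVisible) {f s : ℝ} (hf : f ≤ (I.k : ℝ) - 1) (hs : 0 ≤ s) :
    I.Gap f s ↔ I.GapTest f s := by
  constructor
  · rintro ⟨x, hx, h⟩
    obtain ⟨i₁, hi₁, j₁, hj₁, i₂, hi₂, j₂, hj₂, i₃, hi₃, j₃, hj₃, i₄, hi₄, j₄, hj₄,
      -, -, -, -, hs4⟩ :=
      exists_vertices hx (I.cpt f) (I.cpt s)
    have hsame : ∀ i ∈ I.idx, _ := fun i hi => by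
      have := (hs4 i hi).sameSign (SameSign.refl _) (SameSign.refl _) (SameSign.refl _)
        (SameSign.refl _)
      rw [← ev_avg4] at this
      exact this
    have hx' := inReg_of_sameSign hx hsame
    exact ⟨i₁, hi₁, j₁, hj₁, i₂, hi₂, j₂, hj₂, i₃, hi₃, j₃, hj₃, i₄, hi₄, j₄, hj₄, hx',
      (seesOnly_iff (hI _ hx').1).1 (SeesOnly.of_sameSign hI hf hs hx h hsame)⟩
  · rintro ⟨i₁, -, j₁, -, i₂, -, j₂, -, i₃, -, j₃, -, i₄, -, j₄, -, h1, h2⟩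
    exact ⟨_, h1, (seesOnly_iff (hI _ h1).1).2 h2⟩

end Instance
end Watchmen

/-! ### The next position of the greedy search -/

namespace Watchmen
namespace Instance

variable (I : Instance)

/-- The determinant of three forms of the arrangement for the parameters `f` and `s`. -/
noncomputable def tri (f s : ℝ) (i₁ i₂ i₃ : ℕ × ℕ × ℕ) : ℝ :=
  det3 (I.arr (I.cpt f) (I.cpt s) i₁) (I.arr (I.cpt f) (I.cpt s) i₂) (I.arr (I.cpt f) (I.cpt s) i₃)

/-- The parameters on the edge `j` of the curve at which three forms of the arrangement may become
dependent. -/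
noncomputable def candidate (f : ℝ) (j : ℕ) (i₁ i₂ i₃ : ℕ × ℕ × ℕ) (σ : ℝ) : ℝ :=
  j + quadRoot σ (I.tri f j i₁ i₂ i₃) (I.tri f (j + 1 / 2) i₁ i₂ i₃) (I.tri f (j + 1) i₁ i₂ i₃)

open Classical in
/-- The value `c`, if it is a parameter after `f` such that no point of the region is seen only
from between `f` and `c`, else `f`. -/
noncomputable def validated (f c : ℝ) : ℝ :=
  if f < c ∧ 0 ≤ c ∧ c ≤ (I.k : ℝ) - 1 ∧ ¬ I.GapTest f c then c else f

/-- The maximum of a function over the indices of the arrangement. -/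
noncomputable def maxIdx (b : ℝ) (F : ℕ × ℕ × ℕ → ℝ) : ℝ :=
  (Finset.range 3).fold max b fun a => (Finset.range I.nf).fold max b fun q =>
    (Finset.range I.nf).fold max b fun r => F (a, q, r)

/-- The last parameter `s` such that every point of the region that is not seen from a parameter
up to `f` is seen from `s` or a later parameter. -/
noncomputable def next (f : ℝ) : ℝ :=
  max ((Finset.range I.k).fold max f fun j : ℕ => I.validated f j)
    ((Finset.range (I.k - 1)).fold max f fun j => I.maxIdx f fun i₁ => I.maxIdx f fun i₂ =>
      I.maxIdx f fun i₃ => max (I.validated f (I.candidate f j i₁ i₂ i₃ 1))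
        (I.validated f (I.candidate f j i₁ i₂ i₃ (-1))))

variable {I}

theorem maxIdx_le {b c : ℝ} {F : ℕ × ℕ × ℕ → ℝ} (hb : b ≤ c) (h : ∀ i, F i ≤ c) :
    I.maxIdx b F ≤ c := by
  simp only [maxIdx, Finset.fold_max_le]
  exact ⟨hb, fun _ _ => ⟨hb, fun _ _ => ⟨hb, fun _ _ => h _⟩⟩⟩

theorem le_maxIdx {b c : ℝ} {F : ℕ × ℕ × ℕ → ℝ} {i : ℕ × ℕ × ℕ} (hi : i ∈ I.idx) (h : c ≤ F i) :
    c ≤ I.maxIdx b F := by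
  obtain ⟨h1, h2, h3⟩ := I.mem_idx.1 hi
  simp only [maxIdx, Finset.le_fold_max]
  exact Or.inr ⟨i.1, by simpa using h1, Or.inr ⟨i.2.1, by simpa using h2,
    Or.inr ⟨i.2.2, by simpa using h3, h⟩⟩⟩

theorem ev_pairCoef_self (q r : ℕ) (y : ℝ × ℝ) : ev (I.pairCoef q r y) y = 0 := by
  rw [ev_pairCoef, pairForm]; ring

/-- On an edge of the curve, the forms of the arrangement are affine functions of the parameter,
constant ones unless the form vanishes at the moving point. -/
theorem arr_affine {j : ℕ} (hj : j < I.k - 1) (y : ℝ × ℝ) (i : ℕ × ℕ × ℕ) :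
    ∃ A B : ℝ × ℝ × ℝ, (∀ t ∈ Icc (0 : ℝ) 1, I.arr y (I.cpt (j + t)) i = A + t • B) ∧
      (B = 0 ∨ ∀ z, ev (I.arr y z i) z = 0) := by
  by_cases h0 : i.1 = 0
  · exact ⟨I.form i.2.1, 0, fun t _ => by simp [arr, h0], Or.inl rfl⟩
  by_cases h1 : i.1 = 1
  · exact ⟨I.pairCoef i.2.1 i.2.2 y, 0, fun t _ => by simp [arr, h1], Or.inl rfl⟩
  refine ⟨I.pairCoef i.2.1 i.2.2 (I.cpt j),
    I.pairCoef i.2.1 i.2.2 (I.cpt (j + 1)) - I.pairCoef i.2.1 i.2.2 (I.cpt j), fun t ht => ?_,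
    Or.inr fun z => by simp only [arr, h0, h1, if_false]; exact ev_pairCoef_self _ _ _⟩
  simp only [arr, h0, h1, if_false, I.cpt_eq_segPt hj ht, pairCoef, ev_segPt]
  ext <;> simp <;> ring

/-- The determinant of three affine functions of the parameter is a cubic polynomial in general.
Its cubic term vanishes if one of the forms is constant; otherwise all three forms vanish at the
moving point, so that they are dependent. -/
theorem tri_quadratic {j : ℕ} (hj : j < I.k - 1) (f : ℝ) (i₁ i₂ i₃ : ℕ × ℕ × ℕ) :
    ∃ c₀ c₁ c₂ : ℝ, ∀ t ∈ Icc (0 : ℝ) 1,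
      I.tri f (j + t) i₁ i₂ i₃ = c₀ + c₁ * t + c₂ * t ^ 2 := by
  obtain ⟨A₁, B₁, h₁, k₁⟩ := arr_affine hj (I.cpt f) i₁
  obtain ⟨A₂, B₂, h₂, k₂⟩ := arr_affine hj (I.cpt f) i₂
  obtain ⟨A₃, B₃, h₃, k₃⟩ := arr_affine hj (I.cpt f) i₃
  by_cases hB : B₁ = 0 ∨ B₂ = 0 ∨ B₃ = 0
  · have h0 : det3 B₁ B₂ B₃ = 0 := by
      rcases hB with h | h | h <;> simp [h, det3]
    refine ⟨det3 A₁ A₂ A₃, det3 B₁ A₂ A₃ + det3 A₁ B₂ A₃ + det3 A₁ A₂ B₃,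
      det3 A₁ B₂ B₃ + det3 B₁ A₂ B₃ + det3 B₁ B₂ A₃, fun t ht => ?_⟩
    rw [tri, h₁ t ht, h₂ t ht, h₃ t ht]
    have : det3 (A₁ + t • B₁) (A₂ + t • B₂) (A₃ + t • B₃) = det3 A₁ A₂ A₃ +
        (det3 B₁ A₂ A₃ + det3 A₁ B₂ A₃ + det3 A₁ A₂ B₃) * t +
        (det3 A₁ B₂ B₃ + det3 B₁ A₂ B₃ + det3 B₁ B₂ A₃) * t ^ 2 + det3 B₁ B₂ B₃ * t ^ 3 := by
      simp only [det3, Prod.fst_add, Prod.snd_add, Prod.smul_fst, Prod.smul_snd, smul_eq_mul]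
      ring
    rw [this, h0]; ring
  · push Not at hB
    refine ⟨0, 0, 0, fun t ht => ?_⟩
    rw [tri, det3_eq_zero (k₁.resolve_left hB.1 _) (k₂.resolve_left hB.2.1 _)
      (k₃.resolve_left hB.2.2 _)]
    ring

theorem eventually_sameSign_tri {j : ℕ} (hj : j < I.k - 1) (f : ℝ) {t : ℝ}
    (ht : t ∈ Ioo (0 : ℝ) 1) {i₁ i₂ i₃ : ℕ × ℕ × ℕ} (h1 : j + t ≠ I.candidate f j i₁ i₂ i₃ 1)
    (h2 : j + t ≠ I.candidate f j i₁ i₂ i₃ (-1)) :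
    ∀ᶠ u in nhds t, SameSign (I.tri f (j + t) i₁ i₂ i₃) (I.tri f (j + u) i₁ i₂ i₃) := by
  obtain ⟨c₀, c₁, c₂, hc⟩ := tri_quadratic hj f i₁ i₂ i₃
  have e0 := hc 0 (by simp)
  have eh := hc (1 / 2) (by norm_num)
  have e1 := hc 1 (by simp)
  have q0 : I.tri f j i₁ i₂ i₃ = c₀ := by simpa using e0
  have qh : I.tri f (j + 1 / 2) i₁ i₂ i₃ = c₀ + c₁ / 2 + c₂ / 4 := by rw [eh]; ring
  have q1 : I.tri f (j + 1) i₁ i₂ i₃ = c₀ + c₁ + c₂ := by rw [e1]; ring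
  simp only [candidate, q0, qh, q1, ne_eq, add_right_inj] at h1 h2
  filter_upwards [eventually_sameSign_quadratic h1 h2, isOpen_Ioo.mem_nhds ht] with u hu hu'
  rwa [hc t ⟨ht.1.le, ht.2.le⟩, hc u ⟨hu'.1.le, hu'.2.le⟩]

theorem continuous_arr (y : ℝ × ℝ) (i : ℕ × ℕ × ℕ) : Continuous fun z => I.arr y z i := by
  unfold arr
  split_ifs
  · exact continuous_const
  · exact continuous_const
  · have := fun a => continuous_ev (I.form a)
    unfold pairCoef
    fun_prop

theorem form_one_mem : (0, I.n + I.n + I.n, 0) ∈ I.idx :=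
  I.mem_idx.2 ⟨by simp, by simp [nf], nf_pos⟩

theorem tri_one (f s : ℝ) (i j : ℕ × ℕ × ℕ) : I.tri f s (0, I.n + I.n + I.n, 0) i j =
    det2 (I.arr (I.cpt f) (I.cpt s) i) (I.arr (I.cpt f) (I.cpt s) j) := by
  rw [tri, arr_form, form_one, det3_one]

/-- The value of a form at the moving point of the curve is the determinant of the form with two
moving forms: the horizontal and the vertical line through that point. -/
theorem tri_point (f s : ℝ) (q : ℕ) : I.tri f s (0, q, 0) (2, I.n + 0, I.n + I.n + I.n)
    (2, I.n + I.n + 0, I.n + I.n + I.n) = ev (I.form q) (I.cpt s) := by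
  have hn := NeZero.pos I.n
  rw [tri, arr_form, arr_snd, arr_snd]
  simp only [pairCoef, I.form_x hn, I.form_y hn, form_one, det3, ev]
  ring

/-- If no determinant of the arrangement changes sign while a parameter moves along an edge of the
curve, a gap persists: its witness can be moved along with the vertices of the arrangement. -/
theorem Gap.transfer (hI : I.ChainVisible) {f : ℝ} (hf : f ≤ (I.k : ℝ) - 1) {j : ℕ}
    (hj : j < I.k - 1) {t₁ t₂ : ℝ} (h₂ : 0 ≤ t₂) (h₂₁ : t₂ ≤ t₁) (h₁ : t₁ ≤ 1)
    (hs : ∀ t ∈ Icc t₂ t₁, ∀ i₁ ∈ I.idx, ∀ i₂ ∈ I.idx, ∀ i₃ ∈ I.idx,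
      SameSign (I.tri f (j + t₁) i₁ i₂ i₃) (I.tri f (j + t) i₁ i₂ i₃))
    (h : I.Gap f (j + t₁)) : I.Gap f (j + t₂) := by
  obtain ⟨x, hx, hx'⟩ := h
  have hj0 : (0 : ℝ) ≤ j := by positivity
  obtain ⟨i₁, hi₁, j₁, hj₁, i₂, hi₂, j₂, hj₂, i₃, hi₃, j₃, hj₃, i₄, hi₄, j₄, hj₄,
    d₁, d₂, d₃, d₄, hs4⟩ :=
    exists_vertices hx (I.cpt f) (I.cpt (j + t₁))
  let a : ℝ → ℕ × ℕ × ℕ → ℝ × ℝ × ℝ := fun t i => I.arr (I.cpt f) (I.cpt (j + t)) i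
  let γ : ℝ → ℝ × ℝ := fun t => avg4 (meet (a t i₁) (a t j₁)) (meet (a t i₂) (a t j₂))
    (meet (a t i₃) (a t j₃)) (meet (a t i₄) (a t j₄))
  -- determinants with the constant form: lines that meet at the start keep meeting
  have hdet : ∀ i ∈ I.idx, ∀ i' ∈ I.idx, det2 (a t₁ i) (a t₁ i') ≠ 0 → ∀ t ∈ Icc t₂ t₁,
      det2 (a t i) (a t i') ≠ 0 := by
    intro i hi i' hi' h0 t ht
    have := hs t ht _ form_one_mem i hi i' hi'
    rw [tri_one, tri_one] at this
    exact fun h => h0 (this.eq_zero_iff.2 h)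
  have hmeet : ∀ i ∈ I.idx, ∀ i' ∈ I.idx, det2 (a t₁ i) (a t₁ i') ≠ 0 → ∀ t ∈ Icc t₂ t₁,
      ∀ k ∈ I.idx, SameSign (ev (a t₁ k) (meet (a t₁ i) (a t₁ i')))
        (ev (a t k) (meet (a t i) (a t i'))) := by
    intro i hi i' hi' h0 t ht k hk
    rw [ev_meet _ h0, ev_meet _ (hdet i hi i' hi' h0 t ht)]
    have := hs t ht _ form_one_mem i hi i' hi'
    rw [tri_one, tri_one] at this
    exact (hs t ht k hk i hi i' hi').div this
  have hsame : ∀ t ∈ Icc t₂ t₁, ∀ k ∈ I.idx, SameSign (ev (a t₁ k) x) (ev (a t k) (γ t)) := by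
    intro t ht k hk
    have := (hs4 k hk).sameSign (hmeet i₁ hi₁ j₁ hj₁ d₁ t ht k hk)
      (hmeet i₂ hi₂ j₂ hj₂ d₂ t ht k hk) (hmeet i₃ hi₃ j₃ hj₃ d₃ t ht k hk)
      (hmeet i₄ hi₄ j₄ hj₄ d₄ t ht k hk)
    rwa [← ev_avg4] at this
  have hcont : ContinuousOn γ (Icc t₂ t₁) := by
    have ha : ∀ i, Continuous fun t => a t i := fun i =>
      (continuous_arr (I.cpt f) i).comp (I.continuous_cpt.comp (by fun_prop))
    have hm : ∀ i ∈ I.idx, ∀ i' ∈ I.idx, det2 (a t₁ i) (a t₁ i') ≠ 0 →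
        ContinuousOn (fun t => meet (a t i) (a t i')) (Icc t₂ t₁) := by
      intro i hi i' hi' h0
      have c1 := ha i
      have c2 := ha i'
      have c3 : Continuous fun t => det2 (a t i) (a t i') := by unfold det2; fun_prop
      unfold meet
      refine ContinuousOn.prodMk (ContinuousOn.div ?_ c3.continuousOn (hdet i hi i' hi' h0))
        (ContinuousOn.div ?_ c3.continuousOn (hdet i hi i' hi' h0)) <;>
      exact Continuous.continuousOn (by fun_prop)
    have m1 := hm i₁ hi₁ j₁ hj₁ d₁
    have m2 := hm i₂ hi₂ j₂ hj₂ d₂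
    have m3 := hm i₃ hi₃ j₃ hj₃ d₃
    have m4 := hm i₄ hi₄ j₄ hj₄ d₄
    have hc : Continuous fun p : ((ℝ × ℝ) × (ℝ × ℝ)) × ((ℝ × ℝ) × (ℝ × ℝ)) =>
        avg4 p.1.1 p.1.2 p.2.1 p.2.2 := by unfold avg4; fun_prop
    exact hc.comp_continuousOn ((m1.prodMk m2).prodMk (m3.prodMk m4))
  have ht₁ : t₁ ∈ Icc t₂ t₁ := ⟨h₂₁, le_rfl⟩
  have hγ : I.SeesOnly f (j + t₁) (γ t₁) :=
    SeesOnly.of_sameSign hI hf (by linarith) hx hx' (hsame t₁ ht₁)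
  refine ⟨γ t₂, inReg_of_sameSign hx (hsame t₂ ⟨le_rfl, h₂₁⟩), ?_⟩
  refine SeesOnly.path hI (τ := fun t => j + t) hcont (by fun_prop)
    (fun t ht => inReg_of_sameSign hx (hsame t ht))
    (fun t ht h0 => not_vis_fst (hx'.not_vis_left hf h0) (hsame t ht))
    (fun t ht _ => not_vis_snd (hx'.not_vis_right (by linarith) ?_) (fun q hq => ?_) (hsame t ht))
    ht₁ hγ t₂ ⟨le_rfl, h₂₁⟩
  · rw [← cast_k_sub_one]
    have : (j : ℝ) + 1 ≤ ((I.k - 1 : ℕ) : ℝ) := by exact_mod_cast hj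
    linarith
  · have hn := NeZero.pos I.n
    have := hs t ht (0, q, 0) (I.mem_idx.2 ⟨by simp, hq, nf_pos⟩)
      (2, I.n + 0, I.n + I.n + I.n) (I.mem_idx.2 ⟨by simp, by simp only [nf]; omega, by simp [nf]⟩)
      (2, I.n + I.n + 0, I.n + I.n + I.n)
      (I.mem_idx.2 ⟨by simp, by simp only [nf]; omega, by simp [nf]⟩)
    rwa [tri_point, tri_point] at this

/-- The frontier can advance to `next f`, but not beyond, without losing a point of the region. -/
theorem next_spec (hI : I.ChainVisible) {f : ℝ} (hf : f ≤ (I.k : ℝ) - 1) {V : Finset ℝ}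
    (hV : ∀ x, I.InReg x → ∃ v ∈ V, v ∈ I.seeing x)
    (hgap : I.Gap f I.k) :
    f < I.next f ∧ I.next f ∈ I.params ∧ ¬ I.Gap f (I.next f) ∧
      ∀ s ≤ (I.k : ℝ) - 1, I.next f < s → I.Gap f s := by
  classical
  let S : Set ℝ := {s | f < s ∧ s ∈ I.params ∧ ¬ I.Gap f s}
  have hne : S.Nonempty := by
    obtain ⟨x, hx, hx'⟩ := hgap
    obtain ⟨v, hv, hv'⟩ := hV x hx
    -- the first viewpoint of `V` after `f` belongs to `S`
    obtain ⟨w, hw, hmin⟩ := (V.filter fun v => f < v ∧ v ∈ I.params).exists_min_image id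
      ⟨v, by simpa [hv] using ⟨(hx' v hv').1, hv'.1⟩⟩
    simp only [Finset.mem_filter, id] at hw hmin
    refine ⟨w, hw.2.1, hw.2.2, ?_⟩
    rintro ⟨y, hy, hy'⟩
    obtain ⟨u, hu, hu'⟩ := hV y hy
    exact (hmin u ⟨hu, (hy' u hu').1, hu'.1⟩).not_gt (hy' u hu').2
  have hbdd : BddAbove S := ⟨(I.k : ℝ) - 1, fun s hs => hs.2.1.2⟩
  obtain ⟨w, hw⟩ := hne
  have hle : ∀ s ∈ S, s ≤ sSup S := fun s hs => le_csSup hbdd hs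
  have hmem : sSup S ∈ S := by
    refine ⟨hw.1.trans_le (hle w hw), ⟨hw.2.1.1.trans (hle w hw),
      csSup_le ⟨w, hw⟩ fun s hs => hs.2.1.2⟩, ?_⟩
    -- the last parameter that sees a witness is less than some element of `S`
    rintro ⟨x, hx, hx'⟩
    obtain ⟨r, hr, hr'⟩ := (I.isCompact_seeing x).exists_isGreatest (hI x hx).1
    obtain ⟨s, hs, hs'⟩ := exists_lt_of_lt_csSup ⟨w, hw⟩ (hx' r hr).2
    exact hs.2.2 ⟨x, hx, fun u hu => ⟨(hx' u hu).1, (hr' hu).trans_lt hs'⟩⟩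
  -- so `next f` is the maximum of `S`; it remains to see that it is among the candidates
  have hgr : ∀ s ≤ (I.k : ℝ) - 1, sSup S < s → I.Gap f s := by
    intro s hs hlt
    by_contra hn
    exact (hle s ⟨hmem.1.trans hlt, ⟨hmem.2.1.1.trans hlt.le, hs⟩, hn⟩).not_gt hlt
  have hvalid : I.validated f (sSup S) = sSup S := by
    rw [validated, if_pos]
    exact ⟨hmem.1, hmem.2.1.1, hmem.2.1.2, fun h =>
      hmem.2.2 ((gap_iff hI hf hmem.2.1.1).2 h)⟩
  have hvle : ∀ c, I.validated f c ≤ sSup S := by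
    intro c
    rw [validated]
    split_ifs with h
    · exact hle c ⟨h.1, ⟨h.2.1, h.2.2.1⟩, fun hg => h.2.2.2 ((gap_iff hI hf h.2.1).1 hg)⟩
    · exact hmem.1.le
  suffices hnext : I.next f = sSup S by
    rw [hnext]
    exact ⟨hmem.1, hmem.2.1, hmem.2.2, hgr⟩
  apply le_antisymm
  · refine max_le ?_ ?_ <;> rw [Finset.fold_max_le]
    · exact ⟨hmem.1.le, fun _ _ => hvle _⟩
    · exact ⟨hmem.1.le, fun _ _ => maxIdx_le hmem.1.le fun _ => maxIdx_le hmem.1.le fun _ =>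
        maxIdx_le hmem.1.le fun _ => max_le (hvle _) (hvle _)⟩
  · rw [next, le_max_iff, Finset.le_fold_max, Finset.le_fold_max]
    rcases I.params_cases hmem.2.1 with ⟨j, hj, hs0⟩ | ⟨j, hj, t, ht, hs0⟩
    · exact Or.inl (Or.inr ⟨j, by simpa using hj, by rw [← hs0, hvalid]⟩)
    right; right
    refine ⟨j, by simpa using hj, ?_⟩
    -- otherwise no determinant changes sign near `t`, and a gap beyond `sSup S` could be moved
    -- back across `sSup S`
    by_contra hcon
    have hcand : ∀ i₁ ∈ I.idx, ∀ i₂ ∈ I.idx, ∀ i₃ ∈ I.idx,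
        sSup S ≠ I.candidate f j i₁ i₂ i₃ 1 ∧ sSup S ≠ I.candidate f j i₁ i₂ i₃ (-1) := by
      intro i₁ hi₁ i₂ hi₂ i₃ hi₃
      constructor <;> intro heq <;>
        refine hcon (le_maxIdx hi₁ (le_maxIdx hi₂ (le_maxIdx hi₃ ?_)))
      · exact le_max_of_le_left (by rw [← heq, hvalid])
      · exact le_max_of_le_right (by rw [← heq, hvalid])
    have hev : ∀ᶠ u in nhds t, ∀ i₁ ∈ I.idx, ∀ i₂ ∈ I.idx, ∀ i₃ ∈ I.idx,
        SameSign (I.tri f (j + t) i₁ i₂ i₃) (I.tri f (j + u) i₁ i₂ i₃) := by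
      rw [Filter.eventually_all_finset]; intro i₁ hi₁
      rw [Filter.eventually_all_finset]; intro i₂ hi₂
      rw [Filter.eventually_all_finset]; intro i₃ hi₃
      have := hcand i₁ hi₁ i₂ hi₂ i₃ hi₃
      rw [hs0] at this
      exact eventually_sameSign_tri hj f ht this.1 this.2
    have hev' : ∀ᶠ u in nhds t, u ∈ Ioo (0 : ℝ) 1 ∧ f < j + u := by
      refine Filter.Eventually.and (isOpen_Ioo.mem_nhds ht) ?_
      have hc : Continuous fun u : ℝ => (j : ℝ) + u := by fun_prop
      exact (isOpen_lt continuous_const hc).mem_nhds (show f < j + t from hs0 ▸ hmem.1)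
    obtain ⟨ε, hε, hball⟩ := Metric.eventually_nhds_iff_ball.1 (hev.and hev')
    have hin : ∀ u, t - ε / 2 ≤ u → u ≤ t + ε / 2 → u ∈ Metric.ball t ε := by
      intro u h1 h2
      rw [Metric.mem_ball, Real.dist_eq, abs_lt]
      constructor <;> linarith
    obtain ⟨-, b1, -⟩ := hball (t + ε / 2) (hin _ (by linarith) le_rfl)
    obtain ⟨-, b2, b2'⟩ := hball (t - ε / 2) (hin _ le_rfl (by linarith))
    have hjk : (j : ℝ) + 1 ≤ (I.k : ℝ) - 1 := by
      rw [← cast_k_sub_one]; exact_mod_cast hj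
    have hg := hgr (j + (t + ε / 2)) (by linarith [b1.2]) (by rw [hs0]; linarith)
    have hg' := Gap.transfer hI hf hj b2.1.le (by linarith) b1.2.le
      (fun u hu i₁ hi₁ i₂ hi₂ i₃ hi₃ =>
        ((hball (t + ε / 2) (hin _ (by linarith) le_rfl)).1 i₁ hi₁ i₂ hi₂ i₃ hi₃).symm.trans
        ((hball u (hin u hu.1 hu.2)).1 i₁ hi₁ i₂ hi₂ i₃ hi₃)) hg
    exact hmem.2.2 (hg'.mono I (by rw [hs0]; linarith))

end Instance
end Watchmen

/-! ### Arc length and the translation from the plane to coordinates -/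

namespace Watchmen

/-- The point of the plane with the given coordinates. -/
noncomputable def toPlane (p : ℝ × ℝ) : Plane := !₂[p.1, p.2]

theorem coords_toPlane (p : ℝ × ℝ) : coords (toPlane p) = p := by simp [coords, toPlane]

theorem toPlane_coords (p : Plane) : toPlane (coords p) = p := by
  ext i; fin_cases i <;> simp [coords, toPlane]

theorem continuous_toPlane : Continuous toPlane := by
  unfold toPlane; fun_prop

namespace Instance

variable (I : Instance)

theorem curve_eq {s : ℝ} (hs : s ∈ I.params) : I.curve s = toPlane (I.cpt s) := by
  rw [← coords_curve I hs, toPlane_coords]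

variable {I}

theorem mem_seeing_iff {x : ℝ × ℝ} {u : ℝ} (hu : u ∈ I.params) :
    u ∈ I.seeing x ↔ toPlane x ∈ visibilityPolygon I.P (I.curve u) := by
  rw [mem_visibilityPolygon_iff, coords_toPlane, I.coords_curve hu]
  exact ⟨fun h => h.2, fun h => ⟨hu, h⟩⟩

theorem seesAll_iff {V : Set ℝ} (hV : V ⊆ I.params) :
    I.SeesAll V ↔ ∀ x, I.InReg x → ∃ v ∈ V, v ∈ I.seeing x := by
  constructor
  · intro h x hx
    obtain ⟨s, hs, hs'⟩ := h (toPlane x) (by rwa [mem_P_iff, coords_toPlane])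
    exact ⟨s, hs, (mem_seeing_iff (hV hs)).2 hs'⟩
  · intro h x hx
    obtain ⟨s, hs, hs'⟩ := h (coords x) (by rwa [← mem_P_iff])
    refine ⟨s, hs, ?_⟩
    have := (mem_seeing_iff (hV hs)).1 hs'
    rwa [toPlane_coords] at this

/-- The curve is a homeomorphism onto its image, so that connected parts of the image are images of
intervals of parameters. -/
theorem chainVisible (h : I.IsChainVisibleWatchmanCurve) : I.ChainVisible := by
  obtain ⟨hinj, -, hconn⟩ := h
  intro x hx
  have hc := hconn (toPlane x) (by rwa [mem_P_iff, coords_toPlane])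
  have hmem : ∀ u ∈ I.params, u ∈ I.seeing x ↔ I.curve u ∈ visibilityPolygon I.P (toPlane x) := by
    intro u hu
    rw [mem_visibilityPolygon_iff, coords_toPlane, I.coords_curve hu]
    exact ⟨fun h => h.2.symm, fun h => ⟨hu, h.symm⟩⟩
  constructor
  · obtain ⟨c, hc1, u, hu, rfl⟩ := hc.nonempty
    exact ⟨u, (hmem u hu).2 hc1⟩
  · let g : I.params → Plane := fun u => I.curve u
    have hg : Continuous g := by
      have : g = fun u : I.params => toPlane (I.cpt u) := funext fun u => I.curve_eq u.2
      rw [this]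
      exact continuous_toPlane.comp (I.continuous_cpt.comp continuous_subtype_val)
    have hgi : Function.Injective g := fun u v huv => Subtype.ext (hinj u.2 v.2 huv)
    have : CompactSpace I.params := isCompact_iff_compactSpace.1 isCompact_Icc
    have hpre := hc.isPreconnected.preimage_of_isClosedMap hgi hg.isClosedMap (by
      rintro c ⟨-, u, hu, rfl⟩
      exact ⟨⟨u, hu⟩, rfl⟩)
    have himg := hpre.image _ continuous_subtype_val.continuousOn
    have heq : I.seeing x = Subtype.val '' (g ⁻¹' (visibilityPolygon I.P (toPlane x) ∩ I.C)) := by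
      ext u
      constructor
      · intro hu
        exact ⟨⟨u, hu.1⟩, ⟨(hmem u hu.1).1 hu, u, hu.1, rfl⟩, rfl⟩
      · rintro ⟨⟨u, hu⟩, ⟨h1, -⟩, rfl⟩
        exact (hmem u hu).2 h1
    rw [heq]
    exact himg.ordConnected

variable (I)

/-- The length of an edge of the curve. -/
noncomputable def edgeLen (j : ℕ) : ℝ :=
  √((I.cx (j + 1) - I.cx j) ^ 2 + (I.cy (j + 1) - I.cy j) ^ 2)

/-- The arc length of the part of the curve up to a parameter. -/
noncomputable def arc (s : ℝ) : ℝ := ramp (I.k - 1) I.edgeLen s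

/-- The parameter up to which the curve has the given arc length, clamped to the parameter
interval. -/
noncomputable def arcInv (l : ℝ) : ℝ :=
  ∑ j ∈ Finset.range (I.k - 1), clamp01 ((l - ∑ i ∈ Finset.range j, I.edgeLen i) / I.edgeLen j)

variable {I}

theorem norm_toPlane (p : ℝ × ℝ) : ‖toPlane p‖ = √(p.1 ^ 2 + p.2 ^ 2) := by
  simp [EuclideanSpace.norm_eq, toPlane, Fin.sum_univ_two]

theorem monotone_arc : Monotone I.arc := by
  intro s t hst
  unfold arc ramp
  refine Finset.sum_le_sum fun i _ => mul_le_mul_of_nonneg_left ?_ (Real.sqrt_nonneg _)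
  exact monotone_clamp01 (by linarith)

theorem continuous_arc : Continuous I.arc := continuous_ramp _ _

theorem dist_curve_le {s t : ℝ} (hs : s ∈ I.params) (ht : t ∈ I.params) (hst : s ≤ t) :
    dist (I.curve s) (I.curve t) ≤ I.arc t - I.arc s := by
  have h1 : I.curve t - I.curve s = ∑ i ∈ Finset.range (I.k - 1),
      (clamp01 (t - i) - clamp01 (s - i)) •
        toPlane (I.cx (i + 1) - I.cx i, I.cy (i + 1) - I.cy i) := by
    rw [I.curve_eq hs, I.curve_eq ht]
    ext i
    rw [WithLp.ofLp_sum, Finset.sum_apply]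
    fin_cases i
    · simp only [toPlane, cpt, ramp, Fin.zero_eta, PiLp.sub_apply, PiLp.smul_apply]
      simp only [Matrix.cons_val_zero, smul_eq_mul, add_sub_add_left_eq_sub]
      rw [← Finset.sum_sub_distrib]
      exact Finset.sum_congr rfl fun i _ => by ring
    · simp only [toPlane, cpt, ramp, Fin.mk_one, PiLp.sub_apply, PiLp.smul_apply]
      simp only [Matrix.cons_val_one, smul_eq_mul, Matrix.cons_val_fin_one,
        add_sub_add_left_eq_sub]
      rw [← Finset.sum_sub_distrib]
      exact Finset.sum_congr rfl fun i _ => by ring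
  rw [dist_comm, dist_eq_norm, h1, arc, arc, ramp, ramp, ← Finset.sum_sub_distrib]
  refine (norm_sum_le _ _).trans (Finset.sum_le_sum fun i _ => ?_)
  rw [norm_smul, norm_toPlane, Real.norm_eq_abs, abs_of_nonneg, ← mul_sub, mul_comm]
  · rfl
  · exact sub_nonneg.2 (monotone_clamp01 (by linarith))

theorem dist_curve_edge {j : ℕ} (hj : j < I.k - 1) {s t : ℝ} (hs : (j : ℝ) ≤ s) (hst : s ≤ t)
    (ht : t ≤ j + 1) : dist (I.curve s) (I.curve t) = I.arc t - I.arc s := by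
  have hjk : (j : ℝ) + 1 ≤ (I.k : ℝ) - 1 := by
    rw [← cast_k_sub_one]; exact_mod_cast hj
  have hj0 : (0 : ℝ) ≤ j := by positivity
  obtain ⟨a, rfl⟩ : ∃ a, s = j + a := ⟨s - j, by ring⟩
  obtain ⟨b, rfl⟩ : ∃ b, t = j + b := ⟨t - j, by ring⟩
  have ha : a ∈ Icc (0 : ℝ) 1 := ⟨by linarith, by linarith⟩
  have hb : b ∈ Icc (0 : ℝ) 1 := ⟨by linarith, by linarith⟩
  rw [arc, arc, ramp_add hj _ ha, ramp_add hj _ hb, I.curve_eq ⟨by linarith, by linarith⟩,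
    I.curve_eq ⟨by linarith, by linarith⟩, I.cpt_add hj ha, I.cpt_add hj hb]
  have : toPlane (segPt (I.cx j, I.cy j) (I.cx (j + 1), I.cy (j + 1)) b) -
      toPlane (segPt (I.cx j, I.cy j) (I.cx (j + 1), I.cy (j + 1)) a) =
      (b - a) • toPlane (I.cx (j + 1) - I.cx j, I.cy (j + 1) - I.cy j) := by
    ext i
    fin_cases i <;> simp [toPlane, segPt] <;> ring
  rw [dist_comm, dist_eq_norm, this, norm_smul, norm_toPlane, Real.norm_eq_abs,
    abs_of_nonneg (by linarith)]
  simp only [edgeLen]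
  ring

/-- The distance of two points of the curve is at most the difference of their arc lengths, with
equality on an edge. -/
theorem eVariationOn_curve {s t : ℝ} (hs : s ∈ I.params) (ht : t ∈ I.params) (hst : s ≤ t) :
    eVariationOn I.curve (Icc s t) = ENNReal.ofReal (I.arc t - I.arc s) := by
  apply le_antisymm
  · have h1 : eVariationOn I.curve (Icc s t) ≤ eVariationOn I.arc (Icc s t) := by
      refine iSup_le fun p => le_trans (Finset.sum_le_sum fun i _ => ?_)
        (le_iSup (fun p : ℕ × { u : ℕ → ℝ // Monotone u ∧ ∀ i, u i ∈ Icc s t } =>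
          ∑ i ∈ Finset.range p.1, edist (I.arc (p.2.1 (i + 1))) (I.arc (p.2.1 i))) p)
      have hp := p.2.2.1 (Nat.le_succ i)
      have hm : ∀ i, p.2.1 i ∈ I.params := fun i =>
        ⟨hs.1.trans (p.2.2.2 i).1, (p.2.2.2 i).2.trans ht.2⟩
      rw [edist_comm, edist_dist, edist_dist, Real.dist_eq]
      refine ENNReal.ofReal_le_ofReal ((dist_curve_le (hm _) (hm _) hp).trans (le_abs_self _))
    have h2 := (monotone_arc (I := I)).monotoneOn (Icc s t) |>.eVariationOn_eq
      (a := s) (b := t) (left_mem_Icc.2 hst) (right_mem_Icc.2 hst)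
    rw [inter_self] at h2
    exact h1.trans h2.le
  · have key : ∀ j : ℕ, j ≤ I.k - 1 → ∀ s t : ℝ, 0 ≤ s → s ≤ t → t ≤ j →
        ENNReal.ofReal (I.arc t - I.arc s) ≤ eVariationOn I.curve (Icc s t) := by
      intro j
      induction j with
      | zero =>
        intro _ s t h0 hst ht
        have : s = t := by push_cast at ht; linarith
        simp [this]
      | succ j ih =>
        intro hj s t h0 hst ht
        push_cast at ht
        have edge : ∀ s t : ℝ, (j : ℝ) ≤ s → s ≤ t → t ≤ j + 1 →
            ENNReal.ofReal (I.arc t - I.arc s) ≤ eVariationOn I.curve (Icc s t) := by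
          intro s t h1 h2 h3
          rw [← dist_curve_edge (by omega) h1 h2 h3, ← edist_dist]
          exact eVariationOn.edist_le _ (left_mem_Icc.2 h2) (right_mem_Icc.2 h2)
        rcases le_total t j with htj | htj
        · exact ih (by omega) s t h0 hst htj
        rcases le_total (j : ℝ) s with hsj | hsj
        · exact edge s t hsj hst ht
        · have h3 := eVariationOn.Icc_add_Icc I.curve (s := univ) hsj htj (mem_univ _)
          simp only [univ_inter] at h3
          rw [← h3]
          refine le_trans ?_ (add_le_add (ih (by omega) s j h0 hsj le_rfl) (edge j t le_rfl htj ht))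
          rw [← ENNReal.ofReal_add (sub_nonneg.2 (monotone_arc hsj))
            (sub_nonneg.2 (monotone_arc htj))]
          exact ENNReal.ofReal_le_ofReal (by linarith)
    exact key (I.k - 1) le_rfl s t hs.1 hst (by rw [cast_k_sub_one]; exact ht.2)

theorem edgeLen_pos (hI : InjOn I.curve I.params) {j : ℕ} (hj : j < I.k - 1) : 0 < I.edgeLen j := by
  have hjk : (j : ℝ) + 1 ≤ (I.k : ℝ) - 1 := by
    rw [← cast_k_sub_one]; exact_mod_cast hj
  have hj0 : (0 : ℝ) ≤ j := by positivity
  have h1 := dist_curve_edge hj (s := j) (t := j + 1) le_rfl (by linarith) le_rfl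
  have h2 : 0 < dist (I.curve j) (I.curve (j + 1)) := by
    rw [dist_pos]
    intro h
    have := hI (⟨hj0, by linarith⟩ : (j : ℝ) ∈ I.params) ⟨by linarith, by linarith⟩ h
    linarith
  have h3 := ramp_add hj I.edgeLen (t := 0) (by simp)
  have h4 := ramp_add hj I.edgeLen (t := 1) (by simp)
  rw [h1, arc, arc, h4] at h2
  rw [add_zero] at h3
  rw [h3] at h2
  linarith

theorem arcInv_arc (hI : InjOn I.curve I.params) {s : ℝ} (hs : s ∈ I.params) :
    I.arcInv (I.arc s) = s := by
  -- on the edge `j` the summands before `j` are `1`, and those after `j` are `0`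
  have hedge : ∀ j < I.k - 1, ∀ t ∈ Icc (0 : ℝ) 1, I.arcInv (I.arc (j + t)) = j + t := by
    intro j hj t ht
    have hpos : ∀ i < I.k - 1, 0 < I.edgeLen i := fun i hi => edgeLen_pos hI hi
    rw [arc, ramp_add hj _ ht, arcInv]
    obtain ⟨d, hd⟩ : ∃ d, I.k - 1 = j + 1 + d := ⟨I.k - 1 - (j + 1), by omega⟩
    rw [hd, Finset.sum_range_add, Finset.sum_range_succ]
    have hmono : ∀ a b : ℕ, a ≤ b → ∑ i ∈ Finset.range a, I.edgeLen i ≤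
        ∑ i ∈ Finset.range b, I.edgeLen i := fun a b hab =>
      Finset.sum_le_sum_of_subset_of_nonneg (Finset.range_subset_range.2 hab)
        fun _ _ _ => Real.sqrt_nonneg _
    have e1 : ∀ i ∈ Finset.range j, clamp01 ((((∑ i ∈ Finset.range j, I.edgeLen i) +
        t * I.edgeLen j) - ∑ i ∈ Finset.range i, I.edgeLen i) / I.edgeLen i) = 1 := by
      intro i hi
      have hi := Finset.mem_range.1 hi
      have p := hpos i (by omega)
      refine clamp01_of_one_le ((one_le_div p).2 ?_)
      have := hmono (i + 1) j hi
      rw [Finset.sum_range_succ] at this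
      have := mul_nonneg ht.1 (hpos j hj).le
      linarith
    have e2 : ∀ i ∈ Finset.range d, clamp01 ((((∑ i ∈ Finset.range j, I.edgeLen i) +
        t * I.edgeLen j) - ∑ i ∈ Finset.range (j + 1 + i), I.edgeLen i) /
          I.edgeLen (j + 1 + i)) = 0 := by
      intro i hi
      have hi := Finset.mem_range.1 hi
      have p := hpos (j + 1 + i) (by omega)
      refine clamp01_of_nonpos (div_nonpos_of_nonpos_of_nonneg ?_ p.le)
      have := hmono (j + 1) (j + 1 + i) (by omega)
      rw [Finset.sum_range_succ] at this
      have := mul_le_mul_of_nonneg_right ht.2 (hpos j hj).le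
      linarith
    rw [Finset.sum_congr rfl e1, Finset.sum_congr rfl e2, add_sub_cancel_left,
      mul_div_cancel_right₀ _ (hpos j hj).ne', clamp01_of_mem ht]
    simp
  have hk := NeZero.pos I.k
  rcases I.params_cases hs with ⟨j, hj, rfl⟩ | ⟨j, hj, t, ht, rfl⟩
  · rcases Nat.lt_or_ge j (I.k - 1) with h | h
    · simpa using hedge j h 0 (by simp)
    · rcases Nat.eq_zero_or_pos j with rfl | hj0
      · have h1 : I.k - 1 = 0 := by omega
        simp [arcInv, h1]
      · have := hedge (j - 1) (by omega) 1 (by simp)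
        rwa [Nat.cast_sub hj0, Nat.cast_one, sub_add_cancel] at this
  · exact hedge j hj t ⟨ht.1.le, ht.2.le⟩

theorem strictMonoOn_arc (hI : InjOn I.curve I.params) : StrictMonoOn I.arc I.params := by
  intro s hs t ht hst
  refine lt_of_le_of_ne (monotone_arc hst.le) fun h => hst.ne ?_
  rw [← arcInv_arc hI hs, ← arcInv_arc hI ht, h]

/-- The parameter `arcInv l` is the last one with arc length at most `l`, if there is any. -/
theorem arcInv_spec (hI : InjOn I.curve I.params) {l : ℝ} (hl : 0 ≤ l) :
    I.arcInv l ∈ I.params ∧ I.arc (I.arcInv l) = min l (I.arc ((I.k : ℝ) - 1)) := by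
  have hk : (0 : ℝ) ≤ (I.k : ℝ) - 1 := by rw [← cast_k_sub_one]; positivity
  have h0 : I.arc 0 = 0 := by
    unfold arc ramp
    refine Finset.sum_eq_zero fun i _ => ?_
    rw [clamp01_of_nonpos (by simp), mul_zero]
  rcases le_total l (I.arc ((I.k : ℝ) - 1)) with h | h
  · obtain ⟨s, hs, rfl⟩ := intermediate_value_Icc hk continuous_arc.continuousOn
      (show l ∈ Icc (I.arc 0) (I.arc ((I.k : ℝ) - 1)) from ⟨by rwa [h0], h⟩)
    rw [arcInv_arc hI hs, min_eq_left h]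
    exact ⟨hs, rfl⟩
  · have : I.arcInv l = (I.k : ℝ) - 1 := by
      rw [arcInv, ← cast_k_sub_one]
      have : ∀ j ∈ Finset.range (I.k - 1),
          clamp01 ((l - ∑ i ∈ Finset.range j, I.edgeLen i) / I.edgeLen j) = 1 := by
        intro j hj
        have hj := Finset.mem_range.1 hj
        refine clamp01_of_one_le ((one_le_div (edgeLen_pos hI hj)).2 ?_)
        have h1 := ramp_add hj I.edgeLen (t := 1) (by simp)
        have h2 : I.arc (j + 1) ≤ I.arc ((I.k : ℝ) - 1) := by
          refine monotone_arc ?_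
          rw [← cast_k_sub_one]; exact_mod_cast hj
        rw [arc, h1] at h2
        linarith
      rw [Finset.sum_congr rfl this]
      simp
    rw [this, min_eq_right h]
    exact ⟨⟨hk, le_rfl⟩, rfl⟩

end Instance
end Watchmen

/-! ### Solutions in which the robots are ordered along the curve -/

namespace Watchmen

/-- A covering of an interval by finitely many intervals has at least its length. -/
theorem sub_le_sum_of_subset_iUnion {ι : Type*} (s : Finset ι) {a b : ι → ℝ}
    (hab : ∀ i ∈ s, a i ≤ b i) {α β : ℝ} (h : Icc α β ⊆ ⋃ i ∈ s, Icc (a i) (b i)) :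
    β - α ≤ ∑ i ∈ s, (b i - a i) := by
  have h1 := (MeasureTheory.measure_mono (μ := MeasureTheory.volume) h).trans
    (MeasureTheory.measure_biUnion_finset_le s _)
  simp only [Real.volume_Icc] at h1
  rw [← ENNReal.ofReal_sum_of_nonneg fun i hi => sub_nonneg.2 (hab i hi)] at h1
  exact (ENNReal.ofReal_le_ofReal_iff (Finset.sum_nonneg fun i hi => sub_nonneg.2 (hab i hi))).1 h1

/-- Cutting a finite set `V` of reals into `q` consecutive groups: if `φ v` is the distance from
`α` to `v` plus `c` times the number of points left of `v`, then the groups are given by the integer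
part of `φ v / T`. -/
theorem exists_groups {V : Finset ℝ} {α T c : ℝ} {q : ℕ} (hc : 0 < c) (hT : 0 < T)
    (hα : ∀ v ∈ V, α ≤ v) (hV : ∀ v ∈ V, v - α + c * V.card ≤ q * T) :
    ∃ W : ℕ → Finset ℝ, (∀ i j, i < j → ∀ w ∈ W i, ∀ w' ∈ W j, w ≤ w') ∧
      (∀ v ∈ V, ∃ j < q, v ∈ W j) ∧ (∀ j, W j ⊆ V) ∧
      ∀ j, ∀ w ∈ W j, ∀ w' ∈ W j, w - w' + c * (W j).card ≤ T + c := by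
  classical
  let left : ℝ → Finset ℝ := fun v => V.filter (· < v)
  let φ : ℝ → ℝ := fun v => v - α + c * (left v).card
  have hmono : Monotone φ := by
    intro v w hvw
    have h1 : ((left v).card : ℝ) ≤ (left w).card := by
      exact_mod_cast Finset.card_le_card fun u hu => by
        simp only [left, Finset.mem_filter] at hu ⊢
        exact ⟨hu.1, hu.2.trans_le hvw⟩
    have := mul_le_mul_of_nonneg_left h1 hc.le
    simp only [φ]
    linarith
  have hφ0 : ∀ v ∈ V, 0 ≤ φ v := fun v hv =>
    add_nonneg (sub_nonneg.2 (hα v hv)) (by positivity)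
  refine ⟨fun j => V.filter fun v => ⌊φ v / T⌋₊ = j, ?_, ?_, fun j => Finset.filter_subset _ _, ?_⟩
  · intro i j hij w hw w' hw'
    by_contra! hlt
    have h1 := (Finset.mem_filter.1 hw).2
    have h2 := (Finset.mem_filter.1 hw').2
    have : ⌊φ w' / T⌋₊ ≤ ⌊φ w / T⌋₊ :=
      Nat.floor_mono (div_le_div_of_nonneg_right (hmono hlt.le) hT.le)
    omega
  · intro v hv
    refine ⟨_, ?_, Finset.mem_filter.2 ⟨hv, rfl⟩⟩
    rw [Nat.floor_lt (div_nonneg (hφ0 v hv) hT.le), div_lt_iff₀ hT]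
    have h1 : ((left v).card : ℝ) < V.card := by
      refine Nat.cast_lt.2 (Finset.card_lt_card (Finset.filter_ssubset.2 ⟨v, hv, lt_irrefl v⟩))
    have := mul_lt_mul_of_pos_left h1 hc
    have := hV v hv
    simp only [φ]
    linarith
  · intro j w hw w' hw'
    set G := V.filter fun v => ⌊φ v / T⌋₊ = j with hG
    have hne : G.Nonempty := ⟨w, hw⟩
    have hmax := G.max'_mem hne
    have hmin := G.min'_mem hne
    have h1 := (Finset.mem_filter.1 hmax)
    have h2 := (Finset.mem_filter.1 hmin)
    set M := G.max' hne
    set μ := G.min' hne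
    have hM : φ M < (j + 1) * T := by
      rw [← div_lt_iff₀ hT, ← h1.2]
      exact Nat.lt_floor_add_one _
    have hμ : j * T ≤ φ μ := by
      rw [← le_div_iff₀ hT, ← h2.2]
      exact Nat.floor_le (div_nonneg (hφ0 _ h2.1) hT.le)
    -- apart from `M`, the members of `G` lie to the left of `M` but not of `μ`
    have hcard : G.card + (left μ).card ≤ (left M).card + 1 := by
      have hd : Disjoint (G.erase M) (left μ) := by
        refine Finset.disjoint_left.2 fun u hu hu' => ?_
        have h3 := G.min'_le u (Finset.mem_of_mem_erase hu)
        exact absurd (Finset.mem_filter.1 hu').2 (not_lt.2 h3)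
      have hs : G.erase M ∪ left μ ⊆ left M := by
        refine Finset.union_subset (fun u hu => ?_) fun u hu => ?_
        · refine Finset.mem_filter.2 ⟨Finset.filter_subset _ _ (Finset.mem_of_mem_erase hu), ?_⟩
          exact lt_of_le_of_ne (G.le_max' u (Finset.mem_of_mem_erase hu))
            (Finset.ne_of_mem_erase hu)
        · have hu := Finset.mem_filter.1 hu
          exact Finset.mem_filter.2 ⟨hu.1, hu.2.trans_le (G.le_max' _ hmin)⟩
      have h3 := Finset.card_le_card hs
      rw [Finset.card_union_of_disjoint hd] at h3
      have h4 := Finset.card_erase_add_one hmax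
      omega
    have hcard' : (G.card : ℝ) + (left μ).card ≤ (left M).card + 1 := by exact_mod_cast hcard
    have h5 := mul_le_mul_of_nonneg_left hcard' hc.le
    have h6 := G.le_max' w hw
    have h7 := G.min'_le w' hw'
    simp only [φ] at hM hμ
    linarith

/-- Any solution with costs at most `T` can be replaced by one in which the viewpoints are divided
among the robots in consecutive groups, at the price of one more measurement per robot. If the
paths fall into two parts separated by a point, the two parts are treated one after the other;
otherwise the paths cover an interval, and its length is at most the sum of theirs. -/
theorem exists_consecutive {ι : Type*} {a b : ι → ℝ} {V : ι → Finset ℝ} {T c : ℝ} (hc : 0 < c)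
    (hab : ∀ i, a i ≤ b i) (hV : ∀ i, (V i : Set ℝ) ⊆ Icc (a i) (b i))
    (hT : ∀ i, b i - a i + c * (V i).card ≤ T) (s : Finset ι) :
    ∃ W : ℕ → Finset ℝ, (∀ i j, i < j → j < s.card → ∀ w ∈ W i, ∀ w' ∈ W j, w ≤ w') ∧
      (∀ i ∈ s, ∀ v ∈ V i, ∃ j < s.card, v ∈ W j) ∧
      (∀ j < s.card, ∀ w ∈ W j, ∃ i ∈ s, w ∈ V i) ∧
      ∀ j < s.card, ∀ w ∈ W j, ∀ w' ∈ W j, w - w' + c * (W j).card ≤ T + c := by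
  classical
  induction s using Finset.strongInduction with
  | H s ih =>
  by_cases hsplit : ∃ x, (∃ i ∈ s, b i < x) ∧ (∃ i ∈ s, x < a i) ∧ ∀ i ∈ s, b i < x ∨ x < a i
  · obtain ⟨x, ⟨i₀, hi₀, hi₀x⟩, ⟨i₁, hi₁, hi₁x⟩, hx⟩ := hsplit
    have hL : s.filter (fun i => b i < x) ⊂ s :=
      Finset.filter_ssubset.2 ⟨i₁, hi₁, not_lt.2 (hi₁x.le.trans (hab i₁))⟩
    have hR : s.filter (fun i => ¬ b i < x) ⊂ s :=
      Finset.filter_ssubset.2 ⟨i₀, hi₀, not_not.2 hi₀x⟩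
    obtain ⟨W₁, h₁o, h₁v, h₁s, h₁c⟩ := ih _ hL
    obtain ⟨W₂, h₂o, h₂v, h₂s, h₂c⟩ := ih _ hR
    have hcard := Finset.card_filter_add_card_filter_not (s := s) (fun i => b i < x)
    set L := s.filter (fun i => b i < x)
    set R := s.filter (fun i => ¬ b i < x)
    obtain ⟨W, hW₁, hW₂⟩ : ∃ W : ℕ → Finset ℝ, (∀ j, j < L.card → W j = W₁ j) ∧
        ∀ j, ¬ j < L.card → W j = W₂ (j - L.card) :=
      ⟨fun j => if j < L.card then W₁ j else W₂ (j - L.card), fun _ h => if_pos h,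
        fun _ h => if_neg h⟩
    refine ⟨W, ?_, ?_, ?_, ?_⟩
    · intro i j hij hj w hw w' hw'
      by_cases hjL : j < L.card
      · rw [hW₁ _ hjL] at hw'
        rw [hW₁ _ (hij.trans hjL)] at hw
        exact h₁o i j hij hjL w hw w' hw'
      · rw [hW₂ _ hjL] at hw'
        by_cases hiL : i < L.card
        · rw [hW₁ _ hiL] at hw
          obtain ⟨r, hr, hrw⟩ := h₁s i hiL w hw
          obtain ⟨r', hr', hrw'⟩ := h₂s _ (by omega) w' hw'
          have h1 := (hV r hrw).2
          have h2 := (hV r' hrw').1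
          have h3 := (Finset.mem_filter.1 hr).2
          have h4 := (hx r' (Finset.mem_filter.1 hr').1).resolve_left (Finset.mem_filter.1 hr').2
          linarith
        · rw [hW₂ _ hiL] at hw
          exact h₂o _ _ (by omega) (by omega) w hw w' hw'
    · intro i hi v hv
      by_cases hbx : b i < x
      · obtain ⟨j, hj, hjv⟩ := h₁v i (Finset.mem_filter.2 ⟨hi, hbx⟩) v hv
        exact ⟨j, by omega, by rwa [hW₁ _ hj]⟩
      · obtain ⟨j, hj, hjv⟩ := h₂v i (Finset.mem_filter.2 ⟨hi, hbx⟩) v hv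
        refine ⟨L.card + j, by omega, ?_⟩
        rwa [hW₂ _ (by omega), Nat.add_sub_cancel_left]
    · intro j hj w hw
      by_cases hjL : j < L.card
      · rw [hW₁ _ hjL] at hw
        obtain ⟨i, hi, hiw⟩ := h₁s j hjL w hw
        exact ⟨i, hL.1 hi, hiw⟩
      · rw [hW₂ _ hjL] at hw
        obtain ⟨i, hi, hiw⟩ := h₂s _ (by omega) w hw
        exact ⟨i, hR.1 hi, hiw⟩
    · intro j hj w hw w' hw'
      by_cases hjL : j < L.card
      · rw [hW₁ _ hjL] at hw hw' ⊢
        exact h₁c j hjL w hw w' hw'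
      · rw [hW₂ _ hjL] at hw hw' ⊢
        exact h₂c _ (by omega) w hw w' hw'
  · by_cases hVe : s.biUnion V = ∅
    · refine ⟨fun _ => ∅, by simp, fun i hi v hv => ?_, by simp, by simp⟩
      exact absurd (Finset.mem_biUnion.2 ⟨i, hi, hv⟩) (by simp [hVe])
    obtain ⟨v₀, hv₀⟩ := Finset.nonempty_iff_ne_empty.2 hVe
    obtain ⟨i₀, hi₀, hv₀⟩ := Finset.mem_biUnion.1 hv₀
    have hT0 : 0 < T := by
      have h1 := hT i₀
      have h2 : (1 : ℝ) ≤ (V i₀).card := by exact_mod_cast Finset.card_pos.2 ⟨v₀, hv₀⟩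
      have := hab i₀
      nlinarith
    obtain ⟨r, hr, hrmin⟩ := s.exists_min_image a ⟨i₀, hi₀⟩
    obtain ⟨t, ht, htmax⟩ := s.exists_max_image b ⟨i₀, hi₀⟩
    have hcover : Icc (a r) (b t) ⊆ ⋃ i ∈ s, Icc (a i) (b i) := by
      intro x hx
      by_contra hno
      simp only [mem_iUnion, not_exists] at hno
      have hno' : ∀ i ∈ s, b i < x ∨ x < a i := by
        intro i hi
        by_contra! h
        exact hno i hi ⟨h.2, h.1⟩
      exact hsplit ⟨x, ⟨r, hr, (hno' r hr).resolve_right (not_lt.2 hx.1)⟩,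
        ⟨t, ht, (hno' t ht).resolve_left (not_lt.2 hx.2)⟩, hno'⟩
    have hlen := sub_le_sum_of_subset_iUnion s (fun i _ => hab i) hcover
    have hcardV : ((s.biUnion V).card : ℝ) ≤ ∑ i ∈ s, ((V i).card : ℝ) := by
      exact_mod_cast Finset.card_biUnion_le
    have hsum : ∑ i ∈ s, (b i - a i) + c * ∑ i ∈ s, ((V i).card : ℝ) ≤ s.card * T := by
      rw [Finset.mul_sum, ← Finset.sum_add_distrib, ← nsmul_eq_mul]
      exact Finset.sum_le_card_nsmul _ _ _ fun i _ => hT i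
    obtain ⟨W, h1, h2, h3, h4⟩ := exists_groups (V := s.biUnion V) (α := a r) (q := s.card) hc hT0
      (fun v hv => by
        obtain ⟨i, hi, hiv⟩ := Finset.mem_biUnion.1 hv
        exact (hrmin i hi).trans (hV i hiv).1)
      (fun v hv => by
        obtain ⟨i, hi, hiv⟩ := Finset.mem_biUnion.1 hv
        have h1 := (hV i hiv).2.trans (htmax i hi)
        have h2 := mul_le_mul_of_nonneg_left hcardV hc.le
        linarith)
    refine ⟨W, fun i j hij _ => h1 i j hij, fun i hi v hv =>
      h2 v (Finset.mem_biUnion.2 ⟨i, hi, hv⟩), fun j _ w hw => ?_, fun j _ => h4 j⟩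
    exact Finset.mem_biUnion.1 (h3 j hw)

namespace Instance

variable {I : Instance}

/-- A solution in which the viewpoints of each robot come before those of the next one, and in
which each robot has cost at most `B`: the distance of any two of its viewpoints, which bounds the
length of its shortest path, plus the time for its measurements. -/
structure IsOrderedSolution (I : Instance) (B : ℝ) (W : ℕ → Finset ℝ) : Prop where
  mem : ∀ j < I.m, ∀ w ∈ W j, w ∈ I.params
  order : ∀ i j, i < j → j < I.m → ∀ w ∈ W i, ∀ w' ∈ W j, w ≤ w'
  sees : ∀ x, I.InReg x → ∃ j < I.m, ∃ w ∈ W j, w ∈ I.seeing x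
  cost : ∀ j < I.m, ∀ w ∈ W j, ∀ w' ∈ W j, I.arc w - I.arc w' + I.tm * (W j).card ≤ B

theorem Plan.length_eq {S : I.Plan} (hS : S.IsFeasible) (i : Fin I.m) :
    S.length i = I.arc (S.last i) - I.arc (S.first i) := by
  obtain ⟨h1, h2, h3, -⟩ := hS.1 i
  rw [Plan.length, eVariationOn_curve h1 h2 h3, ENNReal.toReal_ofReal]
  exact sub_nonneg.2 (monotone_arc h3)

/-- Solutions that respect the order along the curve are almost as good as all solutions. -/
theorem exists_isOrderedSolution (hI : InjOn I.curve I.params) {S : I.Plan} (hS : S.IsFeasible)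
    {T : ℝ} (hT : ∀ i, S.cost i ≤ T) : ∃ W, I.IsOrderedSolution (T + I.tm) W := by
  classical
  have hpar : ∀ i, (S.views i : Set ℝ) ⊆ I.params := fun i v hv =>
    ⟨(hS.1 i).1.1.trans ((hS.1 i).2.2.2 hv).1, ((hS.1 i).2.2.2 hv).2.trans (hS.1 i).2.1.2⟩
  have hmono := strictMonoOn_arc hI
  obtain ⟨W, h1, h2, -, h4⟩ := exists_consecutive (ι := Fin I.m)
    (a := fun i => I.arc (S.first i)) (b := fun i => I.arc (S.last i))
    (V := fun i => (S.views i).image I.arc) (T := T) (c := I.tm) I.tm_pos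
    (fun i => monotone_arc (hS.1 i).2.2.1)
    (fun i => by
      rw [Finset.coe_image]
      rintro - ⟨v, hv, rfl⟩
      exact ⟨monotone_arc ((hS.1 i).2.2.2 hv).1, monotone_arc ((hS.1 i).2.2.2 hv).2⟩)
    (fun i => by
      have h5 := hT i
      rw [Plan.cost, Plan.length_eq hS] at h5
      have h6 : (((S.views i).image I.arc).card : ℝ) ≤ (S.views i).card := by
        exact_mod_cast Finset.card_image_le
      have := mul_le_mul_of_nonneg_left h6 I.tm_pos.le
      linarith) Finset.univ
  rw [Finset.card_univ, Fintype.card_fin] at h1 h2 h4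
  let V : Finset ℝ := Finset.univ.biUnion S.views
  have hVp : ∀ v ∈ V, v ∈ I.params := by
    intro v hv
    obtain ⟨i, -, hi⟩ := Finset.mem_biUnion.1 hv
    exact hpar i hi
  refine ⟨fun j => V.filter fun v => I.arc v ∈ W j, ⟨?_, ?_, ?_, ?_⟩⟩
  · exact fun j _ w hw => hVp w (Finset.mem_filter.1 hw).1
  · intro i j hij hj w hw w' hw'
    obtain ⟨hw1, hw2⟩ := Finset.mem_filter.1 hw
    obtain ⟨hw1', hw2'⟩ := Finset.mem_filter.1 hw'
    exact (hmono.le_iff_le (hVp _ hw1) (hVp _ hw1')).1 (h1 i j hij hj _ hw2 _ hw2')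
  · intro x hx
    obtain ⟨v, hv, hvx⟩ := (seesAll_iff (by
      intro v hv
      obtain ⟨i, hi⟩ := mem_iUnion.1 hv
      exact hpar i hi)).1 hS.2 x hx
    obtain ⟨i, hi⟩ := mem_iUnion.1 hv
    obtain ⟨j, hj, hjv⟩ := h2 i (Finset.mem_univ i) _ (Finset.mem_image_of_mem _ hi)
    exact ⟨j, hj, v, Finset.mem_filter.2 ⟨Finset.mem_biUnion.2 ⟨i, Finset.mem_univ i, hi⟩, hjv⟩,
      hvx⟩
  · intro j hj w hw w' hw'
    have h5 := h4 j hj _ (Finset.mem_filter.1 hw).2 _ (Finset.mem_filter.1 hw').2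
    have h6 : ((V.filter fun v => I.arc v ∈ W j).card : ℝ) ≤ (W j).card := by
      exact_mod_cast Finset.card_le_card_of_injOn I.arc
        (fun v hv => (Finset.mem_filter.1 hv).2)
        (hmono.injOn.mono fun v hv => hVp v (Finset.mem_filter.1 hv).1)
    have := mul_le_mul_of_nonneg_left h6 I.tm_pos.le
    linarith

end Instance
end Watchmen

/-! ### The greedy search with doubling budgets -/

namespace Watchmen

/-- A stage of the search: the current budget per robot; the last viewpoint placed (or `-1`); the
first point of the path of the current robot; the number of robots used, of viewpoints of the
current robot, and of all viewpoints; and the solution found so far, in the output format. -/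
structure Search where
  budget : ℝ
  front : ℝ
  start : ℝ
  robots : ℕ
  num : ℕ
  cnt : ℕ
  begins : ℕ → ℕ
  lens : ℕ → ℕ
  firsts : ℕ → ℝ
  lasts : ℕ → ℝ
  views : ℕ → ℝ

/-- The stage at which the viewpoint `f` is added as viewpoint number `n` of the robot `r`, whose
path starts at `a`. -/
noncomputable def Search.record (s : Search) (r n : ℕ) (a f : ℝ) : Search where
  budget := s.budget
  front := f
  start := a
  robots := r + 1
  num := n
  cnt := s.cnt + 1
  begins := Function.update s.begins r (s.cnt + 1 - n)
  lens := Function.update s.lens r n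
  firsts := Function.update s.firsts r a
  lasts := Function.update s.lasts r f
  views := Function.update s.views s.cnt f

namespace Instance

variable (I : Instance) (s : Search)

/-- The arc length at which the budget of the current robot is used up, if it makes one more
measurement. -/
noncomputable def limit : ℝ := I.arc s.start + s.budget - ((s.num : ℝ) + 1) * I.tm

/-- The current robot can go on and make one more measurement. -/
def CanExtend : Prop := 0 < s.num ∧ I.arc s.front < I.limit s

open Classical in
/-- The last viewpoint after a step. -/
noncomputable def newFront : ℝ :=
  if I.CanExtend s then min (I.next s.front) (I.arcInv (I.limit s))
  else if s.robots < I.m then I.next s.front else -1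

open Classical in
/-- The first point of the current path after a step. -/
noncomputable def newStart : ℝ :=
  if I.CanExtend s then s.start else if s.robots < I.m then I.next s.front else 0

open Classical in
/-- The budget after a step. -/
noncomputable def newBudget : ℝ :=
  if I.CanExtend s then s.budget else if s.robots < I.m then s.budget else s.budget + s.budget

open Classical in
/-- The number of robots used after a step. -/
noncomputable def newRobots : ℕ :=
  if I.CanExtend s then s.robots else if s.robots < I.m then s.robots + 1 else 0

open Classical in
/-- The number of viewpoints of the current robot after a step. -/
noncomputable def newNum : ℕ :=
  if I.CanExtend s then s.num + 1 else if s.robots < I.m then 1 else 0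

open Classical in
/-- The number of viewpoints after a step. -/
noncomputable def newCnt : ℕ :=
  if I.CanExtend s then s.cnt + 1 else if s.robots < I.m then s.cnt + 1 else 0

/-- A step of the search. The current robot goes to the last point at which it or a later robot
must make the next measurement, or as far as its budget permits; if it cannot move, the next robot
is placed; if there is none, the search starts again with twice the budget. -/
noncomputable def step : Search where
  budget := I.newBudget s
  front := I.newFront s
  start := I.newStart s
  robots := I.newRobots s
  num := I.newNum s
  cnt := I.newCnt s
  begins := Function.update s.begins (I.newRobots s - 1) (I.newCnt s - I.newNum s)
  lens := Function.update s.lens (I.newRobots s - 1) (I.newNum s)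
  firsts := Function.update s.firsts (I.newRobots s - 1) (I.newStart s)
  lasts := Function.update s.lasts (I.newRobots s - 1) (I.newFront s)
  views := Function.update s.views (I.newCnt s - 1) (I.newFront s)

/-- The consistency of the data of the search: the paths fit the budget, and every point that is
seen from some point of the curve up to the last viewpoint is seen from a viewpoint. -/
structure Valid : Prop where
  tm_le : I.tm ≤ s.budget
  robots_le : s.robots ≤ I.m
  front_le : s.front ≤ (I.k : ℝ) - 1
  none : s.robots = 0 → s.front = -1 ∧ s.num = 0 ∧ s.cnt = 0
  num_le : s.num ≤ s.cnt
  current : ∀ j, j + 1 = s.robots → s.begins j + s.lens j = s.cnt ∧ s.lens j = s.num ∧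
    s.firsts j = s.start ∧ s.lasts j = s.front ∧ 0 < s.num
  paths : ∀ j < s.robots, 0 ≤ s.firsts j ∧ s.firsts j ≤ s.lasts j ∧ s.lasts j ≤ (I.k : ℝ) - 1 ∧
    I.arc (s.lasts j) - I.arc (s.firsts j) + s.lens j * I.tm ≤ s.budget
  blocks : ∀ j < s.robots, s.begins j + s.lens j ≤ s.cnt ∧
    ∀ l < s.lens j, s.views (s.begins j + l) ∈ Icc (s.firsts j) (s.lasts j)
  sees : ∀ x, I.InReg x → ∀ u ∈ I.seeing x, u ≤ s.front →
    ∃ j < s.robots, ∃ l < s.lens j, s.views (s.begins j + l) ∈ I.seeing x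

/-- The search is not behind any solution within the budget: the viewpoints of the earlier robots
have been passed, and those of the current robot that have not been passed are so close that the
budget suffices to visit them all. -/
def Ahead : Prop :=
  ∀ W, I.IsOrderedSolution s.budget W →
    (∀ j, j + 1 < s.robots → ∀ w ∈ W j, w ≤ s.front) ∧
    ∀ j, j + 1 = s.robots → ∀ w ∈ W j, s.front < w → I.arc w ≤
      I.arc s.start + s.budget - (s.num + ((W j).filter (s.front < ·)).card) * I.tm

open Classical in
/-- A bound for the number of further steps with the current budget: each of them passes a point of
`V`, or uses up the budget of a robot, or starts a new robot. -/
noncomputable def potential (V : Finset ℝ) : ℕ :=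
  (V.filter (s.front < ·)).card + 2 * (I.m - s.robots) + if I.CanExtend s then 1 else 0

variable {I s}

theorem step_eq_of_canExtend (hs : I.Valid s) (h : I.CanExtend s) : ∃ r, r + 1 = s.robots ∧
    I.step s = s.record r (s.num + 1) s.start
      (min (I.next s.front) (I.arcInv (I.limit s))) := by
  have hr : s.robots ≠ 0 := fun h0 => by
    have := (hs.none h0).2.1
    have := h.1
    omega
  refine ⟨s.robots - 1, by omega, ?_⟩
  have : s.robots - 1 + 1 = s.robots := by omega
  simp [step, Search.record, newBudget, newFront, newStart, newRobots, newNum, newCnt, h, this]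

theorem step_eq_of_lt (h : ¬ I.CanExtend s) (hm : s.robots < I.m) :
    I.step s = s.record s.robots 1 (I.next s.front) (I.next s.front) := by
  simp [step, Search.record, newBudget, newFront, newStart, newRobots, newNum, newCnt, h, hm]

theorem Valid.start_mem (hs : I.Valid s) (hr : s.robots ≠ 0) :
    0 ≤ s.start ∧ s.start ≤ s.front ∧
      I.arc s.front - I.arc s.start + s.num * I.tm ≤ s.budget := by
  obtain ⟨j, hj⟩ := Nat.exists_eq_succ_of_ne_zero hr
  obtain ⟨-, h1, h2, h3, -⟩ := hs.current j hj.symm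
  obtain ⟨h4, h5, -, h6⟩ := hs.paths j (by omega)
  rw [h1, h2, h3] at h6
  rw [h2] at h4 h5
  rw [h3] at h5
  exact ⟨h4, h5, h6⟩

/-- If no point is seen only from between `f` and `s`, then a point that is seen up to `f'`,
where `f' ≤ s`, is seen up to `f` or from `f'`. -/
theorem mem_seeing_or (hI : I.ChainVisible) {f f' t : ℝ} (hg : ¬ I.Gap f t) (hf' : f' ≤ t)
    {x : ℝ × ℝ} (hx : I.InReg x) {u : ℝ} (hu : u ∈ I.seeing x) (huf : u ≤ f') :
    (∃ u ∈ I.seeing x, u ≤ f) ∨ f' ∈ I.seeing x := by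
  by_contra! h
  refine hg (Gap.mono I ⟨x, hx, fun v hv => ⟨h.1 v hv, ?_⟩⟩ hf')
  by_contra! hfv
  exact h.2 ((hI x hx).2.out hu hv ⟨huf, hfv⟩)

/-- Adding a viewpoint `f`, either for a new robot or for the current one. -/
theorem Valid.record (hI : I.ChainVisible) (hs : I.Valid s) {r n : ℕ} {a f : ℝ} (hr : r < I.m)
    (hcase : (r = s.robots ∧ n = 1 ∧ a = f) ∨ (r + 1 = s.robots ∧ n = s.num + 1 ∧ a = s.start))
    (hsf : s.front < f) (hf : f ∈ I.params) (hfn : f ≤ I.next s.front)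
    (hn : ¬ I.Gap s.front (I.next s.front)) (hcost : I.arc f - I.arc a + n * I.tm ≤ s.budget) :
    I.Valid (s.record r n a f) := by
  have hncnt : n ≤ s.cnt + 1 := by
    have := hs.num_le
    omega
  have hn1 : 0 < n := by omega
  have haf : 0 ≤ a ∧ a ≤ f := by
    rcases hcase with ⟨h1, h2, h3⟩ | ⟨h1, h2, h3⟩
    · rw [h3]; exact ⟨hf.1, le_rfl⟩
    · have := hs.start_mem (by omega)
      rw [h3]
      exact ⟨this.1, this.2.1.trans hsf.le⟩
  have hnew : ∀ l < n, Function.update s.views s.cnt f (s.cnt + 1 - n + l) ∈ Icc a f := by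
    intro l hl
    by_cases hl' : s.cnt + 1 - n + l = s.cnt
    · rw [hl', Function.update_self]
      exact ⟨haf.2, le_rfl⟩
    · rw [Function.update_of_ne hl']
      rcases hcase with ⟨h1, h2, h3⟩ | ⟨h1, h2, h3⟩
      · omega
      · obtain ⟨c1, c2, c3, c4, -⟩ := hs.current r h1
        have h4 := (hs.blocks r (by omega)).2 l (by omega)
        rw [c3, c4, show s.begins r = s.cnt + 1 - n by omega] at h4
        rw [h3]
        exact ⟨h4.1, h4.2.trans hsf.le⟩
  constructor
  · exact hs.tm_le
  · exact hr
  · exact hf.2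
  · intro h; exact absurd h (Nat.succ_ne_zero _)
  · exact hncnt
  · intro j hj
    obtain rfl : j = r := Nat.succ_injective hj
    simp only [Search.record, Function.update_self, true_and]
    omega
  · intro j hj
    have hj : j < r + 1 := hj
    by_cases hjr : j = r
    · subst hjr
      simp only [Search.record, Function.update_self]
      exact ⟨haf.1, haf.2, hf.2, hcost⟩
    · simp only [Search.record, Function.update_of_ne hjr]
      exact hs.paths j (by omega)
  · intro j hj
    have hj : j < r + 1 := hj
    by_cases hjr : j = r
    · subst hjr
      simp only [Search.record, Function.update_self]
      exact ⟨by omega, hnew⟩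
    · simp only [Search.record, Function.update_of_ne hjr]
      have h1 := hs.blocks j (by omega)
      refine ⟨by omega, fun l hl => ?_⟩
      rw [Function.update_of_ne (by omega)]
      exact h1.2 l hl
  · intro x hx u hu huf
    rcases mem_seeing_or hI hn hfn hx hu huf with ⟨u', hu', hle⟩ | hfx
    · obtain ⟨j, hj, l, hl, hv⟩ := hs.sees x hx u' hu' hle
      have hb := hs.blocks j hj
      by_cases hjr : j = r
      · subst hjr
        obtain ⟨h1, h2, h3⟩ := hcase.resolve_left (by omega)
        obtain ⟨c1, c2, -⟩ := hs.current j h1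
        refine ⟨j, Nat.lt_succ_self j, l, ?_, ?_⟩
        · simp only [Search.record, Function.update_self]
          omega
        · simp only [Search.record, Function.update_self]
          rwa [show s.cnt + 1 - n = s.begins j by omega, Function.update_of_ne (by omega)]
      · refine ⟨j, show j < r + 1 by omega, l, ?_, ?_⟩
        · simpa only [Search.record, Function.update_of_ne hjr] using hl
        · simp only [Search.record, Function.update_of_ne hjr]
          rwa [Function.update_of_ne (by omega)]
    · refine ⟨r, Nat.lt_succ_self r, n - 1, ?_, ?_⟩
      · simp only [Search.record, Function.update_self]
        omega
      · simp only [Search.record, Function.update_self]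
        rwa [show s.cnt + 1 - n + (n - 1) = s.cnt by omega, Function.update_self]

/-- A finite set of viewpoints that sees everything has one between the last viewpoint and the
next position of the search. -/
theorem exists_mem_le_next (hI : I.ChainVisible) {f : ℝ} (hf : f ≤ (I.k : ℝ) - 1)
    (hgap : I.Gap f I.k) {V : Finset ℝ} (hVp : ∀ v ∈ V, v ∈ I.params)
    (hV : ∀ x, I.InReg x → ∃ v ∈ V, v ∈ I.seeing x) : ∃ v ∈ V, f < v ∧ v ≤ I.next f := by
  obtain ⟨-, -, -, hn⟩ := next_spec hI hf hV hgap
  by_contra! h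
  by_cases hne : (V.filter (I.next f < ·)).Nonempty
  · obtain ⟨hm1, hm2⟩ := Finset.mem_filter.1 (Finset.min'_mem _ hne)
    obtain ⟨x, hx, hx'⟩ := hn _ (hVp _ hm1).2 hm2
    obtain ⟨v, hv, hvx⟩ := hV x hx
    have h1 := hx' v hvx
    have h2 := Finset.min'_le _ v (Finset.mem_filter.2 ⟨hv, h v hv h1.1⟩)
    exact absurd h1.2 (not_lt.2 h2)
  · obtain ⟨x, hx, hx'⟩ := hgap
    obtain ⟨v, hv, hvx⟩ := hV x hx
    exact hne ⟨v, Finset.mem_filter.2 ⟨hv, h v hv (hx' v hvx).1⟩⟩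

theorem IsOrderedSolution.exists_mem_le_next (hI : I.ChainVisible) {B : ℝ} {W : ℕ → Finset ℝ}
    (hW : I.IsOrderedSolution B W) {f : ℝ} (hf : f ≤ (I.k : ℝ) - 1) (hgap : I.Gap f I.k) :
    ∃ j < I.m, ∃ w ∈ W j, f < w ∧ w ≤ I.next f := by
  classical
  obtain ⟨v, hv, hfv⟩ := Instance.exists_mem_le_next hI hf hgap
    (V := (Finset.range I.m).biUnion W)
    (fun v hv => by
      obtain ⟨j, hj, hv⟩ := Finset.mem_biUnion.1 hv
      exact hW.mem j (Finset.mem_range.1 hj) v hv)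
    (fun x hx => by
      obtain ⟨j, hj, w, hw, hwx⟩ := hW.sees x hx
      exact ⟨w, Finset.mem_biUnion.2 ⟨j, Finset.mem_range.2 hj, hw⟩, hwx⟩)
  obtain ⟨j, hj, hv⟩ := Finset.mem_biUnion.1 hv
  exact ⟨j, Finset.mem_range.1 hj, v, hv, hfv⟩

theorem arc_nonneg (t : ℝ) : 0 ≤ I.arc t := by
  unfold arc ramp
  exact Finset.sum_nonneg fun _ _ => mul_nonneg (Real.sqrt_nonneg _) (le_max_left _ _)

/-- When the current robot cannot go on, all viewpoints of the corresponding robots of a solution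
within the budget have been passed. -/
theorem Ahead.le_front (hinj : InjOn I.curve I.params) (ha : I.Ahead s) (hs : I.Valid s)
    (h : ¬ I.CanExtend s) {W : ℕ → Finset ℝ} (hW : I.IsOrderedSolution s.budget W) {j : ℕ}
    (hj : j < s.robots) {w : ℝ} (hw : w ∈ W j) : w ≤ s.front := by
  rcases Nat.lt_or_ge (j + 1) s.robots with h1 | h1
  · exact (ha W hW).1 j h1 w hw
  · have hj' : j + 1 = s.robots := by omega
    by_contra! hlt
    have h2 := (ha W hW).2 j hj' w hw hlt
    have h3 : (1 : ℝ) ≤ ((W j).filter (s.front < ·)).card := by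
      exact_mod_cast Finset.card_pos.2 ⟨w, Finset.mem_filter.2 ⟨hw, hlt⟩⟩
    have hst := hs.start_mem (by omega)
    have hwp := hW.mem j (hj.trans_le hs.robots_le) w hw
    have h4 := strictMonoOn_arc hinj ⟨hst.1.trans hst.2.1, hs.front_le⟩ hwp hlt
    refine h ⟨(hs.current j hj').2.2.2.2, h4.trans_le (h2.trans ?_)⟩
    have := mul_le_mul_of_nonneg_right h3 I.tm_pos.le
    rw [limit]
    linarith

/-- The point to which the current robot goes on. -/
theorem CanExtend.target (hinj : InjOn I.curve I.params) (h : I.CanExtend s) (hs : I.Valid s)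
    (hnp : I.next s.front ∈ I.params) (hfn : s.front < I.next s.front) :
    s.front < I.arcInv (I.limit s) ∧ I.arcInv (I.limit s) ∈ I.params ∧
      I.arc (I.arcInv (I.limit s)) ≤ I.limit s ∧
      ∀ t ∈ I.params, I.arcInv (I.limit s) < t → I.arc (I.arcInv (I.limit s)) = I.limit s := by
  have hr : s.robots ≠ 0 := fun h0 => by
    have := (hs.none h0).2.1
    have := h.1
    omega
  have hst := hs.start_mem hr
  have hmono := strictMonoOn_arc hinj
  obtain ⟨h1, h2⟩ := arcInv_spec hinj ((arc_nonneg _).trans h.2.le)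
  have hk : (I.k : ℝ) - 1 ∈ I.params := ⟨hnp.1.trans hnp.2, le_rfl⟩
  refine ⟨?_, h1, h2 ▸ min_le_left _ _, fun t ht htP => ?_⟩
  · refine (monotone_arc (I := I)).reflect_lt ?_
    rw [h2]
    exact lt_min h.2 (hmono ⟨hst.1.trans hst.2.1, hs.front_le⟩ hk (hfn.trans_le hnp.2))
  · rcases min_choice (I.limit s) (I.arc ((I.k : ℝ) - 1)) with h3 | h3
    · rw [h2, h3]
    · have h4 := hmono h1 ht htP
      have h5 := monotone_arc (I := I) ht.2
      rw [h2, h3] at h4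
      exact absurd h5 (not_le.2 h4)

/-- A step of the current robot. It stays ahead of an ordered solution: if it moves to the next
position, it passes a viewpoint of the corresponding robot; if it moves to the end of its budget,
the corresponding robot cannot have a viewpoint beyond. -/
theorem step_advance (hinj : InjOn I.curve I.params) (hI : I.ChainVisible) {V : Finset ℝ}
    (hVp : ∀ v ∈ V, v ∈ I.params) (hV : ∀ x, I.InReg x → ∃ v ∈ V, v ∈ I.seeing x)
    (hs : I.Valid s) (ha : I.Ahead s) (hgap : I.Gap s.front I.k) (h : I.CanExtend s) :
    I.Valid (I.step s) ∧ I.Ahead (I.step s) ∧ (I.step s).budget = s.budget ∧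
      (I.step s).cnt = s.cnt + 1 ∧ I.potential (I.step s) V < I.potential s V := by
  classical
  obtain ⟨hfn, hnp, hng, -⟩ := next_spec hI hs.front_le hV hgap
  obtain ⟨hP1, hP2, hP3, hP4⟩ := h.target hinj hs hnp hfn
  obtain ⟨r, hr, hstep⟩ := step_eq_of_canExtend hs h
  have hmono := strictMonoOn_arc hinj
  rw [hstep]
  set P := I.arcInv (I.limit s) with hP
  have hf' : min (I.next s.front) P ∈ I.params :=
    ⟨le_min hnp.1 hP2.1, (min_le_left _ _).trans hnp.2⟩
  have hff' : s.front < min (I.next s.front) P := lt_min hfn hP1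
  refine ⟨?_, ?_, rfl, rfl, ?_⟩
  · refine hs.record hI (by have := hs.robots_le; omega) (Or.inr ⟨hr, rfl, rfl⟩) hff' hf'
      (min_le_left _ _) hng ?_
    have h1 : I.arc (min (I.next s.front) P) ≤ I.arc P := monotone_arc (min_le_right _ _)
    have h2 := h1.trans hP3
    rw [limit] at h2
    push_cast
    linarith
  · intro W hW
    have hW' : I.IsOrderedSolution s.budget W := hW
    obtain ⟨h1, h2⟩ := ha W hW'
    refine ⟨fun j hj w hw => (h1 j (hr ▸ hj) w hw).trans hff'.le, fun j hj w hw hlt => ?_⟩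
    obtain rfl : j = r := Nat.succ_injective hj
    have hlt : min (I.next s.front) P < w := hlt
    have h3 := h2 j hr w hw (hff'.trans hlt)
    have hjm : j < I.m := by have := hs.robots_le; omega
    have hwp := hW.mem j hjm w hw
    -- the points of `W j` that remain are fewer than before
    have hcard : ((W j).filter (min (I.next s.front) P < ·)).card + 1 ≤
        ((W j).filter (s.front < ·)).card := by
      rcases le_total (I.next s.front) P with hle | hle
      · rw [min_eq_left hle] at hlt ⊢
        obtain ⟨j', hj', w₀, hw₀, hlt₀, hle₀⟩ := hW'.exists_mem_le_next hI hs.front_le hgap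
        obtain rfl : j' = j := by
          rcases lt_trichotomy j' j with h4 | h4 | h4
          · exact absurd (h1 j' (by omega) w₀ hw₀) (not_le.2 hlt₀)
          · exact h4
          · exact absurd (hW.order j j' h4 hj' w hw w₀ hw₀) (not_le.2 (hle₀.trans_lt hlt))
        refine Finset.card_lt_card (Finset.ssubset_iff_of_subset ?_ |>.2 ⟨w₀, ?_, ?_⟩)
        · exact fun v hv => Finset.mem_filter.2 ⟨(Finset.mem_filter.1 hv).1,
            hfn.trans (Finset.mem_filter.1 hv).2⟩
        · exact Finset.mem_filter.2 ⟨hw₀, hlt₀⟩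
        · exact fun hv => absurd (Finset.mem_filter.1 hv).2 (not_lt.2 hle₀)
      · rw [min_eq_right hle] at hlt
        have h4 := hmono hP2 hwp hlt
        rw [hP4 w hwp hlt, limit] at h4
        have h5 : (1 : ℝ) ≤ ((W j).filter (s.front < ·)).card := by
          exact_mod_cast Finset.card_pos.2 ⟨w, Finset.mem_filter.2 ⟨hw, hP1.trans hlt⟩⟩
        have := mul_le_mul_of_nonneg_right h5 I.tm_pos.le
        linarith
    have hcard' : (((W j).filter (min (I.next s.front) P < ·)).card : ℝ) + 1 ≤
        ((W j).filter (s.front < ·)).card := by exact_mod_cast hcard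
    have := mul_le_mul_of_nonneg_right hcard' I.tm_pos.le
    change I.arc w ≤ I.arc s.start + s.budget -
      (((s.num + 1 : ℕ) : ℝ) + ((W j).filter (min (I.next s.front) P < ·)).card) * I.tm
    push_cast
    linarith
  · have hsub : V.filter (min (I.next s.front) P < ·) ⊆ V.filter (s.front < ·) := fun v hv =>
      Finset.mem_filter.2 ⟨(Finset.mem_filter.1 hv).1, hff'.trans (Finset.mem_filter.1 hv).2⟩
    rw [potential, potential, if_pos h]
    change (V.filter (min (I.next s.front) P < ·)).card + 2 * (I.m - (r + 1)) + _ < _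
    rw [← hr]
    rcases le_or_gt (I.next s.front) P with hle | hlt
    · obtain ⟨v, hv, hfv, hvn⟩ := exists_mem_le_next hI hs.front_le hgap hVp hV
      have : (V.filter (min (I.next s.front) P < ·)).card < (V.filter (s.front < ·)).card := by
        refine Finset.card_lt_card (Finset.ssubset_iff_of_subset hsub |>.2 ⟨v, ?_, ?_⟩)
        · exact Finset.mem_filter.2 ⟨hv, hfv⟩
        · exact fun hv => absurd (Finset.mem_filter.1 hv).2 (not_lt.2 (le_min hvn (hvn.trans hle)))
      split_ifs <;> omega
    · have := Finset.card_le_card hsub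
      rw [if_neg]
      · omega
      · rintro ⟨-, hc⟩
        change I.arc (min (I.next s.front) P) <
          I.arc s.start + s.budget - (((s.num + 1 : ℕ) : ℝ) + 1) * I.tm at hc
        rw [min_eq_right hlt.le, hP4 _ hnp hlt, limit] at hc
        push_cast at hc
        linarith [I.tm_pos]

/-- A step in which a new robot is placed. It stays ahead of an ordered solution, because the
first viewpoint of the solution that has not been passed before is passed now, and belongs to the
corresponding robot if that robot has viewpoints further on. -/
theorem step_open (hinj : InjOn I.curve I.params) (hI : I.ChainVisible) {V : Finset ℝ}
    (hV : ∀ x, I.InReg x → ∃ v ∈ V, v ∈ I.seeing x)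
    (hs : I.Valid s) (ha : I.Ahead s) (hgap : I.Gap s.front I.k) (h : ¬ I.CanExtend s)
    (hm : s.robots < I.m) :
    I.Valid (I.step s) ∧ I.Ahead (I.step s) ∧ (I.step s).budget = s.budget ∧
      (I.step s).cnt = s.cnt + 1 ∧ I.potential (I.step s) V < I.potential s V := by
  classical
  obtain ⟨hfn, hnp, hng, -⟩ := next_spec hI hs.front_le hV hgap
  rw [step_eq_of_lt h hm]
  refine ⟨?_, ?_, rfl, rfl, ?_⟩
  · refine hs.record hI hm (Or.inl ⟨rfl, rfl, rfl⟩) hfn hnp le_rfl hng ?_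
    have := hs.tm_le
    push_cast
    linarith
  · intro W hW
    have hW' : I.IsOrderedSolution s.budget W := hW
    have hold : ∀ j < s.robots, ∀ w ∈ W j, w ≤ s.front := fun j hj w hw =>
      ha.le_front hinj hs h hW' hj hw
    refine ⟨fun j hj w hw => (hold j (Nat.lt_of_succ_lt_succ hj) w hw).trans hfn.le,
      fun j hj w hw hlt => ?_⟩
    obtain rfl : j = s.robots := Nat.succ_injective hj
    have hlt : I.next s.front < w := hlt
    obtain ⟨j', hj', w₀, hw₀, hlt₀, hle₀⟩ := hW'.exists_mem_le_next hI hs.front_le hgap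
    obtain rfl : j' = s.robots := by
      rcases lt_trichotomy j' s.robots with h4 | h4 | h4
      · exact absurd (hold j' h4 w₀ hw₀) (not_le.2 hlt₀)
      · exact h4
      · exact absurd (hW.order _ j' h4 hj' w hw w₀ hw₀) (not_le.2 (hle₀.trans_lt hlt))
    have hcard : ((W s.robots).filter (I.next s.front < ·)).card + 1 ≤ (W s.robots).card :=
      Finset.card_lt_card (Finset.filter_ssubset.2 ⟨w₀, hw₀, not_lt.2 hle₀⟩)
    have hcard' : (((W s.robots).filter (I.next s.front < ·)).card : ℝ) + 1 ≤
        (W s.robots).card := by exact_mod_cast hcard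
    have h1 := mul_le_mul_of_nonneg_right hcard' I.tm_pos.le
    have h2 := hW'.cost _ hj' w hw w₀ hw₀
    have h3 : I.arc w₀ ≤ I.arc (I.next s.front) := monotone_arc hle₀
    change I.arc w ≤ I.arc (I.next s.front) + s.budget -
      (((1 : ℕ) : ℝ) + ((W s.robots).filter (I.next s.front < ·)).card) * I.tm
    push_cast
    linarith
  · have := Finset.card_le_card (show V.filter (I.next s.front < ·) ⊆ V.filter (s.front < ·) from
      fun v hv => Finset.mem_filter.2 ⟨(Finset.mem_filter.1 hv).1,
        hfn.trans (Finset.mem_filter.1 hv).2⟩)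
    rw [potential, potential, if_neg h]
    change (V.filter (I.next s.front < ·)).card + 2 * (I.m - (s.robots + 1)) + _ < _
    split_ifs <;> omega

/-- A step in which the budget is doubled. If the old budget sufficed for an ordered solution, all
its viewpoints would have been passed, although some point of the region is seen only from later
parameters. -/
theorem step_reset (hinj : InjOn I.curve I.params) {V : Finset ℝ}
    (hs : I.Valid s) (ha : I.Ahead s) (hgap : I.Gap s.front I.k) (h : ¬ I.CanExtend s)
    (hm : ¬ s.robots < I.m) :
    I.Valid (I.step s) ∧ I.Ahead (I.step s) ∧ (I.step s).budget = s.budget + s.budget ∧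
      (I.step s).cnt = 0 ∧ I.potential (I.step s) V ≤ V.card + 2 * I.m ∧
      ∀ S : I.Plan, S.IsFeasible → s.budget < S.maxCost + I.tm := by
  classical
  have hk : (0 : ℝ) ≤ (I.k : ℝ) - 1 := by rw [← cast_k_sub_one]; positivity
  have e1 : (I.step s).budget = s.budget + s.budget := by simp [step, newBudget, h, hm]
  have e2 : (I.step s).front = -1 := by simp [step, newFront, h, hm]
  have e3 : (I.step s).robots = 0 := by simp [step, newRobots, h, hm]
  have e4 : (I.step s).num = 0 := by simp [step, newNum, h, hm]
  have e5 : (I.step s).cnt = 0 := by simp [step, newCnt, h, hm]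
  refine ⟨?_, ?_, e1, e5, ?_, ?_⟩
  · constructor
    · rw [e1]; linarith [hs.tm_le, I.tm_pos]
    · rw [e3]; exact Nat.zero_le _
    · rw [e2]; linarith
    · exact fun _ => ⟨e2, e4, e5⟩
    · rw [e4, e5]
    · intro j hj; omega
    · intro j hj; omega
    · intro j hj; omega
    · intro x hx u hu hle
      rw [e2] at hle
      have := hu.1.1
      linarith
  · intro W hW
    exact ⟨fun j hj => by omega, fun j hj => by omega⟩
  · rw [potential, if_neg fun hc => by have := hc.1; omega, e3]
    have := Finset.card_filter_le V ((I.step s).front < ·)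
    omega
  · intro S hS
    by_contra! hle
    have hT : ∀ i, S.cost i ≤ s.budget - I.tm := fun i =>
      (le_ciSup (Set.finite_range S.cost).bddAbove i).trans (by rw [Plan.maxCost] at hle; linarith)
    obtain ⟨W, hW⟩ := exists_isOrderedSolution hinj hS hT
    rw [sub_add_cancel] at hW
    obtain ⟨x, hx, hx'⟩ := hgap
    obtain ⟨j, hj, w, hw, hwx⟩ := hW.sees x hx
    exact absurd (ha.le_front hinj hs h hW (by omega) hw) (not_le.2 (hx' w hwx).1)

end Instance
end Watchmen

/-! ### Correctness and progress of the search -/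

namespace Watchmen

/-- The first stage of the search. -/
noncomputable def Search.init (I : Instance) : Search where
  budget := I.tm
  front := -1
  start := 0
  robots := 0
  num := 0
  cnt := 0
  begins _ := 0
  lens _ := 0
  firsts _ := 0
  lasts _ := 0
  views _ := 0

namespace Instance

variable (I : Instance) (s : Search)

/-- The invariant of the search, for a hitting set `V`: the search is consistent and not behind
any solution, the budget is not too large, and it has been doubled at most `R` times. The number
`v` bounds the remaining number of steps. -/
structure Invariant (V : Finset ℝ) (R v : ℕ) : Prop where
  valid : I.Valid s
  ahead : I.Ahead s
  cnt_le : s.cnt + I.potential s V ≤ V.card + 2 * I.m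
  budget_le : ∀ S : I.Plan, S.IsFeasible → s.budget ≤ max I.tm (2 * (S.maxCost + I.tm))
  variant : ∃ q ≤ R, s.budget = I.tm * 2 ^ q ∧
    v = I.potential s V + (V.card + 2 * I.m + 1) * (R - q)

variable {I s}

/-- A step preserves the invariant. The doublings are bounded, because the budget before a doubling
is less than `S.maxCost + I.tm` for every feasible plan `S`. -/
theorem Invariant.step (hinj : InjOn I.curve I.params) (hI : I.ChainVisible) {V : Finset ℝ}
    (hVp : ∀ v ∈ V, v ∈ I.params) (hV : ∀ x, I.InReg x → ∃ v ∈ V, v ∈ I.seeing x) {R v : ℕ}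
    (hR : ∃ S : I.Plan, S.IsFeasible ∧ S.maxCost + I.tm ≤ I.tm * 2 ^ R)
    (h : I.Invariant s V R v) (hgap : I.Gap s.front I.k) :
    ∃ v' < v, I.Invariant (I.step s) V R v' := by
  obtain ⟨q, hq, hb, hv⟩ := h.variant
  have hcnt := h.cnt_le
  by_cases hcase : I.CanExtend s ∨ s.robots < I.m
  · obtain ⟨h1, h2, h3, h4, h5⟩ : I.Valid (I.step s) ∧ I.Ahead (I.step s) ∧
        (I.step s).budget = s.budget ∧ (I.step s).cnt = s.cnt + 1 ∧
        I.potential (I.step s) V < I.potential s V := by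
      by_cases hc : I.CanExtend s
      · exact step_advance hinj hI hVp hV h.valid h.ahead hgap hc
      · exact step_open hinj hI hV h.valid h.ahead hgap hc (hcase.resolve_left hc)
    refine ⟨_, ?_, h1, h2, ?_, ?_, q, hq, h3.trans hb, rfl⟩
    · omega
    · omega
    · exact fun S hS => h3 ▸ h.budget_le S hS
  · rw [not_or] at hcase
    obtain ⟨h1, h2, h3, h4, h5, h6⟩ := step_reset (V := V) hinj h.valid h.ahead hgap hcase.1 hcase.2
    obtain ⟨S, hS, hSR⟩ := hR
    have hqR : q < R := by
      have h7 := (h6 S hS).trans_le hSR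
      rw [hb] at h7
      exact (pow_lt_pow_iff_right₀ one_lt_two).1 (lt_of_mul_lt_mul_left h7 I.tm_pos.le)
    refine ⟨_, ?_, h1, h2, ?_, ?_, q + 1, hqR, ?_, rfl⟩
    · obtain ⟨e, he⟩ : ∃ e, R - q = e + 1 := ⟨R - q - 1, by omega⟩
      rw [hv, he, show R - (q + 1) = e by omega, Nat.mul_succ]
      omega
    · omega
    · intro S hS
      have := h6 S hS
      refine le_max_of_le_right ?_
      rw [h3]
      linarith
    · rw [h3, hb, pow_succ]
      ring

theorem invariant_init {V : Finset ℝ} {R : ℕ} :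
    ∃ v ≤ (V.card + 2 * I.m + 1) * (R + 1), I.Invariant (Search.init I) V R v := by
  have hk : (0 : ℝ) ≤ (I.k : ℝ) - 1 := by rw [← cast_k_sub_one]; positivity
  have hpot : I.potential (Search.init I) V ≤ V.card + 2 * I.m := by
    rw [potential, if_neg fun hc => absurd hc.1 (lt_irrefl 0)]
    have := Finset.card_filter_le V ((Search.init I).front < ·)
    change _ + 2 * I.m + 0 ≤ _
    omega
  refine ⟨_, ?_, ⟨⟨le_rfl, Nat.zero_le _, ?_, fun _ => ⟨rfl, rfl, rfl⟩, le_rfl, ?_, ?_, ?_, ?_⟩,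
    ?_, ?_, fun S _ => le_max_left _ _, 0, Nat.zero_le _, ?_, rfl⟩⟩
  · rw [Nat.sub_zero, Nat.mul_succ]
    omega
  · change (-1 : ℝ) ≤ _
    linarith
  · exact fun j hj => absurd hj (Nat.succ_ne_zero _)
  · exact fun j hj => absurd hj (Nat.not_lt_zero _)
  · exact fun j hj => absurd hj (Nat.not_lt_zero _)
  · intro x hx u hu hle
    have : u ≤ -1 := hle
    linarith [hu.1.1]
  · exact fun W _ => ⟨fun j hj => absurd hj (Nat.not_lt_zero _),
      fun j hj => absurd hj (Nat.succ_ne_zero _)⟩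
  · change 0 + _ ≤ _
    omega
  · change I.tm = _
    simp

/-- When the search has passed all points, the recorded paths of the robots in use, together with
empty paths for the other robots, are a solution within the budget. -/
theorem Valid.isFeasible (hs : I.Valid s) (hgap : ¬ I.Gap s.front I.k)
    {S : I.Plan} (h₁ : ∀ i : Fin I.m, (i : ℕ) < s.robots → S.first i = s.firsts i ∧
      S.last i = s.lasts i ∧
      S.views i = (Finset.range (s.lens i)).image fun l => s.views (s.begins i + l))
    (h₂ : ∀ i : Fin I.m, ¬ (i : ℕ) < s.robots → S.first i = 0 ∧ S.last i = 0 ∧ S.views i = ∅) :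
    S.IsFeasible ∧ S.maxCost ≤ s.budget := by
  have hk : (0 : ℝ) ≤ (I.k : ℝ) - 1 := by rw [← cast_k_sub_one]; positivity
  have hpath : ∀ i, S.first i ∈ I.params ∧ S.last i ∈ I.params ∧ S.first i ≤ S.last i ∧
      (S.views i : Set ℝ) ⊆ Icc (S.first i) (S.last i) := by
    intro i
    by_cases hi : (i : ℕ) < s.robots
    · obtain ⟨e1, e2, e3⟩ := h₁ i hi
      obtain ⟨p1, p2, p3, -⟩ := hs.paths i hi
      rw [e1, e2, e3]
      refine ⟨⟨p1, p2.trans p3⟩, ⟨p1.trans p2, p3⟩, p2, fun v hv => ?_⟩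
      obtain ⟨l, hl, rfl⟩ := Finset.mem_image.1 (Finset.mem_coe.1 hv)
      exact (hs.blocks i hi).2 l (Finset.mem_range.1 hl)
    · obtain ⟨e1, e2, e3⟩ := h₂ i hi
      rw [e1, e2, e3]
      exact ⟨⟨le_rfl, hk⟩, ⟨le_rfl, hk⟩, le_rfl, by simp⟩
  have hfeas : S.IsFeasible := by
    refine ⟨hpath, (seesAll_iff ?_).2 fun x hx => ?_⟩
    · intro v hv
      obtain ⟨i, hi⟩ := mem_iUnion.1 hv
      obtain ⟨q1, q2, -, q3⟩ := hpath i
      exact ⟨q1.1.trans (q3 hi).1, (q3 hi).2.trans q2.2⟩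
    · obtain ⟨u, hu, huf⟩ : ∃ u ∈ I.seeing x, u ≤ s.front := by
        by_contra! hno
        exact hgap ⟨x, hx, fun u hu => ⟨hno u hu, by linarith [hu.1.2]⟩⟩
      obtain ⟨j, hj, l, hl, hv⟩ := hs.sees x hx u hu huf
      refine ⟨_, mem_iUnion.2 ⟨⟨j, hj.trans_le hs.robots_le⟩, ?_⟩, hv⟩
      rw [(h₁ ⟨j, hj.trans_le hs.robots_le⟩ hj).2.2]
      exact Finset.mem_coe.2 (Finset.mem_image_of_mem _ (Finset.mem_range.2 hl))
  refine ⟨hfeas, ciSup_le fun i => ?_⟩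
  rw [Plan.cost, Plan.length_eq hfeas]
  by_cases hi : (i : ℕ) < s.robots
  · obtain ⟨e1, e2, e3⟩ := h₁ i hi
    have h3 : ((S.views i).card : ℝ) ≤ s.lens i := by
      rw [e3]
      exact_mod_cast Finset.card_image_le.trans (Finset.card_range _).le
    have h4 := mul_le_mul_of_nonneg_right h3 I.tm_pos.le
    have h5 := (hs.paths i hi).2.2.2
    rw [e1, e2]
    linarith
  · obtain ⟨e1, e2, e3⟩ := h₂ i hi
    rw [e1, e2, e3]
    have := hs.tm_le
    have := I.tm_pos
    simp
    linarith

theorem exists_inReg : ∃ x, I.InReg x := by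
  have hmem : I.polygon 0 ∈ I.P := by
    refine Or.inl (mem_iUnion.2 ⟨0, ?_⟩)
    rw [Polygon.edgeSet]
    exact left_mem_affineSegment ℝ _ _
  exact ⟨_, (I.mem_P_iff _).1 hmem⟩

theorem Plan.tm_le_maxCost {S : I.Plan} (hS : S.IsFeasible) : I.tm ≤ S.maxCost := by
  obtain ⟨x, hx⟩ := exists_inReg (I := I)
  obtain ⟨v, hv, -⟩ := hS.2 (toPlane x) (by rwa [mem_P_iff, coords_toPlane])
  obtain ⟨i, hi⟩ := mem_iUnion.1 hv
  have h1 : (1 : ℝ) ≤ (S.views i).card := by exact_mod_cast Finset.card_pos.2 ⟨v, hi⟩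
  have h2 : S.cost i ≤ S.maxCost := le_ciSup (Set.finite_range S.cost).bddAbove i
  have h3 : 0 ≤ S.length i := ENNReal.toReal_nonneg
  have h4 := mul_le_mul_of_nonneg_right h1 I.tm_pos.le
  rw [Plan.cost] at h2
  linarith

/-- Finitely many viewpoints that see everything form a solution. -/
theorem exists_isFeasible {V : Finset ℝ} (hVp : ∀ v ∈ V, v ∈ I.params) (hV : I.SeesAll V) :
    ∃ S : I.Plan, S.IsFeasible := by
  have hk : (0 : ℝ) ≤ (I.k : ℝ) - 1 := by rw [← cast_k_sub_one]; positivity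
  refine ⟨⟨fun _ => 0, fun _ => (I.k : ℝ) - 1, fun _ => V⟩,
    fun i => ⟨⟨le_rfl, hk⟩, ⟨hk, le_rfl⟩, hk, fun v hv => hVp v hv⟩, fun x hx => ?_⟩
  obtain ⟨v, hv, hvx⟩ := hV x hx
  exact ⟨v, mem_iUnion.2 ⟨0, hv⟩, hvx⟩

theorem tm_le_optCost (h : ∃ S : I.Plan, S.IsFeasible) : I.tm ≤ I.optCost := by
  obtain ⟨S, hS⟩ := h
  rw [optCost]
  refine le_csInf ⟨S.maxCost, S, hS, rfl⟩ ?_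
  rintro _ ⟨S, hS, rfl⟩
  exact Plan.tm_le_maxCost hS

theorem exists_maxCost_lt (h : ∃ S : I.Plan, S.IsFeasible) {c : ℝ} (hc : I.optCost < c) :
    ∃ S : I.Plan, S.IsFeasible ∧ S.maxCost < c := by
  obtain ⟨S, hS⟩ := h
  obtain ⟨_, ⟨S, hS, rfl⟩, hlt⟩ := exists_lt_of_csInf_lt
    (s := {c | ∃ S : I.Plan, S.IsFeasible ∧ S.maxCost = c}) ⟨S.maxCost, S, hS, rfl⟩ hc
  exact ⟨S, hS, hlt⟩

/-- The optimal cost need not be attained for this bound: the budget is at most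
`2 * (S.maxCost + tm)` for all feasible plans `S`, and `tm` is at most the optimal cost. -/
theorem Invariant.budget_le_optCost (h : ∃ S : I.Plan, S.IsFeasible) {V : Finset ℝ} {R v : ℕ}
    (hs : I.Invariant s V R v) : s.budget ≤ 4 * I.optCost := by
  have h1 := tm_le_optCost h
  refine le_of_forall_pos_le_add fun ε hε => ?_
  obtain ⟨S, hS, hlt⟩ := exists_maxCost_lt h (c := I.optCost + ε / 2) (by linarith)
  refine (hs.budget_le S hS).trans (max_le ?_ ?_) <;> linarith [I.tm_pos]

/-- The number of doublings needed. -/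
theorem exists_maxCost_add_le (h : ∃ S : I.Plan, S.IsFeasible) :
    ∃ S : I.Plan, S.IsFeasible ∧
      S.maxCost + I.tm ≤ I.tm * 2 ^ (⌊Real.logb 2 (I.optCost / I.tm)⌋₊ + 2) := by
  have h1 := tm_le_optCost h
  have h2 := I.tm_pos
  have h3 : 0 < I.optCost / I.tm := div_pos (h2.trans_le h1) h2
  have h4 : I.optCost / I.tm < 2 ^ (⌊Real.logb 2 (I.optCost / I.tm)⌋₊ + 1) := by
    have h5 := Nat.lt_floor_add_one (Real.logb 2 (I.optCost / I.tm))
    rw [Real.logb_lt_iff_lt_rpow one_lt_two h3] at h5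
    exact_mod_cast h5
  rw [div_lt_iff₀ h2] at h4
  obtain ⟨S, hS, hlt⟩ := exists_maxCost_lt h h4
  refine ⟨S, hS, ?_⟩
  have h6 := Plan.tm_le_maxCost hS
  have h7 : I.tm * 2 ^ (⌊Real.logb 2 (I.optCost / I.tm)⌋₊ + 2) =
      2 * (2 ^ (⌊Real.logb 2 (I.optCost / I.tm)⌋₊ + 1) * I.tm) := by ring
  rw [h7]
  linarith

end Instance
end Watchmen

/-! ### Programs for the geometric tests -/

namespace RealRAM

open Watchmen

variable {α : Type} {Λ : Layout α} {f g h : α → ℝ} {φ ψ : α → Prop} {M N : α → ℕ}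

theorem NC.congr (hM : NC Λ M) (hMN : ∀ a, M a = N a) : NC Λ N := by
  have : M = N := funext hMN
  exact this ▸ hM

theorem RC.max (hf : RC Λ f) (hg : RC Λ g) : RC Λ (fun a => max (f a) (g a)) := by
  classical
  exact (RC.ite (BC.le hf hg) hg hf).congr fun a => by rw [max_def]

theorem RC.min (hf : RC Λ f) (hg : RC Λ g) : RC Λ (fun a => min (f a) (g a)) := by
  classical
  exact (RC.ite (BC.le hf hg) hf hg).congr fun a => by rw [min_def]

theorem RC.foldMax {F : α → ℕ → ℝ} (hN : NC Λ N) (hf : RC Λ f)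
    (hF : ∀ x, RC (Λ.natExt x N) (fun p => F p.1 p.2)) :
    RC Λ (fun a => (Finset.range (N a)).fold Max.max (f a) (F a)) := by
  refine (RC.fold (step := fun a j acc => Max.max (F a j) acc) hN hf fun x y =>
    ((hF x).realExt y).max (RC.snd _ y)).congr fun a => ?_
  induction N a with
  | zero => simp
  | succ n ih => rw [Finset.range_add_one, Finset.fold_insert Finset.notMem_range_self, ← ih]

theorem BC.odd_card_filter {Q : α → ℕ → Prop} [∀ a, DecidablePred (Q a)] (hN : NC Λ N)
    (hQ : ∀ x, BC (Λ.natExt x N) (fun p => Q p.1 p.2)) :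
    BC Λ (fun a => Odd ((Finset.range (N a)).filter (Q a)).card) := by
  classical
  refine (RC.fold (step := fun a j acc => if Q a j then 1 - acc else acc) hN (RC.zero Λ)
    fun x y => RC.ite (BC.realExt (hQ x) y) ((RC.one _).sub (RC.snd _ y)) (RC.snd _ y)).congr
    fun a => ?_
  have key : ∀ n : ℕ, (Nat.rec 0 (fun j acc => if Q a j then 1 - acc else acc) n : ℝ) =
      if Odd ((Finset.range n).filter (Q a)).card then 1 else 0 := by
    intro n
    induction n with
    | zero => simp
    | succ n ih =>
      simp only [ih, Finset.range_add_one, Finset.filter_insert]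
      by_cases hq : Q a n
      · rw [if_pos hq, if_pos hq, Finset.card_insert_of_notMem (by simp)]
        by_cases ho : Odd ((Finset.range n).filter (Q a)).card
        · simp [ho, Nat.odd_add_one]
        · simp [ho, Nat.odd_add_one]
      · rw [if_neg hq, if_neg hq]
  exact (key (N a)).trans (by congr)

/-- Computability of a point of the plane, given by its coordinates. -/
def PC (Λ : Layout α) (p : α → ℝ × ℝ) : Prop := RC Λ (fun a => (p a).1) ∧ RC Λ (fun a => (p a).2)

/-- Computability of an affine form, given by its coefficients. -/
def FC (Λ : Layout α) (c : α → ℝ × ℝ × ℝ) : Prop :=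
  RC Λ (fun a => (c a).1) ∧ RC Λ (fun a => (c a).2.1) ∧ RC Λ (fun a => (c a).2.2)

/-- Computability of an index of an arrangement. -/
def IC (Λ : Layout α) (i : α → ℕ × ℕ × ℕ) : Prop :=
  NC Λ (fun a => (i a).1) ∧ NC Λ (fun a => (i a).2.1) ∧ NC Λ (fun a => (i a).2.2)

/-- The layout extended by an index of an arrangement. -/
abbrev Layout.idxExt (Λ : Layout α) (x y z : ℕ) : Layout (((α × ℕ) × ℕ) × ℕ) :=
  ((Λ.natExt x fun _ => 3).natExt y fun p => (Λ.inst p.1).nf).natExt z fun p => (Λ.inst p.1.1).nf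

variable {p q r : α → ℝ × ℝ} {c d e : α → ℝ × ℝ × ℝ} {i j : α → ℕ × ℕ × ℕ}

theorem PC.natExt (hp : PC Λ p) (x : ℕ) (N : α → ℕ) : PC (Λ.natExt x N) (fun a => p a.1) :=
  ⟨hp.1.natExt x N, hp.2.natExt x N⟩

theorem NC.nf (Λ : Layout α) : NC Λ (fun a => (Λ.inst a).nf) :=
  (((NC.n Λ).add (NC.n Λ)).add (NC.n Λ)).add (NC.const Λ 1)

theorem RC.idxExt (hf : RC Λ f) (x y z : ℕ) : RC (Λ.idxExt x y z) (fun a => f a.1.1.1) :=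
  ((hf.natExt x _).natExt y _).natExt z _

theorem NC.idxExt (hM : NC Λ M) (x y z : ℕ) : NC (Λ.idxExt x y z) (fun a => M a.1.1.1) :=
  ((hM.natExt x _).natExt y _).natExt z _

theorem PC.idxExt (hp : PC Λ p) (x y z : ℕ) : PC (Λ.idxExt x y z) (fun a => p a.1.1.1) :=
  ((hp.natExt x _).natExt y _).natExt z _

theorem IC.idxExt (hi : IC Λ i) (x y z : ℕ) : IC (Λ.idxExt x y z) (fun a => i a.1.1.1) :=
  ⟨hi.1.idxExt x y z, hi.2.1.idxExt x y z, hi.2.2.idxExt x y z⟩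

theorem IC.snd (Λ : Layout α) (x y z : ℕ) :
    IC (Λ.idxExt x y z) (fun a => (a.1.1.2, a.1.2, a.2)) :=
  ⟨((NC.snd x (NC.const Λ 3)).natExt y _).natExt z _,
    (NC.snd y (NC.nf (Λ.natExt x fun _ => 3))).natExt z _,
    NC.snd z (NC.nf ((Λ.natExt x fun _ => 3).natExt y fun p => (Λ.inst p.1).nf))⟩

theorem BC.existsIdx {Q : α → ℕ × ℕ × ℕ → Prop}
    (hQ : ∀ x y z, BC (Λ.idxExt x y z) (fun a => Q a.1.1.1 (a.1.1.2, a.1.2, a.2))) :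
    BC Λ (fun a => ∃ i ∈ (Λ.inst a).idx, Q a i) := by
  refine BC.congr (BC.exists (Q := fun a u => ∃ v < (Λ.inst a).nf, ∃ w < (Λ.inst a).nf,
    Q a (u, v, w)) (NC.const Λ 3) fun x => BC.exists
      (Q := fun (p : α × ℕ) v => ∃ w < (Λ.inst p.1).nf, Q p.1 (p.2, v, w))
      (NC.nf (Λ.natExt x fun _ => 3))
      fun y => BC.exists (Q := fun (p : (α × ℕ) × ℕ) w => Q p.1.1 (p.1.2, p.2, w))
        (NC.nf ((Λ.natExt x fun _ => 3).natExt y fun p => (Λ.inst p.1).nf)) fun z => hQ x y z)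
    fun a => ?_
  constructor
  · rintro ⟨u, hu, v, hv, w, hw, hq⟩
    exact ⟨(u, v, w), (Instance.mem_idx _).2 ⟨hu, hv, hw⟩, hq⟩
  · rintro ⟨⟨u, v, w⟩, hi, hq⟩
    obtain ⟨hu, hv, hw⟩ := (Instance.mem_idx _).1 hi
    exact ⟨u, hu, v, hv, w, hw, hq⟩

theorem RC.maxIdx {F : α → ℕ × ℕ × ℕ → ℝ} (hf : RC Λ f)
    (hF : ∀ x y z i, IC (Λ.idxExt x y z) i →
      RC (Λ.idxExt x y z) (fun a => F a.1.1.1 (i a))) :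
    RC Λ (fun a => (Λ.inst a).maxIdx (f a) (F a)) :=
  RC.foldMax (NC.const Λ 3) hf fun x =>
    RC.foldMax (NC.nf (Λ.natExt x fun _ => 3)) (hf.natExt x _) fun y =>
      RC.foldMax (NC.nf ((Λ.natExt x fun _ => 3).natExt y fun p => (Λ.inst p.1).nf))
        ((hf.natExt x _).natExt y _) fun z =>
          hF x y z _ (IC.snd Λ x y z)

theorem RC.vx (hM : NC Λ M) : RC Λ (fun a => (Λ.inst a).vx (M a)) := RC.load (A := 0) (by omega) hM

theorem RC.vy (hM : NC Λ M) : RC Λ (fun a => (Λ.inst a).vy (M a)) := RC.load (A := 1) (by omega) hM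

theorem RC.cx (hM : NC Λ M) : RC Λ (fun a => (Λ.inst a).cx (M a)) := RC.load (A := 2) (by omega) hM

theorem RC.cy (hM : NC Λ M) : RC Λ (fun a => (Λ.inst a).cy (M a)) := RC.load (A := 3) (by omega) hM

theorem NC.nxt (hM : NC Λ M) : NC Λ (fun a => (Λ.inst a).nxt (M a)) := by
  classical
  exact NC.ite (BC.natLt (hM.add (NC.const Λ 1)) (NC.n Λ)) (hM.add (NC.const Λ 1))
    (NC.const Λ 0)

theorem FC.ite [∀ a, Decidable (φ a)] (hφ : BC Λ φ) (hc : FC Λ c) (hd : FC Λ d) :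
    FC Λ (fun a => if φ a then c a else d a) :=
  ⟨(RC.ite hφ hc.1 hd.1).congr fun a => by dsimp only; split_ifs <;> rfl,
    (RC.ite hφ hc.2.1 hd.2.1).congr fun a => by dsimp only; split_ifs <;> rfl,
    (RC.ite hφ hc.2.2 hd.2.2).congr fun a => by dsimp only; split_ifs <;> rfl⟩

theorem FC.congr (hc : FC Λ c) (hcd : ∀ a, c a = d a) : FC Λ d := by
  have : c = d := funext hcd
  exact this ▸ hc

theorem FC.form (hM : NC Λ M) : FC Λ (fun a => (Λ.inst a).form (M a)) := by
  classical
  have hn := NC.n Λ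
  have hx := RC.vx hM
  have hy := RC.vy hM
  have hx' := RC.vx hM.nxt
  have hy' := RC.vy hM.nxt
  refine (FC.ite (BC.natLt hM hn)
    (c := fun a => ((Λ.inst a).vy (M a) - (Λ.inst a).vy ((Λ.inst a).nxt (M a)),
      (Λ.inst a).vx ((Λ.inst a).nxt (M a)) - (Λ.inst a).vx (M a),
      ((Λ.inst a).vy ((Λ.inst a).nxt (M a)) - (Λ.inst a).vy (M a)) * (Λ.inst a).vx (M a) -
        ((Λ.inst a).vx ((Λ.inst a).nxt (M a)) - (Λ.inst a).vx (M a)) * (Λ.inst a).vy (M a)))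
    ⟨hy.sub hy', hx'.sub hx, ((hy'.sub hy).mul hx).sub ((hx'.sub hx).mul hy)⟩
    (FC.ite (BC.natLt hM (hn.add hn))
      (c := fun a => (1, 0, -(Λ.inst a).vx (M a - (Λ.inst a).n)))
      ⟨RC.one Λ, RC.zero Λ, (RC.vx (hM.sub hn)).neg⟩
      (FC.ite (BC.natLt hM ((hn.add hn).add hn))
        (c := fun a => (0, 1, -(Λ.inst a).vy (M a - ((Λ.inst a).n + (Λ.inst a).n))))
        (d := fun _ => (0, 0, 1))
        ⟨RC.zero Λ, RC.one Λ, (RC.vy (hM.sub (hn.add hn))).neg⟩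
        ⟨RC.zero Λ, RC.zero Λ, RC.one Λ⟩))).congr fun a => ?_
  simp only [Instance.form]

theorem RC.ev (hc : FC Λ c) (hp : PC Λ p) : RC Λ (fun a => ev (c a) (p a)) :=
  ((hc.1.mul hp.1).add (hc.2.1.mul hp.2)).add hc.2.2

theorem PC.segPt (hp : PC Λ p) (hq : PC Λ q) (hf : RC Λ f) :
    PC Λ (fun a => segPt (p a) (q a) (f a)) :=
  ⟨(((RC.one Λ).sub hf).mul hp.1).add (hf.mul hq.1),
    (((RC.one Λ).sub hf).mul hp.2).add (hf.mul hq.2)⟩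

theorem BC.onEdge (hM : NC Λ M) (hp : PC Λ p) :
    BC Λ (fun a => (Λ.inst a).OnEdge (M a) (p a)) := by
  have hx := RC.vx hM
  have hy := RC.vy hM
  have hx' := RC.vx hM.nxt
  have hy' := RC.vy hM.nxt
  exact (BC.eq (RC.ev (FC.form hM) hp) (RC.zero Λ)).and
    ((((BC.le hx hp.1).and (BC.le hp.1 hx')).or ((BC.le hx' hp.1).and (BC.le hp.1 hx))).and
      (((BC.le hy hp.2).and (BC.le hp.2 hy')).or ((BC.le hy' hp.2).and (BC.le hp.2 hy))))

theorem BC.crosses (hM : NC Λ M) (hp : PC Λ p) :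
    BC Λ (fun a => (Λ.inst a).Crosses (M a) (p a)) := by
  have hy := RC.vy hM
  have hy' := RC.vy hM.nxt
  have he := RC.ev (FC.form hM) hp
  exact ((BC.le hy hp.2).and ((BC.lt hp.2 hy').and (BC.lt (RC.zero Λ) he))).or
    ((BC.le hy' hp.2).and ((BC.lt hp.2 hy).and (BC.lt he (RC.zero Λ))))

theorem BC.inReg (hp : PC Λ p) : BC Λ (fun a => (Λ.inst a).InReg (p a)) := by
  classical
  have hn := NC.n Λ
  refine ((BC.exists (Q := fun a i => (Λ.inst a).OnEdge i (p a)) hn fun x =>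
      BC.onEdge (Λ := Λ.natExt x _) (NC.snd x hn) (hp.natExt x _)).or
    (BC.odd_card_filter (Q := fun a i => (Λ.inst a).Crosses i (p a)) hn fun x =>
      BC.crosses (Λ := Λ.natExt x _) (NC.snd x hn) (hp.natExt x _))).congr fun a => ?_
  rw [Instance.InReg]

theorem RC.startVal (hp : PC Λ p) (hM : NC Λ M) :
    RC Λ (fun a => (Λ.inst a).startVal (p a) (M a)) := by
  classical
  exact (RC.ite (BC.natLt hM (NC.nf Λ)) (RC.ev (FC.form hM) hp)
    (RC.ite (BC.natLt hM ((NC.nf Λ).add (NC.const Λ 1))) (RC.zero Λ) (RC.one Λ))).congr fun a => by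
      simp only [Instance.startVal]

theorem RC.endVal (hp : PC Λ p) (hM : NC Λ M) :
    RC Λ (fun a => (Λ.inst a).endVal (p a) (M a)) := by
  classical
  exact (RC.ite (BC.natLt hM (NC.nf Λ)) (RC.ev (FC.form hM) hp)
    (RC.ite (BC.natLt hM ((NC.nf Λ).add (NC.const Λ 1))) (RC.one Λ) (RC.zero Λ))).congr fun a => by
      simp only [Instance.endVal]

theorem RC.clampPt (hp : PC Λ p) (hq : PC Λ q) (hM : NC Λ M) :
    RC Λ (fun a => (Λ.inst a).clampPt (p a) (q a) (M a)) :=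
  (RC.zero Λ).max ((RC.one Λ).min
    ((RC.startVal hp hM).div ((RC.startVal hp hM).sub (RC.endVal hq hM))))

theorem BC.vis (hp : PC Λ p) (hq : PC Λ q) : BC Λ (fun a => (Λ.inst a).Vis (p a) (q a)) := by
  have hN := (NC.nf Λ).add (NC.const Λ 2)
  refine (BC.forall (Q := fun a u => ∀ v < (Λ.inst a).nf + 2, (Λ.inst a).InReg (segPt (p a) (q a)
    (((Λ.inst a).clampPt (p a) (q a) u + (Λ.inst a).clampPt (p a) (q a) v) / 2))) hN fun x =>
      BC.forall (Q := fun b v => (Λ.inst b.1).InReg (segPt (p b.1) (q b.1)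
        (((Λ.inst b.1).clampPt (p b.1) (q b.1) b.2 +
          (Λ.inst b.1).clampPt (p b.1) (q b.1) v) / 2))) (hN.natExt x _) fun y => ?_).congr
    fun a => ((Λ.inst a).vis_iff (p a) (q a)).symm
  have hp' := (hp.natExt x fun a => (Λ.inst a).nf + 2).natExt y fun b => (Λ.inst b.1).nf + 2
  have hq' := (hq.natExt x fun a => (Λ.inst a).nf + 2).natExt y fun b => (Λ.inst b.1).nf + 2
  exact BC.inReg (PC.segPt hp' hq' (((RC.clampPt hp' hq' ((NC.snd x hN).natExt y _)).add
    (RC.clampPt hp' hq' (NC.snd y (hN.natExt x _)))).div (RC.const _ 2)))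

theorem RC.clamp01 (hf : RC Λ f) : RC Λ (fun a => clamp01 (f a)) :=
  (RC.zero Λ).max ((RC.one Λ).min hf)

theorem RC.ramp {w : α → ℕ → ℝ} (hN : NC Λ N)
    (hw : ∀ x, RC (Λ.natExt x N) (fun b => w b.1 b.2)) (hf : RC Λ f) :
    RC Λ (fun a => ramp (N a) (w a) (f a)) :=
  RC.sum hN fun x => (hw x).mul ((hf.natExt x N).sub (RC.natCast (NC.snd x hN))).clamp01

theorem PC.cpt (hf : RC Λ f) : PC Λ (fun a => (Λ.inst a).cpt (f a)) := by
  have hN := (NC.k Λ).sub (NC.const Λ 1)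
  constructor
  · exact (RC.cx (NC.const Λ 0)).add (RC.ramp hN (fun x =>
      (RC.cx (Λ := Λ.natExt x _) ((NC.snd x hN).add (NC.const _ 1))).sub
        (RC.cx (Λ := Λ.natExt x _) (NC.snd x hN))) hf)
  · exact (RC.cy (NC.const Λ 0)).add (RC.ramp hN (fun x =>
      (RC.cy (Λ := Λ.natExt x _) ((NC.snd x hN).add (NC.const _ 1))).sub
        (RC.cy (Λ := Λ.natExt x _) (NC.snd x hN))) hf)

theorem RC.edgeLen (hM : NC Λ M) : RC Λ (fun a => (Λ.inst a).edgeLen (M a)) := by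
  have hx := (RC.cx (hM.add (NC.const Λ 1))).sub (RC.cx hM)
  have hy := (RC.cy (hM.add (NC.const Λ 1))).sub (RC.cy hM)
  exact ((hx.mul hx).add (hy.mul hy)).sqrt.congr fun a => by rw [Instance.edgeLen, sq, sq]

theorem RC.arc (hf : RC Λ f) : RC Λ (fun a => (Λ.inst a).arc (f a)) := by
  have hN := (NC.k Λ).sub (NC.const Λ 1)
  exact RC.ramp hN (fun x => RC.edgeLen (Λ := Λ.natExt x _) (NC.snd x hN)) hf

theorem RC.arcInv (hf : RC Λ f) : RC Λ (fun a => (Λ.inst a).arcInv (f a)) := by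
  have hN := (NC.k Λ).sub (NC.const Λ 1)
  exact RC.sum hN fun x => ((hf.natExt x _).sub (RC.sum (NC.snd x hN) fun y =>
    RC.edgeLen (Λ := (Λ.natExt x _).natExt y _) (NC.snd y (NC.snd x hN)))).div
      (RC.edgeLen (Λ := Λ.natExt x _) (NC.snd x hN)) |>.clamp01

theorem BC.mem_seeing (hf : RC Λ f) (hp : PC Λ p) :
    BC Λ (fun a => f a ∈ (Λ.inst a).seeing (p a)) :=
  ((BC.le (RC.zero Λ) hf).and (BC.le hf ((RC.natCast (NC.k Λ)).sub (RC.one Λ)))).and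
    (BC.vis (PC.cpt hf) hp)

theorem FC.pairCoef (hM : NC Λ M) (hN : NC Λ N) (hp : PC Λ p) :
    FC Λ (fun a => (Λ.inst a).pairCoef (M a) (N a) (p a)) := by
  have h1 := FC.form hM
  have h2 := FC.form hN
  have e1 := RC.ev h1 hp
  have e2 := RC.ev h2 hp
  exact ⟨(e2.mul h1.1).sub (e1.mul h2.1), (e2.mul h1.2.1).sub (e1.mul h2.2.1),
    (e2.mul h1.2.2).sub (e1.mul h2.2.2)⟩

theorem FC.arr (hp : PC Λ p) (hq : PC Λ q) (hi : IC Λ i) :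
    FC Λ (fun a => (Λ.inst a).arr (p a) (q a) (i a)) := by
  classical
  exact (FC.ite (BC.natEq hi.1 (NC.const Λ 0)) (FC.form hi.2.1)
    (FC.ite (BC.natEq hi.1 (NC.const Λ 1)) (FC.pairCoef hi.2.1 hi.2.2 hp)
      (FC.pairCoef hi.2.1 hi.2.2 hq))).congr fun a => by simp only [Instance.arr]

theorem RC.det2 (hc : FC Λ c) (hd : FC Λ d) : RC Λ (fun a => det2 (c a) (d a)) :=
  (hc.1.mul hd.2.1).sub (hc.2.1.mul hd.1)

theorem RC.det3 (hc : FC Λ c) (hd : FC Λ d) (he : FC Λ e) :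
    RC Λ (fun a => det3 (c a) (d a) (e a)) :=
  ((hc.1.mul ((hd.2.1.mul he.2.2).sub (hd.2.2.mul he.2.1))).sub
    (hc.2.1.mul ((hd.1.mul he.2.2).sub (hd.2.2.mul he.1)))).add
    (hc.2.2.mul ((hd.1.mul he.2.1).sub (hd.2.1.mul he.1)))

theorem PC.meet (hc : FC Λ c) (hd : FC Λ d) : PC Λ (fun a => meet (c a) (d a)) :=
  ⟨((hc.2.1.mul hd.2.2).sub (hc.2.2.mul hd.2.1)).div (RC.det2 hc hd),
    ((hc.2.2.mul hd.1).sub (hc.1.mul hd.2.2)).div (RC.det2 hc hd)⟩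

theorem PC.avg4 {p₁ p₂ p₃ p₄ : α → ℝ × ℝ} (h₁ : PC Λ p₁) (h₂ : PC Λ p₂) (h₃ : PC Λ p₃)
    (h₄ : PC Λ p₄) : PC Λ (fun a => avg4 (p₁ a) (p₂ a) (p₃ a) (p₄ a)) :=
  ⟨(((h₁.1.add h₂.1).add h₃.1).add h₄.1).div (RC.const Λ 4),
    (((h₁.2.add h₂.2).add h₃.2).add h₄.2).div (RC.const Λ 4)⟩

theorem RC.edgeRoot (hM : NC Λ M) (hf : RC Λ f) (hg : RC Λ g) :
    RC Λ (fun a => Instance.edgeRoot (M a) (f a) (g a)) :=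
  (RC.natCast hM).add (hf.div (hf.sub hg))

theorem RC.pairForm (hM : NC Λ M) (hN : NC Λ N) (hp : PC Λ p) (hq : PC Λ q) :
    RC Λ (fun a => (Λ.inst a).pairForm (M a) (N a) (p a) (q a)) :=
  ((RC.ev (FC.form hN) hp).mul (RC.ev (FC.form hM) hq)).sub
    ((RC.ev (FC.form hM) hp).mul (RC.ev (FC.form hN) hq))

/-- The condition of `SeesOnlyTest` for one parameter. -/
theorem BC.seen_between (hf : RC Λ f) (hg : RC Λ g) (hh : RC Λ h) (hp : PC Λ p) :
    BC Λ (fun a => h a ∈ (Λ.inst a).seeing (p a) → f a < h a ∧ h a < g a) :=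
  (BC.mem_seeing hh hp).imp ((BC.lt hf hh).and (BC.lt hh hg))

theorem BC.seesOnlyTest (hf : RC Λ f) (hg : RC Λ g) (hp : PC Λ p) :
    BC Λ (fun a => (Λ.inst a).SeesOnlyTest (f a) (g a) (p a)) := by
  have hk := NC.k Λ
  have hk1 := hk.sub (NC.const Λ 1)
  refine BC.and ?_ (BC.and ?_ ?_)
  · exact BC.forall (Q := fun a j => ((j : ℝ)) ∈ (Λ.inst a).seeing (p a) → f a < j ∧ (j : ℝ) < g a)
      hk fun x => BC.seen_between (Λ := Λ.natExt x _) (hf.natExt x _) (hg.natExt x _)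
        (RC.natCast (NC.snd x hk)) (hp.natExt x _)
  · refine BC.forall hk1 fun x => BC.forall (NC.nf (Λ.natExt x _)) fun y => ?_
    have hj := (NC.snd x hk1).natExt y fun b => (Λ.inst b.1).nf
    have hq := NC.snd y (NC.nf (Λ.natExt x fun a => (Λ.inst a).k - 1))
    exact BC.seen_between (Λ := (Λ.natExt x _).natExt y _) ((hf.natExt x _).natExt y _)
      ((hg.natExt x _).natExt y _)
      (RC.edgeRoot hj (RC.ev (FC.form hq) (PC.cpt (RC.natCast hj)))
        (RC.ev (FC.form hq) (PC.cpt ((RC.natCast hj).add (RC.one _)))))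
      ((hp.natExt x _).natExt y _)
  · refine BC.forall hk1 fun x => BC.forall (NC.nf (Λ.natExt x _)) fun y =>
      BC.forall (NC.nf ((Λ.natExt x _).natExt y _)) fun z => ?_
    have hj := ((NC.snd x hk1).natExt y fun b => (Λ.inst b.1).nf).natExt z
      fun b => (Λ.inst b.1.1).nf
    have hq := (NC.snd y (NC.nf (Λ.natExt x fun a => (Λ.inst a).k - 1))).natExt z
      fun b => (Λ.inst b.1.1).nf
    have hr := NC.snd z (NC.nf ((Λ.natExt x fun a => (Λ.inst a).k - 1).natExt y
      fun b => (Λ.inst b.1).nf))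
    have hp' := ((hp.natExt x fun a => (Λ.inst a).k - 1).natExt y
      fun b => (Λ.inst b.1).nf).natExt z fun b => (Λ.inst b.1.1).nf
    exact BC.seen_between (Λ := ((Λ.natExt x _).natExt y _).natExt z _)
      (((hf.natExt x _).natExt y _).natExt z _) (((hg.natExt x _).natExt y _).natExt z _)
      (RC.edgeRoot hj (RC.pairForm hq hr (PC.cpt (RC.natCast hj)) hp')
        (RC.pairForm hq hr (PC.cpt ((RC.natCast hj).add (RC.one _))) hp')) hp'

/-- The layout extended by two indices of an arrangement. -/
abbrev Layout.vertexExt (Λ : Layout α) (x y z x' y' z' : ℕ) :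
    Layout ((((((α × ℕ) × ℕ) × ℕ) × ℕ) × ℕ) × ℕ) :=
  (Λ.idxExt x y z).idxExt x' y' z'

theorem BC.existsVertex {Q : α → ℝ × ℝ → Prop} (hf : RC Λ f) (hg : RC Λ g)
    (hQ : ∀ x y z x' y' z' v, PC (Λ.vertexExt x y z x' y' z') v →
      BC (Λ.vertexExt x y z x' y' z') (fun b => Q b.1.1.1.1.1.1 (v b))) :
    BC Λ (fun a => (Λ.inst a).ExistsVertex (f a) (g a) (Q a)) := by
  have hp := PC.cpt hf
  have hq := PC.cpt hg
  refine BC.existsIdx fun x y z => BC.existsIdx (Λ := Λ.idxExt x y z) fun x' y' z' =>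
    hQ x y z x' y' z' _ (PC.meet ?_ ?_)
  · exact FC.arr (Λ := Λ.vertexExt x y z x' y' z') ((hp.idxExt x y z).idxExt x' y' z')
      ((hq.idxExt x y z).idxExt x' y' z') ((IC.snd Λ x y z).idxExt x' y' z')
  · exact FC.arr (Λ := Λ.vertexExt x y z x' y' z') ((hp.idxExt x y z).idxExt x' y' z')
      ((hq.idxExt x y z).idxExt x' y' z') (IC.snd (Λ.idxExt x y z) x' y' z')

theorem RC.vertexExt (hf : RC Λ f) (x y z x' y' z' : ℕ) :
    RC (Λ.vertexExt x y z x' y' z') (fun b => f b.1.1.1.1.1.1) :=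
  (hf.idxExt x y z).idxExt x' y' z'

theorem PC.vertexExt (hp : PC Λ p) (x y z x' y' z' : ℕ) :
    PC (Λ.vertexExt x y z x' y' z') (fun b => p b.1.1.1.1.1.1) :=
  (hp.idxExt x y z).idxExt x' y' z'

theorem BC.gapTest (hf : RC Λ f) (hg : RC Λ g) :
    BC Λ (fun a => (Λ.inst a).GapTest (f a) (g a)) := by
  refine BC.existsVertex hf hg fun x y z x' y' z' v₁ h₁ => ?_
  have hf := hf.vertexExt x y z x' y' z'
  have hg := hg.vertexExt x y z x' y' z'
  refine BC.existsVertex hf hg fun x y z x' y' z' v₂ h₂ => ?_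
  have h₁ := h₁.vertexExt x y z x' y' z'
  have hf := hf.vertexExt x y z x' y' z'
  have hg := hg.vertexExt x y z x' y' z'
  refine BC.existsVertex hf hg fun x y z x' y' z' v₃ h₃ => ?_
  have h₁ := h₁.vertexExt x y z x' y' z'
  have h₂ := h₂.vertexExt x y z x' y' z'
  have hf := hf.vertexExt x y z x' y' z'
  have hg := hg.vertexExt x y z x' y' z'
  refine BC.existsVertex hf hg fun x y z x' y' z' v₄ h₄ => ?_
  have h₁ := h₁.vertexExt x y z x' y' z'
  have h₂ := h₂.vertexExt x y z x' y' z'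
  have h₃ := h₃.vertexExt x y z x' y' z'
  have hf := hf.vertexExt x y z x' y' z'
  have hg := hg.vertexExt x y z x' y' z'
  exact (BC.inReg (PC.avg4 h₁ h₂ h₃ h₄)).and (BC.seesOnlyTest hf hg (PC.avg4 h₁ h₂ h₃ h₄))

theorem RC.validated (hf : RC Λ f) (hg : RC Λ g) :
    RC Λ (fun a => (Λ.inst a).validated (f a) (g a)) := by
  classical
  exact RC.ite ((BC.lt hf hg).and ((BC.le (RC.zero Λ) hg).and ((BC.le hg
    ((RC.natCast (NC.k Λ)).sub (RC.one Λ))).and (BC.gapTest hf hg).not))) hg hf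

theorem RC.quadRoot {f₁ f₂ f₃ f₄ : α → ℝ} (h₁ : RC Λ f₁) (h₂ : RC Λ f₂) (h₃ : RC Λ f₃)
    (h₄ : RC Λ f₄) : RC Λ (fun a => quadRoot (f₁ a) (f₂ a) (f₃ a) (f₄ a)) := by
  have two := RC.const Λ 2
  have four := RC.const Λ 4
  have hc₂ := two.mul ((h₂.add h₄).sub (two.mul h₃))
  have hc₁ := (h₄.sub h₂).sub hc₂
  refine (RC.ite (BC.eq hc₂ (RC.zero Λ)) (h₂.neg.div (h₄.sub h₂))
    ((hc₁.neg.add (h₁.mul ((hc₁.mul hc₁).sub ((four.mul hc₂).mul h₂)).sqrt)).div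
      (two.mul hc₂))).congr fun a => ?_
  simp only [Watchmen.quadRoot, sq, Nat.cast_ofNat]

theorem RC.tri {k : α → ℕ × ℕ × ℕ} (hf : RC Λ f) (hg : RC Λ g) (hi : IC Λ i) (hj : IC Λ j)
    (hk : IC Λ k) : RC Λ (fun a => (Λ.inst a).tri (f a) (g a) (i a) (j a) (k a)) :=
  RC.det3 (FC.arr (PC.cpt hf) (PC.cpt hg) hi) (FC.arr (PC.cpt hf) (PC.cpt hg) hj)
    (FC.arr (PC.cpt hf) (PC.cpt hg) hk)

theorem RC.candidate {k : α → ℕ × ℕ × ℕ} (hf : RC Λ f) (hM : NC Λ M) (hi : IC Λ i) (hj : IC Λ j)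
    (hk : IC Λ k) (hg : RC Λ g) :
    RC Λ (fun a => (Λ.inst a).candidate (f a) (M a) (i a) (j a) (k a) (g a)) := by
  have hm := RC.natCast hM
  have h2 := (RC.one Λ).div (RC.const Λ 2)
  refine (hm.add (RC.quadRoot hg (RC.tri hf hm hi hj hk) (RC.tri hf (hm.add h2) hi hj hk)
    (RC.tri hf (hm.add (RC.one Λ)) hi hj hk))).congr fun a => ?_
  simp only [Instance.candidate, Nat.cast_ofNat]

theorem RC.next (hf : RC Λ f) : RC Λ (fun a => (Λ.inst a).next (f a)) := by
  have hk := NC.k Λ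
  have hk1 := hk.sub (NC.const Λ 1)
  refine RC.max (RC.foldMax hk hf fun x => RC.validated (Λ := Λ.natExt x _) (hf.natExt x _)
    (RC.natCast (NC.snd x hk))) (RC.foldMax hk1 hf fun u => ?_)
  have hj := NC.snd u hk1
  have hf := hf.natExt u fun a => (Λ.inst a).k - 1
  refine RC.maxIdx hf fun x y z i₁ h₁ => ?_
  have hj := hj.idxExt x y z
  have hf := hf.idxExt x y z
  refine RC.maxIdx hf fun x y z i₂ h₂ => ?_
  have h₁ := h₁.idxExt x y z
  have hj := hj.idxExt x y z
  have hf := hf.idxExt x y z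
  refine RC.maxIdx hf fun x y z i₃ h₃ => ?_
  have h₂ := h₂.idxExt x y z
  have h₁ := h₁.idxExt x y z
  have hj := hj.idxExt x y z
  have hf := hf.idxExt x y z
  exact RC.max (RC.validated hf (RC.candidate hf hj h₁ h₂ h₃ (RC.one _)))
    (RC.validated hf (RC.candidate hf hj h₁ h₂ h₃ (RC.one _).neg))

end RealRAM

/-! ### The program -/

namespace RealRAM

open Watchmen

/-- A sequence of instructions. -/
def block : List Instr → Program
  | [] => .skip
  | i :: l => .seq (.basic i) (block l)

theorem Runs.block (l : List Instr) (σ : State) :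
    Runs (block l) σ (l.length + 1) (fun τ => τ = l.foldl (fun σ i => i.apply σ) σ) := by
  induction l generalizing σ with
  | nil => exact ⟨1, σ, .skip σ, le_rfl, rfl⟩
  | cons i l ih =>
    refine ((Runs.basic i (Q := fun τ => τ = i.apply σ) rfl).seq (T' := l.length + 1)
      fun τ hτ => ?_).mono (by simp; omega) fun _ h => h
    subst hτ
    exact ih _

/-- The layout of a stage of the search. The number `a.2.1` is not stored; it is part of the size
and bounds the number of viewpoints. The natural variables `3, 4, 5` hold the numbers of robots,
of viewpoints of the current robot and of all viewpoints, the real variables `1, 2, 3` the budget,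
the last viewpoint and the starting point; the real variable `4` is zero, and the arrays are those
of the output. -/
noncomputable def searchLayout : Layout (Instance × ℕ × Search) where
  inst a := a.1
  size a := a.1.n + a.1.k + a.1.m + a.2.1
  rep a σ := ((∀ i < 3, σ.nat i = a.1.input.nat i) ∧ σ.real 0 = a.1.input.real 0 ∧
      ∀ A < 4, σ.realArr A = a.1.input.realArr A) ∧
    (σ.nat 3 = a.2.2.robots ∧ σ.nat 4 = a.2.2.num ∧ σ.nat 5 = a.2.2.cnt) ∧
    (σ.real 1 = a.2.2.budget ∧ σ.real 2 = a.2.2.front ∧ σ.real 3 = a.2.2.start ∧ σ.real 4 = 0) ∧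
    (σ.natArr 0 = a.2.2.begins ∧ σ.natArr 1 = a.2.2.lens ∧ σ.realArr 4 = a.2.2.firsts ∧
      σ.realArr 5 = a.2.2.lasts ∧ σ.realArr 6 = a.2.2.views) ∧
    a.2.2.robots ≤ a.1.m ∧ a.2.2.num ≤ a.2.2.cnt ∧ a.2.2.cnt ≤ a.2.1 + 2 * a.1.m
  lvl := 6
  lvl_ge := by omega
  size_ge a := Nat.le_add_right _ _
  stable := by
    rintro a σ τ ⟨⟨h1, h2, h3⟩, ⟨h4, h5, h6⟩, ⟨h7, h8, h9, h10⟩, h11, h12⟩ ⟨e1, e2, e3, e4⟩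
    refine ⟨⟨fun i hi => (e1 i (by omega)).trans (h1 i hi), (e2 0 (by omega)).trans h2,
      fun A hA => ?_⟩, ⟨(e1 3 (by omega)).trans h4, (e1 4 (by omega)).trans h5,
      (e1 5 (by omega)).trans h6⟩, ⟨(e2 1 (by omega)).trans h7, (e2 2 (by omega)).trans h8,
      (e2 3 (by omega)).trans h9, (e2 4 (by omega)).trans h10⟩, ?_, h12⟩
    · rw [e4]; exact h3 A hA
    · rw [e3, e4]; exact h11
  base_nat h := h.1.1
  base_real h := h.1.2.1
  base_arr h := h.1.2.2

theorem rc_budget : RC searchLayout (fun a => a.2.2.budget) :=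
  RC.var (x := 1) (by decide) fun _ _ h => h.2.2.1.1

theorem rc_front : RC searchLayout (fun a => a.2.2.front) :=
  RC.var (x := 2) (by decide) fun _ _ h => h.2.2.1.2.1

theorem rc_start : RC searchLayout (fun a => a.2.2.start) :=
  RC.var (x := 3) (by decide) fun _ _ h => h.2.2.1.2.2.1

theorem le_size_sq {M : Instance × ℕ × Search → ℕ}
    (h : ∀ a σ, searchLayout.rep a σ → M a ≤ a.2.1 + 2 * a.1.m) :
    ∃ b, ∀ a σ, searchLayout.rep a σ → M a ≤ searchLayout.size a ^ b := by
  refine ⟨2, fun a σ ha => (h a σ ha).trans ?_⟩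
  have h1 := searchLayout.two_le_size a
  have h2 : a.2.1 + 2 * a.1.m ≤ 2 * searchLayout.size a := by
    change _ ≤ 2 * (a.1.n + a.1.k + a.1.m + a.2.1)
    omega
  rw [sq]
  exact h2.trans (Nat.mul_le_mul_right _ h1)

theorem nc_robots : NC searchLayout (fun a => a.2.2.robots) :=
  NC.var (x := 3) (by decide) (fun _ _ h => h.2.1.1) (le_size_sq fun a σ h => by
    have := h.2.2.2.2.1
    omega)

theorem nc_num : NC searchLayout (fun a => a.2.2.num) :=
  NC.var (x := 4) (by decide) (fun _ _ h => h.2.1.2.1) (le_size_sq fun a σ h => by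
    have := h.2.2.2.2
    omega)

theorem nc_cnt : NC searchLayout (fun a => a.2.2.cnt) :=
  NC.var (x := 5) (by decide) (fun _ _ h => h.2.1.2.2) (le_size_sq fun a σ h => by
    have := h.2.2.2.2
    omega)

theorem rc_limit : RC searchLayout (fun a => a.1.limit a.2.2) :=
  ((RC.arc rc_start).add rc_budget).sub
    (((RC.natCast nc_num).add (RC.one _)).mul (RC.tm searchLayout))

theorem bc_canExtend : BC searchLayout (fun a => a.1.CanExtend a.2.2) :=
  (BC.natLt (NC.const _ 0) nc_num).and (BC.lt (RC.arc rc_front) rc_limit)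

theorem bc_robots_lt : BC searchLayout (fun a => a.2.2.robots < a.1.m) :=
  BC.natLt nc_robots (NC.m searchLayout)

theorem bc_gapTest : BC searchLayout (fun a => a.1.GapTest a.2.2.front a.1.k) :=
  BC.gapTest rc_front (RC.natCast (NC.k searchLayout))

theorem rc_newFront : RC searchLayout (fun a => a.1.newFront a.2.2) := by
  classical
  exact (RC.ite bc_canExtend (RC.min (RC.next rc_front) (RC.arcInv rc_limit))
    (RC.ite bc_robots_lt (RC.next rc_front) (RC.one _).neg)).congr fun a => by
      rw [Instance.newFront]; rfl

theorem rc_newStart : RC searchLayout (fun a => a.1.newStart a.2.2) := by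
  classical
  exact (RC.ite bc_canExtend rc_start
    (RC.ite bc_robots_lt (RC.next rc_front) (RC.zero _))).congr fun a => by
      rw [Instance.newStart]; rfl

theorem rc_newBudget : RC searchLayout (fun a => a.1.newBudget a.2.2) := by
  classical
  exact (RC.ite bc_canExtend rc_budget
    (RC.ite bc_robots_lt rc_budget (rc_budget.add rc_budget))).congr fun a => by
      simp only [Instance.newBudget]

theorem nc_newRobots : NC searchLayout (fun a => a.1.newRobots a.2.2) := by
  classical
  exact (NC.ite bc_canExtend nc_robots
    (NC.ite bc_robots_lt (nc_robots.add (NC.const _ 1)) (NC.const _ 0))).congr fun a => by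
      simp only [Instance.newRobots]

theorem nc_newNum : NC searchLayout (fun a => a.1.newNum a.2.2) := by
  classical
  exact (NC.ite bc_canExtend (nc_num.add (NC.const _ 1))
    (NC.ite bc_robots_lt (NC.const _ 1) (NC.const _ 0))).congr fun a => by
      simp only [Instance.newNum]

theorem nc_newCnt : NC searchLayout (fun a => a.1.newCnt a.2.2) := by
  classical
  exact (NC.ite bc_canExtend (nc_cnt.add (NC.const _ 1))
    (NC.ite bc_robots_lt (nc_cnt.add (NC.const _ 1)) (NC.const _ 0))).congr fun a => by
      simp only [Instance.newCnt]

/-- Storing the results of a step, which are held in the real variables `7, 8, 9` and the natural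
variables `10, 11, 12`. -/
def storeStep : List Instr :=
  [.natConst 6 1, .natSub 7 10 6, .natSub 8 12 6, .natSub 9 12 11,
    .natStore 0 7 9, .natStore 1 7 11, .realStore 4 7 8, .realStore 5 7 7, .realStore 6 8 7,
    .realAdd 1 9 4, .realAdd 2 7 4, .realAdd 3 8 4,
    .natConst 6 0, .natAdd 3 10 6, .natAdd 4 11 6, .natAdd 5 12 6]

/-- The stage `s` is stored, and the real variable `6` tells whether the search has to go on. -/
def StageAt (I : Instance) (g : ℕ) (s : Search) (σ : State) : Prop :=
  open Classical in searchLayout.rep (I, g, s) σ ∧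
    σ.real 6 = if I.GapTest s.front I.k then 1 else 0

/-- The indices `robots - 1` and `cnt - 1` are differences of natural numbers: after a doubling
they are `0`, and the entries written there are not in use. -/
theorem rep_storeStep {I : Instance} {g : ℕ} {s : Search} {σ τ : State}
    (hσ : searchLayout.rep (I, g, s) σ) (hτ : Agree 6 σ τ) (h7 : τ.real 7 = I.newFront s)
    (h8 : τ.real 8 = I.newStart s) (h9 : τ.real 9 = I.newBudget s)
    (h10 : τ.nat 10 = I.newRobots s) (h11 : τ.nat 11 = I.newNum s) (h12 : τ.nat 12 = I.newCnt s)
    (hb : (I.step s).robots ≤ I.m ∧ (I.step s).num ≤ (I.step s).cnt ∧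
      (I.step s).cnt ≤ g + 2 * I.m) :
    searchLayout.rep (I, g, I.step s) (storeStep.foldl (fun σ i => i.apply σ) τ) := by
  obtain ⟨⟨e1, e2, e3⟩, ⟨e4, e5, e6⟩, ⟨e7, e8, e9, e10⟩, ⟨e11, e12, e13, e14, e15⟩, -⟩ :=
    searchLayout.stable hσ hτ
  refine ⟨⟨fun i hi => ?_, ?_, fun A hA => ?_⟩, ⟨?_, ?_, ?_⟩, ⟨?_, ?_, ?_, ?_⟩,
    ⟨?_, ?_, ?_, ?_, ?_⟩, hb⟩
  · rw [← e1 i hi]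
    interval_cases i <;> simp [storeStep, Instr.apply]
  · rw [← e2]; simp [storeStep, Instr.apply]
  · rw [← e3 A hA]
    interval_cases A <;> simp [storeStep, Instr.apply]
  · simp [storeStep, Instr.apply, h10, Instance.step]
  · simp [storeStep, Instr.apply, h11, Instance.step]
  · simp [storeStep, Instr.apply, h12, Instance.step]
  · simpa [storeStep, Instr.apply, h9, Instance.step] using e10
  · simpa [storeStep, Instr.apply, h7, Instance.step] using e10
  · simpa [storeStep, Instr.apply, h8, Instance.step] using e10
  · simpa [storeStep, Instr.apply] using e10
  · simp [storeStep, Instr.apply, h10, h11, h12, e11, Instance.step]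
  · simp [storeStep, Instr.apply, h10, h11, e12, Instance.step]
  · simp [storeStep, Instr.apply, h10, h8, e13, Instance.step]
  · simp [storeStep, Instr.apply, h10, h7, e14, Instance.step]
  · simp [storeStep, Instr.apply, h12, h7, e15, Instance.step]

/-- A program for one step of the search. The new data are computed from the old ones before any of
them is stored. Of the summands of the time bound, `17` accounts for storing, the others for seven
evaluations. -/
theorem exists_stepProgram : ∃ p b, ∀ I g s σ, searchLayout.rep (I, g, s) σ →
    ((I.step s).robots ≤ I.m ∧ (I.step s).num ≤ (I.step s).cnt ∧
      (I.step s).cnt ≤ g + 2 * I.m) →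
    Runs p σ (6 * (I.n + I.k + I.m + g) ^ b + 17 + (I.n + I.k + I.m + g) ^ b)
      (StageAt I g (I.step s)) := by
  obtain ⟨p₁, b₁, h₁⟩ := rc_newFront 7 (by decide)
  obtain ⟨p₂, b₂, h₂⟩ := rc_newStart 8 (by decide)
  obtain ⟨p₃, b₃, h₃⟩ := rc_newBudget 9 (by decide)
  obtain ⟨p₄, b₄, h₄⟩ := nc_newRobots.2 10 (by decide)
  obtain ⟨p₅, b₅, h₅⟩ := nc_newNum.2 11 (by decide)
  obtain ⟨p₆, b₆, h₆⟩ := nc_newCnt.2 12 (by decide)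
  obtain ⟨p₇, b₇, h₇⟩ := bc_gapTest 6 (by decide)
  refine ⟨.seq (.seq (.seq (.seq (.seq (.seq (.seq p₁ p₂) p₃) p₄) p₅) p₆) (block storeStep)) p₇,
    b₁ + b₂ + b₃ + b₄ + b₅ + b₆ + b₇, fun I g s σ hσ hb => ?_⟩
  set S := I.n + I.k + I.m + g with hS
  have hS2 : 2 ≤ S := searchLayout.two_le_size (I, g, s)
  have hpow : ∀ b ≤ b₁ + b₂ + b₃ + b₄ + b₅ + b₆ + b₇,
      S ^ b ≤ S ^ (b₁ + b₂ + b₃ + b₄ + b₅ + b₆ + b₇) := fun b hb =>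
    Nat.pow_le_pow_right (by omega) hb
  have lvl : searchLayout.lvl = 6 := rfl
  have hrep : ∀ τ, Agree 6 σ τ → searchLayout.rep (I, g, s) τ := fun τ h =>
    searchLayout.stable hσ h
  refine (((((((((h₁ (I, g, s) σ hσ).mono (hpow b₁ (by omega)) fun _ h => h).seq
    (R := fun τ => τ.real 7 = I.newFront s ∧ τ.real 8 = I.newStart s ∧ Agree 6 σ τ)
    fun τ hτ => ((h₂ _ τ (hrep τ (hτ.2.mono (by omega)))).mono (hpow b₂ (by omega))
      fun υ hυ => ?_)).seq
    (R := fun τ => τ.real 7 = I.newFront s ∧ τ.real 8 = I.newStart s ∧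
      τ.real 9 = I.newBudget s ∧ Agree 6 σ τ)
    fun τ hτ => ((h₃ _ τ (hrep τ hτ.2.2)).mono (hpow b₃ (by omega)) fun υ hυ => ?_)).seq
    (R := fun τ => τ.real 7 = I.newFront s ∧ τ.real 8 = I.newStart s ∧
      τ.real 9 = I.newBudget s ∧ τ.nat 10 = I.newRobots s ∧ Agree 6 σ τ)
    fun τ hτ => ((h₄ _ τ (hrep τ hτ.2.2.2)).mono (hpow b₄ (by omega)) fun υ hυ => ?_)).seq
    (R := fun τ => τ.real 7 = I.newFront s ∧ τ.real 8 = I.newStart s ∧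
      τ.real 9 = I.newBudget s ∧ τ.nat 10 = I.newRobots s ∧ τ.nat 11 = I.newNum s ∧ Agree 6 σ τ)
    fun τ hτ => ((h₅ _ τ (hrep τ hτ.2.2.2.2)).mono (hpow b₅ (by omega)) fun υ hυ => ?_)).seq
    (R := fun τ => τ.real 7 = I.newFront s ∧ τ.real 8 = I.newStart s ∧
      τ.real 9 = I.newBudget s ∧ τ.nat 10 = I.newRobots s ∧ τ.nat 11 = I.newNum s ∧
      τ.nat 12 = I.newCnt s ∧ Agree 6 σ τ)
    fun τ hτ => ((h₆ _ τ (hrep τ hτ.2.2.2.2.2)).mono (hpow b₆ (by omega)) fun υ hυ => ?_)).seq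
    (R := fun τ => searchLayout.rep (I, g, I.step s) τ)
    fun τ hτ => (Runs.block storeStep τ).mono (le_refl 17) fun υ hυ => ?_).seq
    fun τ hτ => (h₇ _ τ hτ).mono (hpow b₇ (by omega)) fun υ hυ => ?_).mono ?_ fun _ h => h
  · exact ⟨(hυ.2.2.1 7 (by omega)).trans hτ.1, hυ.1,
      (hτ.2.mono (by omega)).trans (hυ.2.mono (by omega))⟩
  · obtain ⟨e1, e2, e3⟩ := hτ
    exact ⟨(hυ.2.2.1 7 (by omega)).trans e1, (hυ.2.2.1 8 (by omega)).trans e2, hυ.1,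
      e3.trans (hυ.2.mono (by omega))⟩
  · obtain ⟨e1, e2, e3, e4⟩ := hτ
    exact ⟨(hυ.2.2.1 7 (by omega)).trans e1, (hυ.2.2.1 8 (by omega)).trans e2,
      (hυ.2.2.1 9 (by omega)).trans e3, hυ.1, e4.trans (hυ.2.mono (by omega))⟩
  · obtain ⟨e1, e2, e3, e4, e5⟩ := hτ
    exact ⟨(hυ.2.2.1 7 (by omega)).trans e1, (hυ.2.2.1 8 (by omega)).trans e2,
      (hυ.2.2.1 9 (by omega)).trans e3, (hυ.2.1 10 (by omega)).trans e4, hυ.1,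
      e5.trans (hυ.2.mono (by omega))⟩
  · obtain ⟨e1, e2, e3, e4, e5, e6⟩ := hτ
    exact ⟨(hυ.2.2.1 7 (by omega)).trans e1, (hυ.2.2.1 8 (by omega)).trans e2,
      (hυ.2.2.1 9 (by omega)).trans e3, (hυ.2.1 10 (by omega)).trans e4,
      (hυ.2.1 11 (by omega)).trans e5, hυ.1, e6.trans (hυ.2.mono (by omega))⟩
  · obtain ⟨e1, e2, e3, e4, e5, e6, e7⟩ := hτ
    rw [hυ]
    exact rep_storeStep hσ e7 e1 e2 e3 e4 e5 e6 hb
  · exact ⟨searchLayout.stable hτ hυ.2, hυ.1⟩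
  · omega

/-- The first instructions: the budget is the measurement time, and the last viewpoint is `-1`. -/
def initBlock : List Instr :=
  [.realConst 5 1, .realSub 2 4 5, .realAdd 1 0 4]

theorem rep_init (I : Instance) (g : ℕ) : searchLayout.rep (I, g, Search.init I)
    (initBlock.foldl (fun σ i => i.apply σ) I.input) := by
  refine ⟨⟨fun i hi => ?_, ?_, fun A hA => ?_⟩, ⟨?_, ?_, ?_⟩, ⟨?_, ?_, ?_, ?_⟩,
    ⟨?_, ?_, ?_, ?_, ?_⟩, Nat.zero_le _, le_rfl, Nat.zero_le _⟩
  · simp [initBlock, Instr.apply]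
  · simp [initBlock, Instr.apply]
  · simp [initBlock, Instr.apply]
  all_goals simp [initBlock, Instr.apply, Instance.input, Search.init]

/-- One step of the clean-up, which assigns an empty path to a robot that is not in use. -/
def clearBlock : List Instr :=
  [.natStore 1 3 7, .realStore 4 3 4, .realStore 5 3 4, .natAdd 3 3 6]

/-- The clean-up leaves the paths of the robots in use unchanged and gives empty paths to the
others. -/
theorem clear_runs (I : Instance) (g : ℕ) (s : Search) (σ : State)
    (hσ : searchLayout.rep (I, g, s) σ) :
    Runs (.seq (block [.natConst 6 1, .natConst 7 0]) (.whileDo (.natLt 3 2) (block clearBlock))) σ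
      (3 + ((I.m - s.robots) * (5 + 1) + 1)) (fun τ =>
        (∀ i < s.robots, τ.natArr 0 i = s.begins i ∧ τ.natArr 1 i = s.lens i ∧
          τ.realArr 4 i = s.firsts i ∧ τ.realArr 5 i = s.lasts i) ∧ τ.realArr 6 = s.views ∧
        ∀ i, s.robots ≤ i → i < I.m →
          τ.natArr 1 i = 0 ∧ τ.realArr 4 i = 0 ∧ τ.realArr 5 i = 0) := by
  obtain ⟨⟨e1, e2, e3⟩, ⟨e4, e5, e6⟩, ⟨e7, e8, e9, e10⟩, ⟨e11, e12, e13, e14, e15⟩, hm, -⟩ := hσ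
  have hm : s.robots ≤ I.m := hm
  have e1 : σ.nat 2 = I.m := by rw [e1 2 (by omega)]; simp [Instance.input]
  let Inv : ℕ → State → Prop := fun j τ =>
    (τ.nat 2 = I.m ∧ τ.nat 3 = s.robots + j ∧ τ.nat 6 = 1 ∧ τ.nat 7 = 0 ∧ τ.real 4 = 0) ∧
    (∀ i < s.robots, τ.natArr 0 i = s.begins i ∧ τ.natArr 1 i = s.lens i ∧
      τ.realArr 4 i = s.firsts i ∧ τ.realArr 5 i = s.lasts i) ∧ τ.realArr 6 = s.views ∧
    ∀ i, s.robots ≤ i → i < s.robots + j →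
      τ.natArr 1 i = 0 ∧ τ.realArr 4 i = 0 ∧ τ.realArr 5 i = 0
  refine (Runs.block _ σ).seq fun τ hτ => (Runs.while_count (Inv := Inv) (T := 5)
    (fun j hj υ hυ => (Runs.block clearBlock υ).mono le_rfl fun ω hω => ?_)
    (fun j hj υ hυ => ?_) τ ?_).mono le_rfl fun υ hυ => ?_
  · obtain ⟨⟨i1, i2, i3, i4, i5⟩, i6, i7, i8⟩ := hυ
    subst hω
    refine ⟨⟨?_, ?_, ?_, ?_, ?_⟩, fun i hi => ?_, ?_, fun i hi hi' => ?_⟩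
    · simpa [clearBlock, Instr.apply] using i1
    · simp [clearBlock, Instr.apply, i2, i3, Nat.add_assoc]
    · simpa [clearBlock, Instr.apply] using i3
    · simpa [clearBlock, Instr.apply] using i4
    · simpa [clearBlock, Instr.apply] using i5
    · have hne : i ≠ s.robots + j := by omega
      simpa [clearBlock, Instr.apply, i2, Function.update_of_ne hne] using i6 i hi
    · simpa [clearBlock, Instr.apply] using i7
    · by_cases hij : i = s.robots + j
      · simp [clearBlock, Instr.apply, i2, i4, i5, hij]
      · simpa [clearBlock, Instr.apply, i2, Function.update_of_ne hij] using i8 i hi (by omega)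
  · simp only [Test.Holds, hυ.1.1, hυ.1.2.1]
    omega
  · subst hτ
    refine ⟨⟨?_, ?_, ?_, ?_, ?_⟩, fun i hi => ?_, ?_, fun i hi hi' => by omega⟩
    · simpa [Instr.apply] using e1
    · simpa [Instr.apply] using e4
    · simp [Instr.apply]
    · simp [Instr.apply]
    · simpa [Instr.apply] using e10
    · simp [Instr.apply, e11, e12, e13, e14]
    · simpa [Instr.apply] using e15
  · obtain ⟨-, i6, i7, i8⟩ := hυ
    exact ⟨i6, i7, fun i hi hi' => i8 i hi (by omega)⟩

/-- The program, with a bound for its running time in terms of the number `v` of steps of the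
search. -/
theorem exists_program : ∃ (prog : Program) (b : ℕ), ∀ (I : Instance) (V : Finset ℝ) (R v : ℕ),
    InjOn I.curve I.params → I.ChainVisible → (∀ x ∈ V, x ∈ I.params) →
    (∀ x, I.InReg x → ∃ v ∈ V, v ∈ I.seeing x) →
    (∃ S : I.Plan, S.IsFeasible ∧ S.maxCost + I.tm ≤ I.tm * 2 ^ R) →
    I.Invariant (Search.init I) V R v →
    Runs prog I.input
      (4 + (I.n + I.k + I.m + V.card) ^ b +
        (v * (7 * (I.n + I.k + I.m + V.card) ^ b + 17 + 1) + 1) + (4 + 6 * I.m))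
      (fun σ => ∃ s v', I.Invariant s V R v' ∧ (I.output σ).IsFeasible ∧
        (I.output σ).maxCost ≤ s.budget) := by
  classical
  obtain ⟨pf, bf, hpf⟩ := bc_gapTest 6 (by decide)
  obtain ⟨ps, bs, hps⟩ := exists_stepProgram
  refine ⟨.seq (.seq (.seq (block initBlock) pf) (.whileDo (.realLt 4 6) ps))
    (.seq (block [.natConst 6 1, .natConst 7 0]) (.whileDo (.natLt 3 2) (block clearBlock))),
    bf + bs, fun I V R v hinj hI hVp hV hR hinv => ?_⟩
  set S := I.n + I.k + I.m + V.card with hS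
  have hS2 : 2 ≤ S := searchLayout.two_le_size (I, V.card, Search.init I)
  have hgap : ∀ s v, I.Invariant s V R v → (I.Gap s.front I.k ↔ I.GapTest s.front I.k) :=
    fun s v hs => Instance.gap_iff hI hs.valid.front_le (by positivity)
  let Inv : ℕ → State → Prop := fun v τ => ∃ s, I.Invariant s V R v ∧ StageAt I V.card s τ
  have hbody : ∀ v τ, Inv v τ → (Test.realLt 4 6).Holds τ →
      Runs ps τ (6 * S ^ bs + 17 + S ^ bs) (fun υ => ∃ v' < v, Inv v' υ) := by
    rintro v τ ⟨s, hs, hrep, hflag⟩ htest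
    have hg : I.Gap s.front I.k := by
      rw [hgap s v hs]
      by_contra hno
      rw [if_neg hno] at hflag
      have h4 : τ.real 4 = 0 := hrep.2.2.1.2.2.2
      simp [Test.Holds, h4, hflag] at htest
    obtain ⟨v', hv', hs'⟩ := hs.step hinj hI hVp hV hR hg
    have h5 := hs'.cnt_le
    exact (hps I V.card s τ hrep ⟨hs'.valid.robots_le, hs'.valid.num_le, by omega⟩).mono le_rfl
      fun υ hυ => ⟨v', hv', _, hs', hυ⟩
  have hstart : Runs (.seq (block initBlock) pf) I.input (4 + S ^ bf) (Inv v) := by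
    refine (Runs.block initBlock I.input).seq fun τ hτ => ?_
    have hrep := rep_init I V.card
    rw [← hτ] at hrep
    exact (hpf _ τ hrep).mono le_rfl fun υ hυ =>
      ⟨_, hinv, searchLayout.stable hrep hυ.2, hυ.1⟩
  refine ((hstart.seq fun τ hτ => Runs.while hbody v τ hτ).seq
    (T' := 4 + 6 * I.m) fun τ hτ => ?_).mono ?_ fun _ h => h
  · obtain ⟨⟨v', s, hs, hrep, hflag⟩, htest⟩ := hτ
    have hg : ¬ I.Gap s.front I.k := by
      rw [hgap s v' hs]
      intro hyes
      rw [if_pos hyes] at hflag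
      have h4 : τ.real 4 = 0 := hrep.2.2.1.2.2.2
      simp [Test.Holds, h4, hflag] at htest
    refine (clear_runs I V.card s τ hrep).mono (by omega) ?_
    rintro υ ⟨h1, h2, h3⟩
    refine ⟨s, v', hs, hs.valid.isFeasible hg (fun i hi => ?_) fun i hi => ?_⟩
    · obtain ⟨e1, e2, e3, e4⟩ := h1 i hi
      refine ⟨e3, e4, ?_⟩
      simp only [Instance.output, e1, e2, h2]
    · obtain ⟨e1, e2, e3⟩ := h3 i (not_lt.1 hi) i.2
      refine ⟨e2, e3, ?_⟩
      simp only [Instance.output, e1, Finset.range_zero, Finset.image_empty]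
  · have h1 : S ^ bf ≤ S ^ (bf + bs) := Nat.pow_le_pow_right (by omega) (by omega)
    have h2 : S ^ bs ≤ S ^ (bf + bs) := Nat.pow_le_pow_right (by omega) (by omega)
    have h3 : v * (6 * S ^ bs + 17 + S ^ bs + 1) ≤ v * (7 * S ^ (bf + bs) + 17 + 1) :=
      Nat.mul_le_mul_left _ (by omega)
    omega

end RealRAM

theorem mainTheorem2 :
    ∃ (prog : RealRAM.Program) (c d : ℕ), ∀ I : Watchmen.Instance,
      Watchmen.IsStreetPolygon I.polygon →
      I.IsChainVisibleWatchmanCurve →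
      I.viewpointCounts.Nonempty →
      ∃ (t : ℕ) (σ : RealRAM.State),
        RealRAM.Exec prog I.input t σ ∧
        (t : ℝ) ≤ (c : ℝ) * ((I.n : ℝ) + I.k + I.m + I.minViewpoints) ^ d *
          (1 + Real.logb 2 (I.optCost / I.tm)) ∧
        (I.output σ).IsFeasible ∧
        (I.output σ).maxCost ≤ 4 * I.optCost := by
  obtain ⟨prog, b, hprog⟩ := RealRAM.exists_program
  refine ⟨prog, 300, b + 1, fun I _ hC hne => ?_⟩
  obtain ⟨V, hVp, hVs, hVg⟩ := Nat.sInf_mem hne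
  have hcard : V.card = I.minViewpoints := hVg
  have hfeas := Watchmen.Instance.exists_isFeasible (fun v hv => hVp hv) hVs
  obtain ⟨v, hv, hinv⟩ := Watchmen.Instance.invariant_init (I := I) (V := V)
    (R := ⌊Real.logb 2 (I.optCost / I.tm)⌋₊ + 2)
  obtain ⟨t, σ, hexec, ht, s, v', hs, hout, hcost⟩ := hprog I V _ v hC.1
    (Watchmen.Instance.chainVisible hC) (fun v hv => hVp hv)
    ((Watchmen.Instance.seesAll_iff hVp).1 hVs)
    (Watchmen.Instance.exists_maxCost_add_le hfeas) hinv
  refine ⟨t, σ, hexec, ?_, hout, hcost.trans (hs.budget_le_optCost hfeas)⟩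
  have hlog : 0 ≤ Real.logb 2 (I.optCost / I.tm) :=
    Real.logb_nonneg one_lt_two ((one_le_div I.tm_pos).2 (Watchmen.Instance.tm_le_optCost hfeas))
  have hfloor := Nat.floor_le hlog
  rw [hcard] at ht hv
  set l := Real.logb 2 (I.optCost / I.tm)
  set S := I.n + I.k + I.m + I.minViewpoints with hS
  have hSr : (I.n : ℝ) + I.k + I.m + I.minViewpoints = (S : ℝ) := by rw [hS]; push_cast; rfl
  have hS1 : 1 ≤ S := by have := NeZero.pos I.n; omega
  have hP : 1 ≤ S ^ b := Nat.one_le_pow _ _ hS1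
  -- all terms of the time bound are at most multiples of `S ^ (b + 1) * (⌊l⌋₊ + 3)`
  have hv' : v ≤ 3 * S * (⌊l⌋₊ + 3) :=
    hv.trans (Nat.mul_le_mul_right _ (by omega))
  have h1 : v * (7 * S ^ b + 17 + 1) ≤ 3 * S * (⌊l⌋₊ + 3) * (25 * S ^ b) :=
    Nat.mul_le_mul hv' (by omega)
  have h2 : S * S ^ b = S ^ (b + 1) := by rw [pow_succ, mul_comm]
  have h3 : S ^ b ≤ S ^ (b + 1) := Nat.pow_le_pow_right hS1 (Nat.le_succ b)
  have h4 : S ≤ S ^ (b + 1) := by rw [← h2]; exact Nat.le_mul_of_pos_right _ hP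
  have h5 : t ≤ 75 * (S ^ (b + 1) * (⌊l⌋₊ + 3)) + 16 * S ^ (b + 1) := by
    have h6 : 3 * S * (⌊l⌋₊ + 3) * (25 * S ^ b) = 75 * (S ^ (b + 1) * (⌊l⌋₊ + 3)) := by
      rw [← h2]; ring
    omega
  rw [hSr]
  have h7 : (t : ℝ) ≤ 75 * ((S : ℝ) ^ (b + 1) * ((⌊l⌋₊ : ℝ) + 3)) + 16 * (S : ℝ) ^ (b + 1) := by
    exact_mod_cast h5
  have h8 : (0 : ℝ) ≤ (S : ℝ) ^ (b + 1) := by positivity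
  have h9 := mul_le_mul_of_nonneg_left hfloor h8
  have h10 := mul_nonneg h8 hlog
  push_cast
  nlinarith
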